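/- Throughout, graphs are finite, simple and undirected. An edge-labeling of $G=(V,E)$ is a map $f:E\to\mathbb N$ such that $|f(e)-f(e')|\ge 2$ whenever $e,e'$ are at distance one and $|f(e)-f(e')|\ge 1$ whenever $e,e'$ are at distance two, where the distance of edges is their distance in the line graph $L(G)$. Let $\lambda'(G)=\min_f\max_{e\in E}f(e)$, the minimum being over all edge-labelings $f$ (and $\lambda'(G)=0$ if $E=\emptyset$). Graphs are given to Turing machines by their adjacency matrices. **Theorem (Polynomial cases of distance edge-labeling).** For each fixed $\lambda\in\{0,1,2,3,4\}$ the following can be done in polynomial time by a deterministic Turing machine, for an arbitrary input graph $G$: (a) decide whether $\lambda'(G)=\lambda$; (b) decide whether $\lambda'(G)\le\lambda$; (c) compute an optimal edge-labeling of $G$, that is, one with largest label $\lambda'(G)$, if $\lambda'(G)\le\lambda$, and report that $\lambda'(G)>\lambda$ otherwise. Moreover, the graphs concerned are described as follows. Let $P_i$ be the path on $i$ vertices. A *generalized path* is a graph obtained from a path with at least one vertex, and a *generalized cycle* is a graph obtained from a cycle of length at least three, by attaching at most one pendant edge at each vertex. A vertex is *hairy* if it has degree $3$ and has a neighbor of degree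 $1$. Two distinct hairy vertices of a generalized path are *consecutive* if no other hairy vertex lies between them on the path, and their distance is their distance in the graph. In a generalized cycle a consecutive pair consists of a hairy vertex and the next hairy vertex met when going around the cycle in a fixed direction, and its distance is the number of steps made; if there is only one hairy vertex, then it is consecutive to itself, at distance the length of the cycle. 1. For connected $G$: $\lambda'(G)=0$ if and only if $G$ is $P_1$ or $P_2$; $\lambda'(G)\neq1$; $\lambda'(G)=2$ if and only if $G$ is $P_3$; $\lambda'(G)=3$ if and only if $G$ is $P_4$ or $P_5$; and if $\lambda'(G)\le4$, then $G$ is a generalized path or a generalized cycle. 2. If $G$ is a generalized path, then $\lambda'(G)\le4$ if and only if every consecutive pair of hairy vertices is at distance $4$ or at least $8$. 3. If $G$ is a generalized cycle, then $\lambda'(G)\le 4$ if and only if every consecutive pair of hairy vertices is at distance $4$ or at least $8$ and, in addition, the number of consecutive pairs at distance $10$ is even or there is a consecutive pair at distance at least $13$. -/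

import Mathlib

namespace DistanceEdgeLabeling

/-- An edge-labeling: labels of edges at distance one differ by at least two and labels of edges at
distance two differ by at least one, the distance being the one in the line graph. -/
def IsEdgeLabeling {V : Type} (G : SimpleGraph V) (f : G.edgeSet → ℕ) : Prop :=
  (∀ e e' : G.edgeSet, G.lineGraph.dist e e' = 1 → 2 ≤ |(f e : ℤ) - (f e' : ℤ)|) ∧
  (∀ e e' : G.edgeSet, G.lineGraph.dist e e' = 2 → 1 ≤ |(f e : ℤ) - (f e' : ℤ)|)

/-- The largest label used (`0` if there is no edge); meant for finite graphs. -/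
noncomputable def maxLabel {V : Type} {G : SimpleGraph V} (f : G.edgeSet → ℕ) : ℕ :=
  ⨆ e : G.edgeSet, f e

/-- The minimum, over all edge-labelings of the finite graph `G`, of the largest label used. -/
noncomputable def lambdaEdge {V : Type} (G : SimpleGraph V) : ℕ :=
  sInf {k : ℕ | ∃ f : G.edgeSet → ℕ, IsEdgeLabeling G f ∧ maxLabel f = k}

/-- The minimum in `lambdaEdge` is attained. -/
theorem exists_labeling_maxLabel_eq {V : Type} [Finite V] (G : SimpleGraph V) :
    ∃ f : G.edgeSet → ℕ, IsEdgeLabeling G f ∧ maxLabel f = lambdaEdge G := by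
  have hne : {k : ℕ | ∃ f : G.edgeSet → ℕ, IsEdgeLabeling G f ∧ maxLabel f = k}.Nonempty := by
    obtain ⟨n, ⟨φ⟩⟩ := Finite.exists_equiv_fin G.edgeSet
    have key : ∀ e e' : G.edgeSet, e ≠ e' →
        2 ≤ |((2 * (φ e : ℕ) : ℕ) : ℤ) - ((2 * (φ e' : ℕ) : ℕ) : ℤ)| := by
      intro e e' h
      have h1 : (φ e : ℕ) ≠ (φ e' : ℕ) := fun h2 => h (φ.injective (Fin.ext h2))
      push_cast
      rw [le_abs]
      omega
    refine ⟨_, fun e => 2 * (φ e : ℕ), ⟨fun e e' h => key e e' ?_, fun e e' h => ?_⟩, rfl⟩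
    · rintro rfl
      simp at h
    · refine le_trans (by norm_num) (key e e' ?_)
      rintro rfl
      simp at h
  exact Nat.sInf_mem hne

/-! ### Graphs as inputs of Turing machines -/

/-- Finite simple graphs, with vertices numbered `0, …, n - 1`. -/
abbrev FinGraph : Type := Σ n : ℕ, SimpleGraph (Fin n)

open Classical in
/-- The adjacency matrix written row by row; `some b` is an entry and `none` ends a row. -/
noncomputable def encodeGraph (G : FinGraph) : List (Option Bool) :=
  (List.finRange G.1).flatMap fun i =>
    (List.finRange G.1).map (fun j => some (decide (G.2.Adj i j))) ++ [none]

/-- A property of finite graphs is decidable in polynomial time by a Turing machine. -/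
def PolyTimeDecidable (P : FinGraph → Prop) : Prop :=
  ∃ d : FinGraph → Bool, (∀ G, d G = true ↔ P G) ∧
    Nonempty (Turing.TM2ComputableInPolyTime encodeGraph Computability.encodeBool d)

/-- The output alphabet for labelings with labels in `{0, …, lam}`. -/
inductive OutSymbol (lam : ℕ) : Type
  | found : OutSymbol lam
  | notFound : OutSymbol lam
  | nonEdge : OutSymbol lam
  | endRow : OutSymbol lam
  | label (c : Fin (lam + 1)) : OutSymbol lam

open Classical in
/-- An edge-labeling written as the matrix of the labels, row by row. -/
noncomputable def encodeLabeling {lam n : ℕ} (G : SimpleGraph (Fin n))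
    (f : G.edgeSet → Fin (lam + 1)) : List (OutSymbol lam) :=
  (List.finRange n).flatMap fun i =>
    (List.finRange n).map (fun j =>
      if h : G.Adj i j then OutSymbol.label (f ⟨s(i, j), h⟩) else OutSymbol.nonEdge) ++
    [OutSymbol.endRow]

/-- `out` answers the search problem for `lam`: if `G` has a labeling with labels at most `lam`, it
returns an optimal labeling of `G`, and otherwise it reports that there is none. -/
def SolvesSearch (lam : ℕ) (out : FinGraph → List (OutSymbol lam)) : Prop :=
  ∀ G : FinGraph,
    (lambdaEdge G.2 ≤ lam →
      ∃ f : G.2.edgeSet → Fin (lam + 1),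
        IsEdgeLabeling G.2 (fun e => (f e : ℕ)) ∧
        maxLabel (fun e => (f e : ℕ)) = lambdaEdge G.2 ∧
        out G = OutSymbol.found :: encodeLabeling G.2 f) ∧
    (¬ lambdaEdge G.2 ≤ lam → out G = [OutSymbol.notFound])

/-- An optimal labeling with labels at most `lam` can be computed in polynomial time by a Turing
machine whenever one exists. -/
def PolyTimeSearch (lam : ℕ) : Prop :=
  ∃ out : FinGraph → List (OutSymbol lam), SolvesSearch lam out ∧
    Nonempty (Turing.TM2ComputableInPolyTime encodeGraph (fun w => w) out)

/-! ### Hairy vertices, generalized paths and generalized cycles -/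

/-- A vertex of degree three with a neighbour of degree one. -/
def IsHairy {V : Type} (G : SimpleGraph V) (v : V) : Prop :=
  (G.neighborSet v).ncard = 3 ∧ ∃ w, G.Adj v w ∧ (G.neighborSet w).ncard = 1

/-- The graph obtained from `H` by attaching one pendant edge at every vertex of `S`. -/
def withPendants {V : Type} (H : SimpleGraph V) (S : Set V) : SimpleGraph (V ⊕ S) where
  Adj
    | .inl a, .inl b => H.Adj a b
    | .inl a, .inr s => a = s
    | .inr s, .inl a => a = s
    | .inr _, .inr _ => False
  symm := ⟨by
    rintro (a | s) (b | t) h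
    · exact H.adj_symm h
    · exact h
    · exact h
    · exact h⟩
  loopless := ⟨by
    rintro (a | s) h
    · exact H.irrefl h
    · exact h⟩

/-- A path with a set `S` of its vertices carrying pendant edges. -/
abbrev genPath (n : ℕ) (S : Set (Fin n)) : SimpleGraph (Fin n ⊕ S) :=
  withPendants (SimpleGraph.pathGraph n) S

/-- A cycle with a set `S` of its vertices carrying pendant edges. -/
abbrev genCycle (n : ℕ) (S : Set (Fin n)) : SimpleGraph (Fin n ⊕ S) :=
  withPendants (SimpleGraph.cycleGraph n) S

def IsGeneralizedPath {V : Type} (G : SimpleGraph V) : Prop :=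
  ∃ (n : ℕ) (S : Set (Fin n)), 1 ≤ n ∧ Nonempty (G ≃g genPath n S)

def IsGeneralizedCycle {V : Type} (G : SimpleGraph V) : Prop :=
  ∃ (n : ℕ) (S : Set (Fin n)), 3 ≤ n ∧ Nonempty (G ≃g genCycle n S)

/-- `i < j` are the positions of two consecutive hairy vertices of a generalized path. -/
def ConsecutiveOnPath {n : ℕ} (S : Set (Fin n)) (i j : Fin n) : Prop :=
  i < j ∧ IsHairy (genPath n S) (.inl i) ∧ IsHairy (genPath n S) (.inl j) ∧
    ∀ k : Fin n, i < k → k < j → ¬ IsHairy (genPath n S) (.inl k)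

/-- The vertex reached from vertex `i` of a cycle of length `n` after `d` steps forward. -/
def stepForward {n : ℕ} (i : Fin n) (d : ℕ) : Fin n :=
  ⟨(i.val + d) % n, Nat.mod_lt _ i.pos⟩

/-- Going around a generalized cycle from the hairy vertex at position `i`, the next hairy vertex
is met after exactly `d` steps, that is, `d` is the distance along the cycle of this consecutive
pair. If there is only one hairy vertex, it is consecutive to itself and `d = n`. -/
def ConsecutiveOnCycle {n : ℕ} (S : Set (Fin n)) (i : Fin n) (d : ℕ) : Prop :=
  0 < d ∧ IsHairy (genCycle n S) (.inl i) ∧ IsHairy (genCycle n S) (.inl (stepForward i d)) ∧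
    ∀ k : ℕ, 0 < k → k < d → ¬ IsHairy (genCycle n S) (.inl (stepForward i k))

/-- Every consecutive pair of hairy vertices is at distance `4` or at least `8`. -/
def PathCondition {n : ℕ} (S : Set (Fin n)) : Prop :=
  ∀ i j : Fin n, ConsecutiveOnPath S i j →
    (genPath n S).dist (.inl i) (.inl j) = 4 ∨ 8 ≤ (genPath n S).dist (.inl i) (.inl j)

/-- Every consecutive pair of hairy vertices is at distance `4` or at least `8` along the cycle, and
the number of pairs at distance `10` is even or some pair is at distance at least `13`. -/
def CycleCondition {n : ℕ} (S : Set (Fin n)) : Prop :=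
  (∀ (i : Fin n) (d : ℕ), ConsecutiveOnCycle S i d → d = 4 ∨ 8 ≤ d) ∧
  (Even {i : Fin n | ConsecutiveOnCycle S i 10}.ncard ∨
    ∃ (i : Fin n) (d : ℕ), ConsecutiveOnCycle S i d ∧ 13 ≤ d)

end DistanceEdgeLabeling

open DistanceEdgeLabeling

/-!
Labels at most `4` leave little freedom. The labels at a vertex of degree three are `0`, `2` and
`4`, and the edge labeled `2` is then pendant (`IsLab.leaf`); no vertex has degree four
(`IsLab.not_four`). Deleting these pendant edges leaves a connected graph of maximum degree two,
that is, a path or a cycle (`exists_path_or_cycle`, `IsLab.exists_iso`), so the graph is a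
generalized path or a generalized cycle. With labels at most `3` there are no vertices of degree
three and no non-backtracking walks with five edges (`IsLab.not_strand`), which leaves the paths
with at most five vertices.

Along a generalized cycle the labels form a periodic sequence with local conditions on any three
consecutive terms (`Win`). At a hairy vertex the two labels are `4, 0` or `0, 4`, in this order: two
states. Which pairs of states are possible at consecutive hairy vertices depends only on their
distance `d`: the same state for `d ∈ {4, 8, 9}` and `d ≥ 11`, different states for `d = 10` and `d
≥ 13` (`arc_of_gap`, `keep_of_le`, `flip_of_le`, and `Arc.distance` for the converse). Around the
cycle the state must change an even number of times. The changes at distance `10` are forced, at a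
distance of at least `13` one has the choice, and at the other distances there is none; this is the
condition on cycles (`exists_labels`, `labels_distance`). A generalized path lies in a long
generalized cycle, where the way back has length at least `13` (`lambdaEdge_genPath_le_iff`).

For the complexity statement this classification is not needed. The labels at the vertices that are
not leaves form the solutions of a binary constraint network with domains of bounded size in which
every variable is constrained with at most two others (`graphNet`). Eliminating the variables one
after the other keeps this property, and a solution can be read off in the reverse order
(`Net.exists_fits`). The elimination is carried out on the adjacency matrix, whose entries store the
current constraints, by programs with three nested loops over the vertices (`pSearch`,
`pSearch_spec`). Such programs are implemented by sweeps back and forth over the matrix, written as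
a word in which the rows and columns of the current loop indices are marked (`Implementable`); a
Turing machine with two work stacks does these sweeps in polynomial time (`polyTime_of_exec`,
`polyTime_of_implementable`).
-/

namespace DistanceEdgeLabeling

section machines
open Turing StateTransition

/-! ### Sweeping programs and their Turing machines -/

/-- Programs acting on a finite state and one word. A `sweep f g` rewrites the word letter by
letter, first from left to right by `f` and then from right to left by `g`. -/
inductive Prog (σ L : Type) : Type
  | load (h : σ → σ) : Prog σ L
  | sweep (f g : σ → L → σ × L) : Prog σ L
  | seq (p q : Prog σ L) : Prog σ L
  | ite (c : σ → Bool) (p q : Prog σ L) : Prog σ L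
  | loop (c : σ → Bool) (p : Prog σ L) : Prog σ L

/-- One pass over a word from left to right. -/
def passLeft {σ L : Type} (f : σ → L → σ × L) : σ → List L → σ × List L
  | s, [] => (s, [])
  | s, a :: w => ((passLeft f (f s a).1 w).1, (f s a).2 :: (passLeft f (f s a).1 w).2)

theorem passLeft_append {σ L : Type} (f : σ → L → σ × L) (s : σ) (u v : List L) :
    passLeft f s (u ++ v) =
      ((passLeft f (passLeft f s u).1 v).1,
        (passLeft f s u).2 ++ (passLeft f (passLeft f s u).1 v).2) := by
  induction u generalizing s with
  | nil => rfl
  | cons a u ih => simp [passLeft, ih]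

theorem passLeft_length {σ L : Type} (f : σ → L → σ × L) (s : σ) (u : List L) :
    (passLeft f s u).2.length = u.length := by
  induction u generalizing s with
  | nil => rfl
  | cons a u ih => simp [passLeft, ih]

theorem passLeft_id {σ L : Type} (s : σ) (w : List L) : passLeft (fun s a => (s, a)) s w = (s, w) := by
  induction w with
  | nil => rfl
  | cons a w ih => simp [passLeft, ih]

/-- `Exec p s w t s' w'`: started in state `s` on the word `w`, the program `p` stops in state `s'`
on the word `w'` after `t` steps. -/
inductive Exec {σ L : Type} : Prog σ L → σ → List L → ℕ → σ → List L → Prop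
  | load (h s w) : Exec (.load h) s w 1 (h s) w
  | sweep (f g s w) : Exec (.sweep f g) s w (2 * w.length + 2)
      (passLeft g (passLeft f s w).1 (passLeft f s w).2.reverse).1
      (passLeft g (passLeft f s w).1 (passLeft f s w).2.reverse).2.reverse
  | seq {p q s w t s' w' t' s'' w''} : Exec p s w t s' w' → Exec q s' w' t' s'' w'' →
      Exec (.seq p q) s w (t + t') s'' w''
  | ite_true {c p q s w t s' w'} : c s = true → Exec p s w t s' w' →
      Exec (.ite c p q) s w (1 + t) s' w'
  | ite_false {c p q s w t s' w'} : c s = false → Exec q s w t s' w' →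
      Exec (.ite c p q) s w (1 + t) s' w'
  | loop_true {c p s w t s' w' t' s'' w''} : c s = true → Exec p s w t s' w' →
      Exec (.loop c p) s' w' t' s'' w'' → Exec (.loop c p) s w (1 + t + t') s'' w''
  | loop_false {c p s w} : c s = false → Exec (.loop c p) s w 1 s w

/-- The stacks of the machines below: input, the two work stacks, output. -/
inductive Stk : Type
  | inp | main | aux | out
  deriving DecidableEq

instance : Fintype Stk :=
  ⟨{.inp, .main, .aux, .out}, fun x => by cases x <;> simp⟩

/-- The stack alphabets, for input alphabet `A`, letters `L` and output alphabet `O`. -/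
abbrev StkAlph (A L O : Type) : Stk → Type
  | .inp => A
  | .main => L
  | .aux => L
  | .out => O

/-- The configuration of the four stacks with the given contents. -/
def contents {A L O : Type} (i : List A) (m a : List L) (o : List O) :
    ∀ k, List (StkAlph A L O k)
  | .inp => i
  | .main => m
  | .aux => a
  | .out => o

section
variable {A L O : Type} (i : List A) (m a : List L) (o : List O)

@[simp] theorem contents_inp : contents i m a o .inp = i := rfl
@[simp] theorem contents_main : contents i m a o .main = m := rfl
@[simp] theorem contents_aux : contents i m a o .aux = a := rfl
@[simp] theorem contents_out : contents i m a o .out = o := rfl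

@[simp] theorem update_contents_inp (x : List A) :
    Function.update (contents i m a o) Stk.inp x = contents x m a o := by
  funext k; cases k <;> rfl

@[simp] theorem update_contents_main (x : List L) :
    Function.update (contents i m a o) Stk.main x = contents i x a o := by
  funext k; cases k <;> rfl

@[simp] theorem update_contents_aux (x : List L) :
    Function.update (contents i m a o) Stk.aux x = contents i m x o := by
  funext k; cases k <;> rfl

@[simp] theorem update_contents_out (x : List O) :
    Function.update (contents i m a o) Stk.out x = contents i m a x := by
  funext k; cases k <;> rfl

end

/-- The labels of the machine code of a program. -/
def Lbl {σ L : Type} : Prog σ L → Type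
  | .load _ => Unit
  | .sweep _ _ => Bool
  | .seq p q => Lbl p ⊕ Lbl q
  | .ite _ p q => Option (Lbl p ⊕ Lbl q)
  | .loop _ p => Option (Lbl p)

theorem finite_lbl {σ L : Type} (p : Prog σ L) : Finite (Lbl p) := by
  induction p with
  | load => exact inferInstanceAs (Finite Unit)
  | sweep => exact inferInstanceAs (Finite Bool)
  | seq p q hp hq => exact inferInstanceAs (Finite (Lbl p ⊕ Lbl q))
  | ite c p q hp hq => exact inferInstanceAs (Finite (Option (Lbl p ⊕ Lbl q)))
  | loop c p hp => exact inferInstanceAs (Finite (Option (Lbl p)))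

/-- The label at which the machine code of a program is entered. -/
def start {σ L : Type} : (p : Prog σ L) → Lbl p
  | .load _ => ()
  | .sweep _ _ => false
  | .seq p _ => Sum.inl (start p)
  | .ite _ _ _ => none
  | .loop _ _ => none

section machine
variable {A L O σ : Type}

/-- Statements over the four stacks; the state carries a buffer for the letter being moved. -/
abbrev Code (A L O σ Λ : Type) : Type := TM2.Stmt (StkAlph A L O) Λ (σ × Option L)

/-- Apply `f` to the letter that was just read, if any, and keep the new letter in the buffer. -/
def readWith {B : Type} (f : σ → B → σ × L) (v : σ × Option L) : Option B → σ × Option L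
  | none => (v.1, none)
  | some b => ((f v.1 b).1, some (f v.1 b).2)

/-- The machine `M` gets from `c` to `c'` in exactly `t` steps. -/
def StepsTo {Λ : Type} (M : Λ → Code A L O σ Λ) (t : ℕ)
    (c c' : TM2.Cfg (StkAlph A L O) Λ (σ × Option L)) : Prop :=
  (flip bind (TM2.step M))^[t] (some c) = some c'

theorem StepsTo.trans {Λ : Type} {M : Λ → Code A L O σ Λ} {t t' : ℕ}
    {c c' c'' : TM2.Cfg (StkAlph A L O) Λ (σ × Option L)} (h : StepsTo M t c c')
    (h' : StepsTo M t' c' c'') : StepsTo M (t + t') c c'' := by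
  unfold StepsTo at *
  rw [add_comm, Function.iterate_add_apply, h, h']

theorem StepsTo.one {Λ : Type} {M : Λ → Code A L O σ Λ}
    {c c' : TM2.Cfg (StkAlph A L O) Λ (σ × Option L)} (h : TM2.step M c = some c') :
    StepsTo M 1 c c' := by
  simpa [StepsTo, flip] using h

variable [Inhabited L]

/-- Move the top letter of `main` to `aux`, rewriting it by `f`; continue at `again`, or at `quit`
if `main` is empty. -/
def moveRight {Λ : Type} (f : σ → L → σ × L) (again quit : Λ) : Code A L O σ Λ :=
  .pop Stk.main (readWith f) <| .branch (fun v => v.2.isSome)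
    (.push Stk.aux (fun v => v.2.getD default) (.goto fun _ => again)) (.goto fun _ => quit)

/-- Move the top letter of `aux` back to `main`, rewriting it by `f`. -/
def moveLeft {Λ : Type} (f : σ → L → σ × L) (again quit : Λ) : Code A L O σ Λ :=
  .pop Stk.aux (readWith f) <| .branch (fun v => v.2.isSome)
    (.push Stk.main (fun v => v.2.getD default) (.goto fun _ => again)) (.goto fun _ => quit)

/-- The machine code of a program whose labels are embedded into `Λ` and which is left at `quit`. -/
def code {Λ : Type} : (p : Prog σ L) → (Lbl p → Λ) → Λ → Lbl p → Code A L O σ Λ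
  | .load h, _, quit, _ => .load (fun v => (h v.1, v.2)) (.goto fun _ => quit)
  | .sweep f _, emb, _, false => moveRight f (emb false) (emb true)
  | .sweep _ g, emb, quit, true => moveLeft g (emb true) quit
  | .seq p q, emb, _, .inl l => code p (fun l => emb (.inl l)) (emb (.inr (start q))) l
  | .seq _ q, emb, quit, .inr l => code q (fun l => emb (.inr l)) quit l
  | .ite c p q, emb, _, none =>
      .branch (fun v => c v.1) (.goto fun _ => emb (some (.inl (start p))))
        (.goto fun _ => emb (some (.inr (start q))))
  | .ite _ p _, emb, quit, some (.inl l) => code p (fun l => emb (some (.inl l))) quit l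
  | .ite _ _ q, emb, quit, some (.inr l) => code q (fun l => emb (some (.inr l))) quit l
  | .loop c p, emb, quit, none =>
      .branch (fun v => c v.1) (.goto fun _ => emb (some (start p))) (.goto fun _ => quit)
  | .loop _ p, emb, _, some l => code p (fun l => emb (some l)) (emb none) l

theorem stepsTo_moveRight {Λ : Type} {M : Λ → Code A L O σ Λ} {l quit : Λ} {f : σ → L → σ × L}
    (hM : M l = moveRight f l quit) (i : List A) (o : List O) (s : σ) (w v : List L) {b : Option L} :
    StepsTo M (w.length + 1) ⟨some l, (s, b), contents i w v o⟩
      ⟨some quit, ((passLeft f s w).1, none), contents i [] ((passLeft f s w).2.reverse ++ v) o⟩ := by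
  induction w generalizing s v b with
  | nil => exact .one (by simp [hM, moveRight, readWith, passLeft])
  | cons a w ih =>
    rw [List.length_cons, add_comm]
    refine (StepsTo.one (c' := ⟨some l, ((f s a).1, some (f s a).2),
      contents i w ((f s a).2 :: v) o⟩) ?_).trans ?_
    · simp [hM, moveRight, readWith]
    · simpa [passLeft] using ih (f s a).1 ((f s a).2 :: v)

theorem stepsTo_moveLeft {Λ : Type} {M : Λ → Code A L O σ Λ} {l quit : Λ} {f : σ → L → σ × L}
    (hM : M l = moveLeft f l quit) (i : List A) (o : List O) (s : σ) (w v : List L) {b : Option L} :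
    StepsTo M (w.length + 1) ⟨some l, (s, b), contents i v w o⟩
      ⟨some quit, ((passLeft f s w).1, none), contents i ((passLeft f s w).2.reverse ++ v) [] o⟩ := by
  induction w generalizing s v b with
  | nil => exact .one (by simp [hM, moveLeft, readWith, passLeft])
  | cons a w ih =>
    rw [List.length_cons, add_comm]
    refine (StepsTo.one (c' := ⟨some l, ((f s a).1, some (f s a).2),
      contents i ((f s a).2 :: v) w o⟩) ?_).trans ?_
    · simp [hM, moveLeft, readWith]
    · simpa [passLeft] using ih (f s a).1 ((f s a).2 :: v)

/-- The machine code of a program carries out its executions, step for step. -/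
theorem stepsTo_code {Λ : Type} {M : Λ → Code A L O σ Λ} {p : Prog σ L} {s s' : σ} {w w' : List L}
    {t : ℕ} (h : Exec p s w t s' w') (emb : Lbl p → Λ) (quit : Λ)
    (hM : ∀ l, M (emb l) = code p emb quit l) (i : List A) (o : List O) :
    StepsTo M t ⟨some (emb (start p)), (s, none), contents i w [] o⟩
      ⟨some quit, (s', none), contents i w' [] o⟩ := by
  induction h generalizing quit with
  | load h s w => exact .one (by simp [hM, code])
  | sweep f g s w =>
    have h1 := stepsTo_moveRight (b := none) (hM false) i o s w []
    have h2 := stepsTo_moveLeft (b := none) (hM true) i o (passLeft f s w).1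
      (passLeft f s w).2.reverse []
    have h3 := h1.trans (by simpa using h2)
    have e : w.length + 1 + (w.length + 1) = 2 * w.length + 2 := by ring
    simpa [passLeft_length, e, start] using h3
  | seq _ _ hp hq =>
    exact (hp (fun l => emb (.inl l)) _ fun l => hM (.inl l)).trans
      (hq (fun l => emb (.inr l)) _ fun l => hM (.inr l))
  | ite_true hc _ hp =>
    exact (StepsTo.one (by simp [start, show M (emb none) = _ from hM none, code, hc])).trans
      (hp (fun l => emb (some (.inl l))) _ fun l => hM (some (.inl l)))
  | ite_false hc _ hq =>
    exact (StepsTo.one (by simp [start, show M (emb none) = _ from hM none, code, hc])).trans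
      (hq (fun l => emb (some (.inr l))) _ fun l => hM (some (.inr l)))
  | loop_true hc _ _ hp hq =>
    exact ((StepsTo.one (by simp [start, show M (emb none) = _ from hM none, code, hc])).trans
      (hp (fun l => emb (some l)) _ fun l => hM (some l))).trans (hq emb quit hM)
  | loop_false hc => exact .one (by simp [start, show M (emb none) = _ from hM none, code, hc])

/-! ### Input and output -/

/-- The phases around a program: reading the input, and writing the output. -/
inductive Phase : Type
  | read | turn | collect | write
  deriving DecidableEq

instance : Fintype Phase :=
  ⟨{.read, .turn, .collect, .write}, fun x => by cases x <;> simp⟩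

/-- The machine that translates the input letter by letter, runs `p`, and writes one symbol `pre s`
depending on the final state `s`, followed by the translated word if `keep s`. -/
def wrapper (p : Prog σ L) (s₀ : σ) (conv : A → L) (pre : σ → O) (keep : σ → Bool) (og : L → O) :
    Phase ⊕ Lbl p → Code A L O σ (Phase ⊕ Lbl p)
  | .inl .read => .pop Stk.inp (readWith fun s a => (s, conv a)) <| .branch (fun v => v.2.isSome)
      (.push Stk.aux (fun v => v.2.getD default) (.goto fun _ => .inl .read))
      (.goto fun _ => .inl .turn)
  | .inl .turn => moveLeft (fun s a => (s, a)) (.inl .turn) (.inr (start p))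
  | .inl .collect => moveRight (fun s a => (s, a)) (.inl .collect) (.inl .write)
  | .inl .write => .pop Stk.aux (readWith fun s a => (s, a)) <| .branch (fun v => v.2.isSome)
      (.branch (fun v => keep v.1)
        (.push Stk.out (fun v => og (v.2.getD default)) (.goto fun _ => .inl .write))
        (.goto fun _ => .inl .write))
      (.push Stk.out (fun v => pre v.1) (.load (fun _ => (s₀, none)) .halt))
  | .inr l => code p Sum.inr (.inl .collect) l

variable (p : Prog σ L) (s₀ : σ) (conv : A → L) (pre : σ → O) (keep : σ → Bool) (og : L → O)

theorem stepsTo_read (s : σ) (u : List A) (v : List L) (b : Option L) :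
    StepsTo (wrapper p s₀ conv pre keep og) (u.length + 1)
      ⟨some (.inl .read), (s, b), contents u [] v []⟩
      ⟨some (.inl .turn), (s, none), contents [] [] ((u.map conv).reverse ++ v) []⟩ := by
  induction u generalizing v b with
  | nil => exact .one (by simp [wrapper, readWith])
  | cons a u ih =>
    rw [List.length_cons, add_comm]
    refine (StepsTo.one (c' := ⟨some (.inl .read), (s, some (conv a)),
      contents u [] (conv a :: v) []⟩) ?_).trans ?_
    · simp [wrapper, readWith]
    · simpa using ih (conv a :: v) (some (conv a))

theorem stepsTo_write (s : σ) (v : List L) (o : List O) (b : Option L) :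
    StepsTo (wrapper p s₀ conv pre keep og) (v.length + 1)
      ⟨some (.inl .write), (s, b), contents [] [] v o⟩
      ⟨none, (s₀, none), contents [] [] []
        (pre s :: ((if keep s then (v.map og).reverse else []) ++ o))⟩ := by
  induction v generalizing o b with
  | nil => exact .one (by simp [wrapper, readWith])
  | cons a v ih =>
    rw [List.length_cons, add_comm]
    refine (StepsTo.one (c' := ⟨some (.inl .write), (s, some a),
      contents [] [] v (if keep s then og a :: o else o)⟩) ?_).trans ?_
    · cases h : keep s <;> simp [wrapper, readWith, h]
    · cases h : keep s
      · simpa [h] using ih o (some a)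
      · simpa [h] using ih (og a :: o) (some a)

theorem stepsTo_wrapper {u : List A} {t : ℕ} {s : σ} {w : List L}
    (h : Exec p s₀ (u.map conv) t s w) :
    StepsTo (wrapper p s₀ conv pre keep og) (2 * (u.length + 1) + t + 2 * (w.length + 1))
      ⟨some (.inl .read), (s₀, none), contents u [] [] []⟩
      ⟨none, (s₀, none), contents [] [] [] (pre s :: if keep s then w.map og else [])⟩ := by
  have h1 := stepsTo_read p s₀ conv pre keep og s₀ u [] none
  have h2 := stepsTo_moveLeft (M := wrapper p s₀ conv pre keep og) (l := .inl .turn)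
    (b := none) rfl [] [] s₀ (u.map conv).reverse []
  have h3 := stepsTo_code (M := wrapper p s₀ conv pre keep og) h Sum.inr (.inl .collect)
    (fun _ => rfl) [] []
  have h4 := stepsTo_moveRight (M := wrapper p s₀ conv pre keep og) (l := .inl .collect)
    (b := none) rfl [] [] s w []
  have h5 := stepsTo_write p s₀ conv pre keep og s w.reverse [] none
  simp only [passLeft_id, List.reverse_reverse, List.append_nil, List.length_reverse,
    List.length_map, List.map_reverse] at h1 h2 h4 h5
  have := (((h1.trans h2).trans h3).trans h4).trans h5
  convert this using 1
  ring

/-- The machine `wrapper` with its finiteness data. -/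
noncomputable def wrapperMachine [Finite σ] [Finite L] [Fintype A] : FinTM2 :=
  haveI : Fintype (Phase ⊕ Lbl p) :=
    haveI := finite_lbl p
    Fintype.ofFinite _
  haveI : Fintype (σ × Option L) := Fintype.ofFinite _
  { K := Stk
    k₀ := .inp
    k₁ := .out
    Γ := StkAlph A L O
    Λ := Phase ⊕ Lbl p
    main := .inl .read
    σ := σ × Option L
    initialState := (s₀, none)
    Γk₀Fin := inferInstanceAs (Fintype A)
    m := wrapper p s₀ conv pre keep og }

/-- A function whose values are computed by a program in polynomially many steps is computable by
a Turing machine in polynomial time. -/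
theorem polyTime_of_exec [Finite σ] [Finite L] [Fintype A] {α β : Type} (ea : α → List A)
    (eb : β → List O) (F : α → β) (c k : ℕ)
    (h : ∀ x, ∃ t s w, Exec p s₀ ((ea x).map conv) t s w ∧ w.length = (ea x).length ∧
      t ≤ c * ((ea x).length + 1) ^ k ∧ eb (F x) = pre s :: if keep s then w.map og else []) :
    Nonempty (TM2ComputableInPolyTime ea eb F) := by
  refine ⟨⟨⟨wrapperMachine p s₀ conv pre keep og, Equiv.refl A, Equiv.refl O⟩,
    .C c * (.X + 1) ^ k + 4 * (.X + 1), fun x => ?_⟩⟩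
  have hh : ∃ t ≤ Polynomial.eval (ea x).length (.C c * (.X + 1) ^ k + 4 * (.X + 1)),
      StepsTo (wrapper p s₀ conv pre keep og) t
        ⟨some (.inl .read), (s₀, none), contents (ea x) [] [] []⟩
        ⟨none, (s₀, none), contents [] [] [] (eb (F x))⟩ := by
    obtain ⟨t, s, w, h1, h2, h3, h4⟩ := h x
    refine ⟨_, ?_, h4 ▸ stepsTo_wrapper p s₀ conv pre keep og h1⟩
    simp [h2]
    linarith
  have e1 : initList (wrapperMachine p s₀ conv pre keep og) ((ea x).map (Equiv.refl A).invFun) =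
      (⟨some (.inl .read), (s₀, none), contents (ea x) [] [] []⟩ :
        TM2.Cfg (StkAlph A L O) (Phase ⊕ Lbl p) (σ × Option L)) := by
    refine (congrArg (initList (wrapperMachine p s₀ conv pre keep og)) (List.map_id _)).trans ?_
    unfold initList
    congr 1
    funext k
    cases k <;> rfl
  have e2 : haltList (wrapperMachine p s₀ conv pre keep og) ((eb (F x)).map (Equiv.refl O).invFun) =
      (⟨none, (s₀, none), contents [] [] [] (eb (F x))⟩ :
        TM2.Cfg (StkAlph A L O) (Phase ⊕ Lbl p) (σ × Option L)) := by
    refine (congrArg (haltList (wrapperMachine p s₀ conv pre keep og)) (List.map_id _)).trans ?_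
    unfold haltList
    congr 1
    funext k
    cases k <;> rfl
  rw [← e1, ← e2] at hh
  exact ⟨⟨hh.choose, hh.choose_spec.2⟩, hh.choose_spec.1⟩

end machine

/-! ### Loops over matrix entries -/

/-- A matrix entry with, for each of three index variables, a mark telling whether the entry lies in
the row, and one telling whether it lies in the column, whose number is the value of the variable.
The letter `none` ends a row. -/
abbrev Letter (Γ : Type) : Type := Option (Γ × (Fin 3 → Bool) × (Fin 3 → Bool))

/-- The letter for the entry `(i, j)` of `M` when the index variables have the values `e`. -/
def entry {Γ : Type} (M : ℕ → ℕ → Γ) (e : Fin 3 → ℕ) (i j : ℕ) : Letter Γ :=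
  some (M i j, fun x => decide (e x = i), fun x => decide (e x = j))

/-- The `n × n` matrix `M` written row by row, with marks for the values `e`. A variable whose value
is at least `n` has no marks. -/
def word {Γ : Type} (n : ℕ) (M : ℕ → ℕ → Γ) (e : Fin 3 → ℕ) : List (Letter Γ) :=
  (List.range n).flatMap fun i => (List.range n).map (entry M e i) ++ [none]

theorem length_word {Γ : Type} (n : ℕ) (M : ℕ → ℕ → Γ) (e : Fin 3 → ℕ) :
    (word n M e).length = n * (n + 1) := by
  simp [word, List.length_flatMap]

theorem passLeft_map_range {σ L : Type} {f : σ → L → σ × L} {S : ℕ → σ} {g h : ℕ → L} (m : ℕ)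
    (H : ∀ j < m, f (S j) (g j) = (S (j + 1), h j)) :
    passLeft f (S 0) ((List.range m).map g) = (S m, (List.range m).map h) := by
  induction m with
  | zero => rfl
  | succ m ih =>
    rw [List.range_succ, List.map_append, passLeft_append, ih fun j hj => H j (by omega)]
    simp [passLeft, H m (by omega)]

theorem passLeft_flatMap_range {σ L : Type} {f : σ → L → σ × L} {S : ℕ → σ} {g h : ℕ → List L}
    (m : ℕ) (H : ∀ j < m, passLeft f (S j) (g j) = (S (j + 1), h j)) :
    passLeft f (S 0) ((List.range m).flatMap g) = (S m, (List.range m).flatMap h) := by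
  induction m with
  | zero => rfl
  | succ m ih =>
    rw [List.range_succ, List.flatMap_append, passLeft_append, ih fun j hj => H j (by omega)]
    simp [H m (by omega)]

/-- A pass over a matrix word, given the states `S i j` in which the entries `(i, j)` are reached.
-/
theorem passLeft_word {σ Γ : Type} {f : σ → Letter Γ → σ × Letter Γ} {S : ℕ → ℕ → σ} {n : ℕ}
    {M M' : ℕ → ℕ → Γ} {e e' : Fin 3 → ℕ}
    (H : ∀ i < n, ∀ j < n, f (S i j) (entry M e i j) = (S i (j + 1), entry M' e' i j))
    (H' : ∀ i < n, f (S i n) none = (S (i + 1) 0, none)) :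
    passLeft f (S 0 0) (word n M e) = (S n 0, word n M' e') := by
  refine passLeft_flatMap_range (S := fun i => S i 0) n fun i hi => ?_
  rw [passLeft_append, passLeft_map_range (S := S i) n (H i hi)]
  simp [passLeft, H' i hi]

/-- The auxiliary memory of a pass that moves the marks of an index variable: whether the current
row was marked, whether it is to be marked, whether the entry to the left was in the marked column,
and whether any mark was set. -/
structure Scratch : Type where
  was : Bool
  mark : Bool
  left : Bool
  alive : Bool

instance : Finite Scratch :=
  Finite.of_injective (fun z : Scratch => (z.was, z.mark, z.left, z.alive)) fun a b h => by
    cases a; cases b; simpa using h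

/-- Operations on a state and a matrix, depending on the values of the index variables and on the
size of the matrix. -/
abbrev Op (σ Γ : Type) : Type :=
  (Fin 3 → ℕ) → ℕ → σ × (ℕ → ℕ → Γ) → σ × (ℕ → ℕ → Γ)

section ops
variable {σ Γ : Type}

/-- Change the state by `h`. -/
def opLoad (h : σ → σ) : Op σ Γ := fun _ _ S => (h S.1, S.2)

/-- Replace the entry of `M` in row `i` and column `j`. -/
def setAt (M : ℕ → ℕ → Γ) (i j : ℕ) (a : Γ) : ℕ → ℕ → Γ :=
  fun i' j' => if i' = i ∧ j' = j then a else M i' j'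

/-- Read and change the entry in row `x` and column `y`. -/
def opAcc (x y : Fin 3) (f : σ → Γ → σ × Γ) : Op σ Γ := fun e _ S =>
  ((f S.1 (S.2 (e x) (e y))).1, setAt S.2 (e x) (e y) (f S.1 (S.2 (e x) (e y))).2)

/-- First `F`, then `G`. -/
def opSeq (F G : Op σ Γ) : Op σ Γ := fun e n S => G e n (F e n S)

/-- `F` or `G`, depending on the state. -/
def opIte (c : σ → Bool) (F G : Op σ Γ) : Op σ Γ := fun e n S => if c S.1 then F e n S else G e n S

/-- `F` for all values `0, …, n - 1` of the index variable `x`. -/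
def opFor (x : Fin 3) (F : Op σ Γ) : Op σ Γ := fun e n S =>
  (List.range n).foldl (fun S i => F (Function.update e x i) n S) S

/-- The operation `F`, which may use the index variables below `d`, is carried out in polynomial
time by a sweeping program. The program may spoil the marks of the other index variables. -/
def Implementable (d : ℕ) (F : Op σ Γ) : Prop :=
  (∀ e e' n S, (∀ x : Fin 3, x.val < d → e x = e' x) → F e n S = F e' n S) ∧
  ∃ (p : Prog (σ × Scratch) (Letter Γ)) (c k : ℕ), ∀ n e s M z,
    (∀ x : Fin 3, x.val < d → e x < n) →
    ∃ t z' e', t ≤ c * (n + 1) ^ k ∧ (∀ x : Fin 3, x.val < d → e' x = e x) ∧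
      Exec p (s, z) (word n M e) t ((F e n (s, M)).1, z') (word n (F e n (s, M)).2 e')

theorem implementable_load (d : ℕ) (h : σ → σ) : Implementable d (opLoad (Γ := Γ) h) :=
  ⟨fun _ _ _ _ _ => rfl, .load fun v => (h v.1, v.2), 1, 0, fun n e s M z _ =>
    ⟨1, z, e, by simp, fun _ _ => rfl, .load _ _ _⟩⟩

theorem add_le_poly {a b c k c' k' n : ℕ} (h : a ≤ c * (n + 1) ^ k) (h' : b ≤ c' * (n + 1) ^ k') :
    a + b ≤ (c + c') * (n + 1) ^ (k + k') := by
  rw [add_mul]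
  refine Nat.add_le_add (h.trans ?_) (h'.trans ?_)
  · exact Nat.mul_le_mul_left _ (Nat.pow_le_pow_right (by omega) (by omega))
  · exact Nat.mul_le_mul_left _ (Nat.pow_le_pow_right (by omega) (by omega))

theorem implementable_seq {d : ℕ} {F G : Op σ Γ} (hF : Implementable d F)
    (hG : Implementable d G) : Implementable d (opSeq F G) := by
  obtain ⟨hF0, p, c, k, hp⟩ := hF
  obtain ⟨hG0, q, c', k', hq⟩ := hG
  refine ⟨fun e e' n S h => by simp only [opSeq, hF0 e e' n S h, hG0 e e' n _ h], .seq p q, c + c',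
    k + k', fun n e s M z he => ?_⟩
  obtain ⟨t, z1, e1, h1, h2, h3⟩ := hp n e s M z he
  obtain ⟨t', z2, e2, h1', h2', h3'⟩ := hq n e1 (F e n (s, M)).1 (F e n (s, M)).2 z1
    fun x hx => by rw [h2 x hx]; exact he x hx
  refine ⟨t + t', z2, e2, add_le_poly h1 h1', fun x hx => (h2' x hx).trans (h2 x hx), ?_⟩
  rw [hG0 e1 e n _ h2] at h3'
  exact .seq h3 h3'

theorem implementable_ite {d : ℕ} (b : σ → Bool) {F G : Op σ Γ} (hF : Implementable d F)
    (hG : Implementable d G) : Implementable d (opIte b F G) := by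
  obtain ⟨hF0, p, c, k, hp⟩ := hF
  obtain ⟨hG0, q, c', k', hq⟩ := hG
  refine ⟨fun e e' n S h => by simp only [opIte, hF0 e e' n S h, hG0 e e' n _ h],
    .ite (fun v => b v.1) p q, 1 + (c + c'), 0 + (k + k'), fun n e s M z he => ?_⟩
  obtain ⟨t, z1, e1, h1, h2, h3⟩ := hp n e s M z he
  obtain ⟨t', z2, e2, h1', h2', h3'⟩ := hq n e s M z he
  have hb := add_le_poly h1 h1'
  have h1 : 1 ≤ 1 * (n + 1) ^ 0 := by simp
  by_cases h : b s = true
  · refine ⟨1 + t, z1, e1, add_le_poly h1 (by omega), h2, ?_⟩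
    simp only [opIte, h, if_true]
    exact .ite_true h h3
  · refine ⟨1 + t', z2, e2, add_le_poly h1 (by omega), h2', ?_⟩
    simp only [opIte, h]
    exact .ite_false (by simpa using h) h3'

/-- A sweep that changes nothing on the way back. -/
theorem exec_sweep_of_passLeft {L τ : Type} {f : τ → L → τ × L} {s s' : τ} {w w' : List L}
    (h : passLeft f s w = (s', w')) :
    Exec (.sweep f fun s a => (s, a)) s w (2 * w.length + 2) s' w' := by
  have := Exec.sweep f (fun s a => (s, a)) s w
  rwa [h, passLeft_id, List.reverse_reverse] at this

theorem sweep_bound (n : ℕ) : 2 * (n * (n + 1)) + 2 ≤ 2 * (n + 1) ^ 2 := by nlinarith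

theorem implementable_acc {d : ℕ} (x y : Fin 3) (hx : x.val < d) (hy : y.val < d)
    (f : σ → Γ → σ × Γ) : Implementable d (opAcc x y f) := by
  refine ⟨fun e e' n S h => by simp only [opAcc, h x hx, h y hy], .sweep (fun v a =>
    match a with
    | none => (v, none)
    | some (γ, R, C) => if R x && C y then (((f v.1 γ).1, v.2), some ((f v.1 γ).2, R, C))
        else (v, some (γ, R, C))) fun s a => (s, a), 2, 2, fun n e s M z he => ?_⟩
  have hyn := he y hy
  refine ⟨_, z, e, ?_, fun _ _ => rfl, exec_sweep_of_passLeft ?_⟩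
  · rw [length_word]; exact sweep_bound n
  have key := passLeft_word (n := n) (M := M) (e := e) (e' := e)
    (M' := setAt M (e x) (e y) (f s (M (e x) (e y))).2)
    (f := fun (v : σ × Scratch) (a : Letter Γ) => match a with
      | none => (v, none)
      | some (γ, R, C) => if R x && C y then (((f v.1 γ).1, v.2), some ((f v.1 γ).2, R, C))
          else (v, some (γ, R, C)))
    (S := fun i j => if e x < i ∨ e x = i ∧ e y < j then ((f s (M (e x) (e y))).1, z) else (s, z))
    (fun i _ j _ => ?_) (fun i _ => ?_)
  · have h1 : e x < n := he x hx
    simpa [opAcc, h1] using key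
  · by_cases h1 : e x = i
    · subst h1
      by_cases h2 : e y = j
      · subst h2
        simp [entry, setAt]
      · have h3 : e y < j + 1 ↔ e y < j := by omega
        simp [entry, setAt, h2, h3, Ne.symm h2]
    · simp [entry, setAt, h1, Ne.symm h1]
  · have : e x < i ∨ e x = i ∧ e y < n ↔ e x < i + 1 ∨ e x = i + 1 ∧ e y < 0 := by omega
    exact congrArg (fun v => (v, (none : Letter Γ))) (if_congr this rfl rfl)

/-- Set the marks of the index variable `x` for the value `0`. -/
def initMarks (x : Fin 3) (v : σ × Scratch) : Letter Γ → (σ × Scratch) × Letter Γ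
  | none => ((v.1, { v.2 with was := true, left := false }), none)
  | some (γ, R, C) => ((v.1, { v.2 with left := true, alive := true }),
      some (γ, Function.update R x !v.2.was, Function.update C x !v.2.left))

/-- Move the marks of the index variable `x` to the next value. -/
def moveMarks (x : Fin 3) (v : σ × Scratch) : Letter Γ → (σ × Scratch) × Letter Γ
  | none => ((v.1, { v.2 with was := false, mark := v.2.was, left := false }), none)
  | some (γ, R, C) => ((v.1, { v.2 with was := R x, left := C x, alive := v.2.alive || v.2.mark }),
      some (γ, Function.update R x v.2.mark, Function.update C x v.2.left))

theorem passLeft_initMarks (x : Fin 3) (s : σ) (n : ℕ) (M : ℕ → ℕ → Γ) (e : Fin 3 → ℕ) :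
    ∃ z, z.alive = decide (0 < n) ∧
      passLeft (initMarks x) (s, ⟨false, false, false, false⟩) (word n M e) =
        ((s, z), word n M (Function.update e x 0)) := by
  have key := passLeft_word (n := n) (M := M) (e := e) (e' := Function.update e x 0) (M' := M)
    (f := initMarks x)
    (S := fun i j => (s, ⟨decide (0 < i), false, decide (0 < j), decide (0 < i) || decide (0 < j)⟩))
    (fun i _ j _ => ?_) (fun i hi => ?_)
  · exact ⟨⟨decide (0 < n), false, false, decide (0 < n)⟩, rfl, by simpa using key⟩
  · simp only [initMarks, entry]
    congr 1
    · simp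
    · congr 2
      refine Prod.ext ?_ ?_
      · funext y
        by_cases hy : y = x
        · subst hy
          simp only [Function.update_self]
          rcases i with - | i <;> simp
        · simp [hy]
      · funext y
        by_cases hy : y = x
        · subst hy
          simp only [Function.update_self]
          rcases j with - | j <;> simp
        · simp [hy]
  · simp [initMarks]
    omega

theorem passLeft_moveMarks (x : Fin 3) (s : σ) (n : ℕ) (M : ℕ → ℕ → Γ) (e : Fin 3 → ℕ) :
    ∃ z, z.alive = decide (e x + 1 < n) ∧
      passLeft (moveMarks x) (s, ⟨false, false, false, false⟩) (word n M e) =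
        ((s, z), word n M (Function.update e x (e x + 1))) := by
  have key := passLeft_word (n := n) (M := M) (e := e) (e' := Function.update e x (e x + 1))
    (M' := M) (f := moveMarks x)
    (S := fun i j => (s, ⟨decide (0 < j ∧ e x = i), decide (e x + 1 = i), decide (e x + 1 = j),
      decide (e x + 1 < i ∨ (e x + 1 = i ∧ 0 < j))⟩))
    (fun i hi j hj => ?_) (fun i hi => ?_)
  · exact ⟨⟨false, decide (e x + 1 = n), false, decide (e x + 1 < n)⟩, rfl, by simpa using key⟩
  · simp only [moveMarks, entry]
    congr 1
    · congr 2
      · simp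
      · simp
      · rw [Bool.eq_iff_iff]; simp; omega
    · congr 2
      refine Prod.ext ?_ ?_
      · funext y
        by_cases hy : y = x
        · subst hy
          simp
        · simp [hy]
      · funext y
        by_cases hy : y = x
        · subst hy
          simp
        · simp [hy]
  · have h0 : 0 < n := by omega
    simp [moveMarks, h0]
    rw [Bool.eq_iff_iff]
    simp
    omega

theorem implementable_for {d : ℕ} (x : Fin 3) (hx : x.val = d) {F : Op σ Γ}
    (hF : Implementable (d + 1) F) : Implementable d (opFor x F) := by
  obtain ⟨hF0, p, c, k, hp⟩ := hF
  have hdep : ∀ e e' n S i, (∀ y : Fin 3, y.val < d → e y = e' y) →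
      F (Function.update e x i) n S = F (Function.update e' x i) n S := by
    intro e e' n S i h
    refine hF0 _ _ _ _ fun y hy => ?_
    by_cases hyx : y = x
    · subst hyx; simp
    · have : y.val ≠ x.val := fun h => hyx (Fin.ext h)
      simpa [hyx] using h y (by omega)
  refine ⟨fun e e' n S h => ?_, ?_⟩
  · simp only [opFor]
    congr 1
    funext S i
    exact hdep e e' n S i h
  let reset : Prog (σ × Scratch) (Letter Γ) := .load fun v => (v.1, ⟨false, false, false, false⟩)
  let body : Prog (σ × Scratch) (Letter Γ) :=
    .seq p (.seq reset (.sweep (moveMarks x) fun s a => (s, a)))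
  -- `r` further rounds, from the value `n - r` of the loop variable on
  have rounds : ∀ n r, r ≤ n → ∀ e s M z, e x = n - r → z.alive = decide (e x < n) →
      (∀ y : Fin 3, y.val < d → e y < n) →
      ∃ t z' e', t ≤ 1 + r * (c * (n + 1) ^ k + (2 * (n + 1) ^ 2 + 2)) ∧
        (∀ y : Fin 3, y.val < d → e' y = e y) ∧
        Exec (.loop (fun v => v.2.alive) body) (s, z) (word n M e) t
          (((List.range' (n - r) r).foldl (fun S i => F (Function.update e x i) n S) (s, M)).1, z')
          (word n ((List.range' (n - r) r).foldl
            (fun S i => F (Function.update e x i) n S) (s, M)).2 e') := by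
    intro n r
    induction r with
    | zero =>
      intro _ e s M z h1 h2 _
      exact ⟨1, z, e, by simp, fun _ _ => rfl, .loop_false (by simp [h2, h1])⟩
    | succ r ih =>
      intro hr e s M z h1 h2 h3
      have hex : e x < n := by omega
      obtain ⟨t1, z1, e1, ht1, he1, hE1⟩ := hp n e s M z fun y hy => by
        by_cases hyx : y = x
        · subst hyx; exact hex
        · have : y.val ≠ x.val := fun h => hyx (Fin.ext h)
          exact h3 y (by omega)
      have he1x : e1 x = e x := he1 x (by omega)
      obtain ⟨z2, hz2, hE2⟩ := passLeft_moveMarks x (F e n (s, M)).1 n (F e n (s, M)).2 e1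
      have he2 : ∀ y : Fin 3, y.val < d → Function.update e1 x (e1 x + 1) y = e y := by
        intro y hy
        have : y ≠ x := fun h => by subst h; omega
        simpa [this] using he1 y (by omega)
      obtain ⟨t3, z3, e3, ht3, he3, hE3⟩ := ih (by omega) (Function.update e1 x (e1 x + 1))
        (F e n (s, M)).1 (F e n (s, M)).2 z2 (by simp; omega) (by simp [hz2])
        (fun y hy => by rw [he2 y hy]; exact h3 y hy)
      have hu : F (Function.update e x (n - (r + 1))) n (s, M) = F e n (s, M) := by
        rw [← h1, Function.update_eq_self]
      have hfold : (fun S i => F (Function.update (Function.update e1 x (e1 x + 1)) x i) n S) =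
          fun S i => F (Function.update e x i) n S := by
        funext S i
        exact hdep _ _ _ _ _ he2
      have hE := Exec.loop_true (c := fun v => v.2.alive) (by simp [h2, hex])
        (.seq hE1 (.seq (.load _ _ _) (exec_sweep_of_passLeft hE2))) hE3
      rw [hfold] at hE
      rw [List.range'_succ, List.foldl_cons, hu, show n - (r + 1) + 1 = n - r by omega]
      refine ⟨_, z3, e3, ?_, fun y hy => (he3 y hy).trans (he2 y hy), hE⟩
      · rw [length_word]
        have := sweep_bound n
        have e1 : (r + 1) * (c * (n + 1) ^ k + (2 * (n + 1) ^ 2 + 2)) =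
          r * (c * (n + 1) ^ k + (2 * (n + 1) ^ 2 + 2)) + (c * (n + 1) ^ k + (2 * (n + 1) ^ 2 + 2)) :=
          by ring
        omega
  refine ⟨.seq reset (.seq (.sweep (initMarks x) fun s a => (s, a))
    (.loop (fun v => v.2.alive) body)), c + 8, (k + 2) + 1, fun n e s M z he => ?_⟩
  obtain ⟨z1, hz1, hE1⟩ := passLeft_initMarks x s n M e
  have he1 : ∀ y : Fin 3, y.val < d → Function.update e x 0 y = e y := by
    intro y hy
    have : y ≠ x := fun h => by subst h; omega
    simp [this]
  obtain ⟨t2, z2, e2, ht2, he2, hE2⟩ := rounds n n le_rfl (Function.update e x 0) s M z1 (by simp)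
    (by simp [hz1]) (fun y hy => by rw [he1 y hy]; exact he y hy)
  have hfor : opFor x F e n (s, M) = (List.range' (n - n) n).foldl
      (fun S i => F (Function.update (Function.update e x 0) x i) n S) (s, M) := by
    simp [opFor, List.range_eq_range']
  rw [← hfor] at hE2
  have hE := Exec.seq (.load (fun v => (v.1, ⟨false, false, false, false⟩)) (s, z) (word n M e))
    (.seq (exec_sweep_of_passLeft hE1) hE2)
  refine ⟨_, z2, e2, ?_, fun y hy => (he2 y hy).trans (he1 y hy), hE⟩
  · rw [length_word]
    have h1 := sweep_bound n
    have h2 : c * (n + 1) ^ k ≤ c * (n + 1) ^ (k + 2) :=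
      Nat.mul_le_mul_left _ (Nat.pow_le_pow_right (by omega) (by omega))
    have h3 : (n + 1) ^ 2 ≤ (n + 1) ^ (k + 2) := Nat.pow_le_pow_right (by omega) (by omega)
    have h4 : 1 ≤ (n + 1) ^ (k + 2) := Nat.one_le_pow _ _ (by omega)
    have h5 : n * (c * (n + 1) ^ k + (2 * (n + 1) ^ 2 + 2)) ≤
        n * ((c + 4) * (n + 1) ^ (k + 2)) := Nat.mul_le_mul_left _ (by linarith)
    have h6 : (c + 8) * (n + 1) ^ (k + 2 + 1) =
        n * ((c + 4) * (n + 1) ^ (k + 2)) + n * (4 * (n + 1) ^ (k + 2)) +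
          (c + 8) * (n + 1) ^ (k + 2) := by ring
    nlinarith

end ops

/-- The adjacency matrix of a graph, with entries translated by `init`. -/
noncomputable def startMatrix {Γ : Type} (init : Bool → Γ) (G : FinGraph) (i j : ℕ) : Γ :=
  open Classical in
  init (decide (∃ (hi : i < G.1) (hj : j < G.1), G.2.Adj ⟨i, hi⟩ ⟨j, hj⟩))

/-- A function on graphs is computable in polynomial time by a Turing machine if it can be read off
from the result of an implementable operation on the adjacency matrix: the output consists of one
symbol that depends on the final state and, if `keep` holds there, of the translated final matrix.
-/
theorem polyTime_of_implementable {σ Γ O β : Type} [Finite σ] [Finite Γ] {F : Op σ Γ}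
    (hF : Implementable 0 F) (s₀ : σ) (init : Bool → Γ) (pre : σ → O) (keep : σ → Bool)
    (og : Option Γ → O) (eb : β → List O) (out : FinGraph → β)
    (h : ∀ G : FinGraph, ∀ S, S = F (fun _ => G.1) G.1 (s₀, startMatrix init G) →
      eb (out G) = pre S.1 :: if keep S.1 then (List.range G.1).flatMap fun i =>
          (List.range G.1).map (fun j => og (some (S.2 i j))) ++ [og none] else []) :
    Nonempty (TM2ComputableInPolyTime encodeGraph eb out) := by
  obtain ⟨-, p, c, k, hp⟩ := hF
  refine polyTime_of_exec p (s₀, ⟨false, false, false, false⟩)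
    (fun a => a.map fun b => (init b, (fun _ => false), fun _ => false)) (fun v => pre v.1)
    (fun v => keep v.1) (fun a => og (a.map Prod.fst)) encodeGraph eb out c k fun G => ?_
  have hw : (encodeGraph G).map
      (fun a => a.map fun b => (init b, (fun _ => false), fun _ => false)) =
        word G.1 (startMatrix init G) (fun _ => G.1) := by
    classical
    simp only [encodeGraph, word, List.map_flatMap]
    have e1 : List.range G.1 = (List.finRange G.1).map Fin.val := by
      simp
    rw [e1, List.flatMap_map]
    congr 1
    funext i
    simp only [List.map_append, List.map_map, List.map_cons, List.map_nil, Option.map_none]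
    congr 2
    funext j
    have hi : ¬ G.1 = i.val := by omega
    have hj : ¬ G.1 = j.val := by omega
    simp [entry, startMatrix, hi, hj]
  have hl : (encodeGraph G).length = G.1 * (G.1 + 1) := by
    rw [← length_word G.1 (startMatrix init G) (fun _ => G.1), ← hw, List.length_map]
  obtain ⟨t, z', e', ht, -, hE⟩ := hp G.1 (fun _ => G.1) s₀ (startMatrix init G)
    ⟨false, false, false, false⟩ (fun x hx => absurd hx (by omega))
  refine ⟨t, _, _, hw ▸ hE, by rw [length_word, hl], ht.trans ?_, ?_⟩
  · refine Nat.mul_le_mul_left _ (Nat.pow_le_pow_left ?_ _)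
    rw [hl]; nlinarith
  · rw [h G _ rfl]
    congr 1
    split
    · simp [word, List.map_flatMap, entry, Function.comp_def]
    · rfl

end machines

/-! ### Edge-labelings as symmetric functions of two vertices -/

/-- An edge-labeling of `G` with labels at most `k`, given by a symmetric function `g` on pairs of
vertices whose values at non-adjacent pairs are irrelevant. -/
structure IsLab {V : Type} (G : SimpleGraph V) (k : ℕ) (g : V → V → ℕ) : Prop where
  symm : ∀ u v, g u v = g v u
  le : ∀ {u v}, G.Adj u v → g u v ≤ k
  sep : ∀ {v u w}, G.Adj v u → G.Adj v w → u ≠ w → g v u + 2 ≤ g v w ∨ g v w + 2 ≤ g v u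
  far : ∀ {u v x y}, G.Adj u v → G.Adj u x → G.Adj v y → x ≠ v → y ≠ u → g u x ≠ g v y

section
variable {V : Type} {G : SimpleGraph V}

theorem lineGraph_adj_mk {u v w : V} (h : G.Adj v u) (h' : G.Adj v w) (hne : u ≠ w) :
    G.lineGraph.Adj ⟨s(v, u), h⟩ ⟨s(v, w), h'⟩ := by
  rw [SimpleGraph.lineGraph_adj_iff_exists]
  refine ⟨fun e => ?_, v, by simp⟩
  have : s(v, u) = s(v, w) := congrArg Subtype.val e
  exact hne (Sym2.congr_right.mp this)

/-- Two edges at distance one in the line graph, written with their common vertex first. -/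
theorem exists_of_lineGraph_adj {e e' : G.edgeSet} (h : G.lineGraph.Adj e e') :
    ∃ (v u w : V) (hu : G.Adj v u) (hw : G.Adj v w), u ≠ w ∧ e = ⟨s(v, u), hu⟩ ∧
      e' = ⟨s(v, w), hw⟩ := by
  rw [SimpleGraph.lineGraph_adj_iff_exists] at h
  obtain ⟨hne, v, hv, hv'⟩ := h
  obtain ⟨e, he⟩ := e
  obtain ⟨e', he'⟩ := e'
  obtain ⟨u, rfl⟩ := hv
  obtain ⟨w, rfl⟩ := hv'
  exact ⟨v, u, w, he, he', fun h => hne (by subst h; rfl), rfl, rfl⟩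

theorem dist_eq_two_iff {W : Type} {L : SimpleGraph W} {u v : W} :
    L.dist u v = 2 ↔ u ≠ v ∧ ¬ L.Adj u v ∧ ∃ m, L.Adj u m ∧ L.Adj m v := by
  rw [SimpleGraph.dist, ENat.toNat_eq_iff (by decide)]
  refine SimpleGraph.edist_eq_two_iff.trans (and_congr_right fun _ => and_congr_right fun _ => ?_)
  simp only [Set.Nonempty, SimpleGraph.mem_commonNeighbors, L.adj_comm v]

theorem ne_of_lineGraph_path {f : G.edgeSet → ℕ} (hf : IsEdgeLabeling G f) {e m e' : G.edgeSet}
    (h : G.lineGraph.Adj e m) (h' : G.lineGraph.Adj m e') (hne : e ≠ e') : f e ≠ f e' := by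
  intro hff
  by_cases ha : G.lineGraph.Adj e e'
  · have := hf.1 e e' (SimpleGraph.dist_eq_one_iff_adj.mpr ha)
    simp [hff] at this
  · have := hf.2 e e' (dist_eq_two_iff.mpr ⟨hne, ha, m, h, h'⟩)
    simp [hff] at this

open Classical in
/-- The function of two vertices belonging to an edge-labeling. -/
noncomputable def pairLabel (f : G.edgeSet → ℕ) (u v : V) : ℕ :=
  if h : G.Adj u v then f ⟨s(u, v), h⟩ else 0

theorem pairLabel_of_adj (f : G.edgeSet → ℕ) {u v : V} (h : G.Adj u v) :
    pairLabel f u v = f ⟨s(u, v), h⟩ := dif_pos h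

theorem isLab_pairLabel {k : ℕ} {f : G.edgeSet → ℕ} (hf : IsEdgeLabeling G f) (hk : ∀ e, f e ≤ k) :
    IsLab G k (pairLabel f) where
  symm u v := by
    by_cases h : G.Adj u v
    · rw [pairLabel_of_adj f h, pairLabel_of_adj f h.symm]
      congr 2
      exact Sym2.eq_swap
    · rw [pairLabel, pairLabel, dif_neg h, dif_neg fun h' => h h'.symm]
  le h := by rw [pairLabel_of_adj f h]; exact hk _
  sep hu hw hne := by
    rw [pairLabel_of_adj f hu, pairLabel_of_adj f hw]
    have := hf.1 _ _ (SimpleGraph.dist_eq_one_iff_adj.mpr (lineGraph_adj_mk hu hw hne))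
    rw [le_abs] at this
    omega
  far {u v x y} h hx hy hne hne' := by
    rw [pairLabel_of_adj f hx, pairLabel_of_adj f hy]
    refine ne_of_lineGraph_path hf (lineGraph_adj_mk hx h hne) (m := ⟨s(u, v), h⟩) ?_ ?_
    · have := lineGraph_adj_mk h.symm hy hne'.symm
      rwa [show (⟨s(v, u), h.symm⟩ : G.edgeSet) = ⟨s(u, v), h⟩ from Subtype.ext Sym2.eq_swap] at this
    · intro e
      have e : s(u, x) = s(v, y) := congrArg Subtype.val e
      rw [Sym2.eq_iff] at e
      rcases e with ⟨rfl, -⟩ | ⟨-, rfl⟩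
      · exact h.ne rfl
      · exact hne rfl

/-- The edge-labeling belonging to a function of two vertices. -/
def edgeLabel {k : ℕ} {g : V → V → ℕ} (hg : IsLab G k g) (e : G.edgeSet) : ℕ :=
  Sym2.lift ⟨g, hg.symm⟩ e.1

theorem edgeLabel_mk {k : ℕ} {g : V → V → ℕ} (hg : IsLab G k g) {u v : V} (h : G.Adj u v) :
    edgeLabel hg ⟨s(u, v), h⟩ = g u v := rfl

theorem edgeLabel_le {k : ℕ} {g : V → V → ℕ} (hg : IsLab G k g) (e : G.edgeSet) :
    edgeLabel hg e ≤ k := by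
  obtain ⟨e, he⟩ := e
  induction e with
  | h u v => exact hg.le he

theorem isEdgeLabeling_edgeLabel {k : ℕ} {g : V → V → ℕ} (hg : IsLab G k g) :
    IsEdgeLabeling G (edgeLabel hg) := by
  constructor
  · intro e e' h
    obtain ⟨v, u, w, hu, hw, hne, rfl, rfl⟩ :=
      exists_of_lineGraph_adj (SimpleGraph.dist_eq_one_iff_adj.mp h)
    rw [edgeLabel_mk, edgeLabel_mk, le_abs]
    have := hg.sep hu hw hne
    omega
  · intro e e' h
    obtain ⟨hne, hna, m, h1, h2⟩ := dist_eq_two_iff.mp h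
    obtain ⟨v, x, u, hx, hu, hxu, rfl, rfl⟩ := exists_of_lineGraph_adj h1
    obtain ⟨u', v', y, hv', hy, hvy, e, rfl⟩ := exists_of_lineGraph_adj h2
    have e : s(v, u) = s(u', v') := congrArg Subtype.val e
    rw [Sym2.eq_iff] at e
    rcases e with ⟨rfl, rfl⟩ | ⟨rfl, rfl⟩
    · exact absurd (lineGraph_adj_mk hx hy fun h => hne (by subst h; rfl)) hna
    · rw [edgeLabel_mk, edgeLabel_mk, le_abs]
      have := hg.far hu hx hy hxu hvy.symm
      omega

theorem lambdaEdge_le_iff [Finite V] (k : ℕ) : lambdaEdge G ≤ k ↔ ∃ g, IsLab G k g := by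
  constructor
  · intro h
    obtain ⟨f, hf, hm⟩ := exists_labeling_maxLabel_eq G
    refine ⟨_, isLab_pairLabel hf fun e => ?_⟩
    refine le_trans ?_ (hm.le.trans h)
    exact le_ciSup (Set.finite_range f).bddAbove e
  · rintro ⟨g, hg⟩
    have h : lambdaEdge G ≤ maxLabel (edgeLabel hg) :=
      Nat.sInf_le ⟨edgeLabel hg, isEdgeLabeling_edgeLabel hg, rfl⟩
    exact h.trans (ciSup_le' fun e => edgeLabel_le hg e)

/-- A labeling with labels at most `lambdaEdge G` is optimal. -/
theorem maxLabel_edgeLabel [Finite V] {g : V → V → ℕ} (hg : IsLab G (lambdaEdge G) g) :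
    maxLabel (edgeLabel hg) = lambdaEdge G :=
  le_antisymm (ciSup_le' fun e => edgeLabel_le hg e)
    (Nat.sInf_le ⟨edgeLabel hg, isEdgeLabeling_edgeLabel hg, rfl⟩)

theorem IsLab.mono {k l : ℕ} {g : V → V → ℕ} (hg : IsLab G k g) (h : k ≤ l) : IsLab G l g :=
  ⟨hg.symm, fun a => (hg.le a).trans h, hg.sep, hg.far⟩

/-- Labelings are pulled back along injective graph homomorphisms. -/
theorem IsLab.comap {W : Type} {H : SimpleGraph W} {k : ℕ} {g : V → V → ℕ} (hg : IsLab G k g)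
    (φ : H →g G) (hφ : Function.Injective φ) : IsLab H k fun u v => g (φ u) (φ v) where
  symm _ _ := hg.symm _ _
  le h := hg.le (φ.map_adj h)
  sep hu hw hne := hg.sep (φ.map_adj hu) (φ.map_adj hw) (hφ.ne hne)
  far h hx hy h1 h2 := hg.far (φ.map_adj h) (φ.map_adj hx) (φ.map_adj hy) (hφ.ne h1) (hφ.ne h2)

theorem lambdaEdge_le_of_hom [Finite V] {W : Type} [Finite W] {H : SimpleGraph W} (φ : H →g G)
    (hφ : Function.Injective φ) : lambdaEdge H ≤ lambdaEdge G := by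
  obtain ⟨g, hg⟩ := (lambdaEdge_le_iff (G := G) _).mp le_rfl
  exact (lambdaEdge_le_iff _).mpr ⟨_, hg.comap φ hφ⟩

theorem lambdaEdge_congr [Finite V] {W : Type} [Finite W] {H : SimpleGraph W} (φ : G ≃g H) :
    lambdaEdge G = lambdaEdge H :=
  le_antisymm (lambdaEdge_le_of_hom φ.toHom φ.injective)
    (lambdaEdge_le_of_hom φ.symm.toHom φ.symm.injective)

/-! ### Labels around a vertex of degree three -/

/-- With labels at most `4`, the labels of three edges at a vertex are `0`, `2` and `4`. -/
theorem IsLab.three {g : V → V → ℕ} (hg : IsLab G 4 g) {v a b c : V} (ha : G.Adj v a)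
    (hb : G.Adj v b) (hc : G.Adj v c) (hab : a ≠ b) (hac : a ≠ c) (hbc : b ≠ c) :
    (g v a = 0 ∨ g v a = 2 ∨ g v a = 4) ∧ (g v a = 2 ∨ g v b = 2 ∨ g v c = 2) := by
  have h1 := hg.le ha
  have h2 := hg.le hb
  have h3 := hg.le hc
  have h4 := hg.sep ha hb hab
  have h5 := hg.sep ha hc hac
  have h6 := hg.sep hb hc hbc
  omega

theorem IsLab.not_four {g : V → V → ℕ} (hg : IsLab G 4 g) {v a b c d : V} (ha : G.Adj v a)
    (hb : G.Adj v b) (hc : G.Adj v c) (hd : G.Adj v d) (hab : a ≠ b) (hac : a ≠ c) (had : a ≠ d)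
    (hbc : b ≠ c) (hbd : b ≠ d) (hcd : c ≠ d) : False := by
  have h1 := hg.le ha
  have h2 := hg.le hb
  have h3 := hg.le hc
  have h4 := hg.le hd
  have h5 := hg.sep ha hb hab
  have h6 := hg.sep ha hc hac
  have h7 := hg.sep hb hc hbc
  have h8 := hg.sep ha hd had
  have h9 := hg.sep hb hd hbd
  have h10 := hg.sep hc hd hcd
  omega

/-- With labels at most `4`, an edge labeled `2` at a vertex of degree three is pendant. -/
theorem IsLab.leaf {g : V → V → ℕ} (hg : IsLab G 4 g) {v a b c : V} (ha : G.Adj v a)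
    (hb : G.Adj v b) (hc : G.Adj v c) (hab : a ≠ b) (hac : a ≠ c) (hbc : b ≠ c)
    (h2 : g v a = 2) {x : V} (hx : G.Adj a x) : x = v := by
  by_contra hne
  have h3 := hg.far ha hb hx hab.symm hne
  have h4 := hg.far ha hc hx hac.symm hne
  have h5 := hg.sep hx ha.symm hne
  have h6 := hg.sep ha hb hab
  have h7 := hg.sep ha hc hac
  have h8 := hg.sep hb hc hbc
  have h9 := hg.le hb
  have h10 := hg.le hc
  have h11 := hg.le hx
  rw [hg.symm a v] at h5
  omega

end

/-! ### Elimination in binary constraint networks of maximum degree two -/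

/-- A binary constraint network on variables numbered by `ℕ` with values in `D`. The relation
`rel u u` is only used on the diagonal, as a constraint on the single variable `u`; `con u w` tells
that the distinct variables `u` and `w` are constrained. -/
structure Net (D : Type) where
  con : ℕ → ℕ → Prop
  rel : ℕ → ℕ → D → D → Prop

namespace Net
variable {D : Type}

/-- `X` satisfies all constraints between the variables `i, …, n - 1`. -/
def Sol (N : Net D) (i n : ℕ) (X : ℕ → D) : Prop :=
  ∀ u w, i ≤ u → u < n → i ≤ w → w < n → N.rel u w (X u) (X w)

/-- The network is symmetric, and unconstrained pairs carry the trivial relation. -/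
structure Proper (N : Net D) : Prop where
  con_symm : ∀ {u w}, N.con u w → N.con w u
  rel_symm : ∀ {u w a c}, N.rel u w a c → N.rel w u c a
  rel_of_not_con : ∀ {u w}, u ≠ w → ¬ N.con u w → ∀ a c, N.rel u w a c

/-- Each of the variables `i, …, n - 1` is constrained with at most two others. -/
def DegTwo (N : Net D) (i n : ℕ) : Prop :=
  ∀ v, i ≤ v → v < n → ∃ p q, ∀ u, i ≤ u → u < n → u ≠ v → N.con v u → u = p ∨ u = q

/-- Eliminate the variable `v`: constrain the later variables that are constrained with `v` by
what their values imply about each other through `v`. -/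
def elim (v : ℕ) (N : Net D) : Net D where
  con u w := N.con u w ∨ (v < u ∧ v < w ∧ N.con u v ∧ N.con v w)
  rel u w a c := N.rel u w a c ∧ (v < u ∧ v < w ∧ N.con u v ∧ N.con v w →
    ∃ b, N.rel v v b b ∧ N.rel u v a b ∧ N.rel v w b c)

theorem Proper.elim {N : Net D} (h : N.Proper) (v : ℕ) : (N.elim v).Proper where
  con_symm := by
    rintro u w (h1 | ⟨h1, h2, h3, h4⟩)
    · exact .inl (h.con_symm h1)
    · exact .inr ⟨h2, h1, h.con_symm h4, h.con_symm h3⟩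
  rel_symm := by
    rintro u w a c ⟨h1, h2⟩
    refine ⟨h.rel_symm h1, fun ⟨h3, h4, h5, h6⟩ => ?_⟩
    obtain ⟨b, hb, hb1, hb2⟩ := h2 ⟨h4, h3, h.con_symm h6, h.con_symm h5⟩
    exact ⟨b, hb, h.rel_symm hb2, h.rel_symm hb1⟩
  rel_of_not_con hne hc a c := by
    simp only [Net.elim, not_or] at hc
    exact ⟨h.rel_of_not_con hne hc.1 a c, fun h' => absurd h' hc.2⟩

theorem DegTwo.elim {N : Net D} (h : N.Proper) {v n : ℕ} (hd : N.DegTwo v n) (hv : v < n) :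
    (N.elim v).DegTwo (v + 1) n := by
  intro x hx hxn
  obtain ⟨p, q, hpq⟩ := hd x (by omega) hxn
  obtain ⟨p', q', hpq'⟩ := hd v le_rfl hv
  by_cases hc : N.con x v
  · -- `x` loses the neighbour `v` and gains at most the other neighbour of `v`
    have hvx := hpq v le_rfl hv (by omega) hc
    have hxv := hpq' x (by omega) hxn (by omega) (h.con_symm hc)
    refine ⟨if v = p then q else p, if x = p' then q' else p', fun u hu hun hne hcu => ?_⟩
    rcases hcu with h1 | ⟨-, -, -, h1⟩
    · have := hpq u (by omega) hun hne h1
      split_ifs <;> omega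
    · have := hpq' u (by omega) hun (by omega) h1
      split_ifs <;> omega
  · refine ⟨p, q, fun u hu hun hne hcu => ?_⟩
    rcases hcu with h1 | ⟨-, -, h1, -⟩
    · exact hpq u (by omega) hun hne h1
    · exact absurd h1 hc

theorem Sol.elim {N : Net D} {v n : ℕ} {X : ℕ → D} (hv : v < n) (h : N.Sol v n X) :
    (N.elim v).Sol (v + 1) n X := fun u w hu hun hw hwn =>
  ⟨h u w (by omega) hun (by omega) hwn, fun _ => ⟨X v, h v v le_rfl hv le_rfl hv,
    h u v (by omega) hun le_rfl hv, h v w le_rfl hv (by omega) hwn⟩⟩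

/-- A value for the eliminated variable can be found, because at most two variables constrain it. -/
theorem exists_value {N : Net D} (h : N.Proper) {v n : ℕ} (hd : N.DegTwo v n) (hv : v < n)
    {X : ℕ → D} (hX : (N.elim v).Sol (v + 1) n X) (hne : ∃ b, N.rel v v b b) :
    ∃ b, N.rel v v b b ∧ ∀ u, v < u → u < n → N.con v u → N.rel v u b (X u) := by
  obtain ⟨p, q, hpq⟩ := hd v le_rfl hv
  have key : ∀ u w, v < u → u < n → v < w → w < n → N.con v u → N.con v w →
      ∃ b, N.rel v v b b ∧ N.rel v u b (X u) ∧ N.rel v w b (X w) := by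
    intro u w hu hun hw hwn hcu hcw
    obtain ⟨b, h1, h2, h3⟩ := (hX u w hu hun hw hwn).2 ⟨hu, hw, h.con_symm hcu, hcw⟩
    exact ⟨b, h1, h.rel_symm h2, h3⟩
  by_cases hp : v < p ∧ p < n ∧ N.con v p <;> by_cases hq : v < q ∧ q < n ∧ N.con v q
  · obtain ⟨b, h1, h2, h3⟩ := key p q hp.1 hp.2.1 hq.1 hq.2.1 hp.2.2 hq.2.2
    refine ⟨b, h1, fun u hu hun hc => ?_⟩
    rcases hpq u hu.le hun hu.ne' hc with rfl | rfl <;> assumption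
  · obtain ⟨b, h1, h2, -⟩ := key p p hp.1 hp.2.1 hp.1 hp.2.1 hp.2.2 hp.2.2
    refine ⟨b, h1, fun u hu hun hc => ?_⟩
    rcases hpq u hu.le hun hu.ne' hc with rfl | rfl
    · assumption
    · exact absurd ⟨hu, hun, hc⟩ hq
  · obtain ⟨b, h1, h2, -⟩ := key q q hq.1 hq.2.1 hq.1 hq.2.1 hq.2.2 hq.2.2
    refine ⟨b, h1, fun u hu hun hc => ?_⟩
    rcases hpq u hu.le hun hu.ne' hc with rfl | rfl
    · exact absurd ⟨hu, hun, hc⟩ hp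
    · assumption
  · obtain ⟨b, h1⟩ := hne
    refine ⟨b, h1, fun u hu hun hc => ?_⟩
    rcases hpq u hu.le hun hu.ne' hc with rfl | rfl
    · exact absurd ⟨hu, hun, hc⟩ hp
    · exact absurd ⟨hu, hun, hc⟩ hq

theorem Sol.extend {N : Net D} (h : N.Proper) {v n : ℕ} {X : ℕ → D}
    (hX : (N.elim v).Sol (v + 1) n X) {b : D} (hb : N.rel v v b b)
    (hb' : ∀ u, v < u → u < n → N.con v u → N.rel v u b (X u)) :
    N.Sol v n (Function.update X v b) := by
  have h1 : ∀ u, v < u → u < n → N.rel v u b (X u) := fun u hu hun => by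
    by_cases hc : N.con v u
    · exact hb' u hu hun hc
    · exact h.rel_of_not_con hu.ne hc _ _
  intro u w hu hun hw hwn
  rcases hu.eq_or_lt with rfl | hu <;> rcases hw.eq_or_lt with rfl | hw
  · simpa using hb
  · simpa [hw.ne'] using h1 w hw hwn
  · simpa [hu.ne'] using h.rel_symm (h1 u hu hun)
  · simpa [hw.ne', hu.ne'] using (hX u w hu hun hw hwn).1

/-- Eliminate the variables `0, …, i - 1`, in this order. -/
def elims (N : Net D) : ℕ → Net D
  | 0 => N
  | i + 1 => (N.elims i).elim i

theorem proper_elims {N : Net D} (h : N.Proper) (i : ℕ) : (N.elims i).Proper := by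
  induction i with
  | zero => exact h
  | succ i ih => exact ih.elim i

theorem degTwo_elims {N : Net D} (h : N.Proper) {n : ℕ} (hd : N.DegTwo 0 n) (i : ℕ) (hi : i ≤ n) :
    (N.elims i).DegTwo i n := by
  induction i with
  | zero => exact hd
  | succ i ih => exact (ih (by omega)).elim (proper_elims h i) hi

theorem sol_elims {N : Net D} {n : ℕ} {X : ℕ → D} (hX : N.Sol 0 n X) (i : ℕ) (hi : i ≤ n) :
    (N.elims i).Sol i n X := by
  induction i with
  | zero => exact hX
  | succ i ih => exact (ih (by omega)).elim hi

/-- Constraints of a variable do not change after its elimination. -/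
theorem elims_eq (N : Net D) {m j u w : ℕ} (hm : m ≤ j) (h : u ≤ m ∨ w ≤ m) :
    (N.elims j).rel u w = (N.elims m).rel u w ∧ (N.elims j).con u w = (N.elims m).con u w := by
  induction j, hm using Nat.le_induction with
  | base => exact ⟨rfl, rfl⟩
  | succ j hj ih =>
    rw [← ih.1, ← ih.2]
    constructor
    · funext a c
      simp only [elims, elim, eq_iff_iff, and_iff_left_iff_imp]
      intros
      omega
    · simp only [elims, elim, eq_iff_iff, or_iff_left_iff_imp]
      intros
      omega

theorem exists_of_sol {N : Net D} {n : ℕ} {X : ℕ → D} (hX : N.Sol 0 n X) {v : ℕ} (hv : v < n) :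
    ∃ b, (N.elims n).rel v v b b := by
  refine ⟨X v, ?_⟩
  rw [(N.elims_eq hv.le (.inl le_rfl)).1]
  exact sol_elims hX v hv.le v v le_rfl hv le_rfl hv

/-- `b` is compatible, in the network after all eliminations, with the values of the later
variables. -/
def Fits (N : Net D) (n v : ℕ) (X : ℕ → D) (b : D) : Prop :=
  (N.elims n).rel v v b b ∧
    ∀ u, v < u → u < n → (N.elims n).con v u → (N.elims n).rel v u b (X u)

theorem exists_fits {N : Net D} (h : N.Proper) {n : ℕ} (hd : N.DegTwo 0 n) {v : ℕ} (hv : v < n)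
    {X : ℕ → D} (hX : (N.elims (v + 1)).Sol (v + 1) n X) (hne : ∃ b, (N.elims n).rel v v b b) :
    ∃ b, N.Fits n v X b := by
  unfold Fits
  rw [(N.elims_eq hv.le (.inl le_rfl)).1] at hne ⊢
  obtain ⟨b, h1, h2⟩ := exists_value (proper_elims h v) (degTwo_elims h hd v hv.le) hv hX hne
  refine ⟨b, h1, fun u hu hun => ?_⟩
  rw [(N.elims_eq hv.le (.inl le_rfl)).1, (N.elims_eq hv.le (.inl le_rfl)).2]
  exact h2 u hu hun

theorem Sol.extend_elims {N : Net D} (h : N.Proper) {n : ℕ} {v : ℕ} (hv : v < n)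
    {X : ℕ → D} (hX : (N.elims (v + 1)).Sol (v + 1) n X) {b : D} (hb : N.Fits n v X b) :
    (N.elims v).Sol v n (Function.update X v b) := by
  unfold Fits at hb
  rw [(N.elims_eq hv.le (.inl le_rfl)).1] at hb
  refine Sol.extend (proper_elims h v) hX hb.1 fun u hu hun => ?_
  rw [← (N.elims_eq hv.le (.inl le_rfl)).1, ← (N.elims_eq hv.le (.inl le_rfl)).2]
  exact hb.2 u hu hun

end Net

/-! ### The constraint network of a graph -/

section
open Classical

/-- The number of neighbours of `u` that are smaller than `v`. -/
noncomputable def rank (H : SimpleGraph ℕ) (u v : ℕ) : ℕ := {w ∈ Finset.range v | H.Adj u w}.card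

variable {H : SimpleGraph ℕ}

theorem rank_succ (u v : ℕ) : rank H u (v + 1) = rank H u v + if H.Adj u v then 1 else 0 := by
  rw [rank, Finset.range_add_one, Finset.filter_insert]
  split_ifs with h
  · rw [Finset.card_insert_of_notMem (by simp), rank]
  · rfl

theorem rank_mono (u : ℕ) : Monotone (rank H u) :=
  monotone_nat_of_le_succ fun v => by rw [rank_succ]; omega

theorem rank_lt {u v n : ℕ} (h : H.Adj u v) (hv : v < n) : rank H u v < rank H u n := by
  have := rank_mono (H := H) u (show v + 1 ≤ n from hv)
  rw [rank_succ, if_pos h] at this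
  omega

theorem rank_inj {u v w : ℕ} (hv : H.Adj u v) (hw : H.Adj u w) (h : rank H u v = rank H u w) :
    v = w := by
  rcases lt_trichotomy v w with h1 | h1 | h1
  · have := rank_lt hv h1; omega
  · exact h1
  · have := rank_lt hw h1; omega

theorem exists_rank_eq {u n i : ℕ} (hi : i < rank H u n) : ∃ v < n, H.Adj u v ∧ rank H u v = i := by
  induction n with
  | zero => simp [rank] at hi
  | succ n ih =>
    by_cases h : i < rank H u n
    · obtain ⟨v, hv, h'⟩ := ih h
      exact ⟨v, by omega, h'⟩
    · rw [rank_succ] at hi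
      split_ifs at hi with ha
      · exact ⟨n, by omega, ha, by omega⟩
      · omega

/-- The labels of the at most three edges at a vertex, listed by the ranks of the neighbours. -/
abbrev Dom : Type := Fin 3 → Fin 5

/-- The label of the edge of rank `i`. -/
def lab (a : Dom) (i : ℕ) : ℕ := if h : i < 3 then (a ⟨i, h⟩).val else 0

/-- Labels at a vertex of degree `d`: they are at most `k` and two apart. -/
def AtVertex (k d : ℕ) (a : Dom) : Prop :=
  (∀ i < d, lab a i ≤ k) ∧
    ∀ i < d, ∀ j < d, i ≠ j → lab a i + 2 ≤ lab a j ∨ lab a j + 2 ≤ lab a i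

/-- Labels at two adjacent vertices, of degrees `d` and `d'`, whose common edge has rank `r` and
`r'` respectively: they agree on the common edge, and the other labels are distinct. -/
def AtEdge (r r' d d' : ℕ) (a c : Dom) : Prop :=
  lab a r = lab c r' ∧ ∀ i < d, ∀ j < d', i ≠ r → j ≠ r' → lab a i ≠ lab c j

/-- Ranks and degrees above `4` need not be told apart. -/
noncomputable def rank4 (H : SimpleGraph ℕ) (u v : ℕ) : ℕ := min (rank H u v) 4

/-- Adjacent vertices none of which is a leaf. -/
def Core (H : SimpleGraph ℕ) (n u w : ℕ) : Prop :=
  H.Adj u w ∧ 2 ≤ rank4 H u n ∧ 2 ≤ rank4 H w n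

/-- The network whose solutions are the labelings of the graph `H` on `0, …, n - 1` with labels at
most `k`. Pendant edges give no constraint, since the label at the leaf can be chosen last. -/
def graphNet (H : SimpleGraph ℕ) (n k : ℕ) : Net Dom where
  con := Core H n
  rel u w a c := (u = w → AtVertex k (rank4 H u n) a ∧ AtVertex k (rank4 H u n) c) ∧
    (Core H n u w →
      AtEdge (rank4 H u w) (rank4 H w u) (rank4 H u n) (rank4 H w n) a c)

theorem core_symm {n u w : ℕ} (h : Core H n u w) : Core H n w u := ⟨h.1.symm, h.2.2, h.2.1⟩

theorem proper_graphNet (n k : ℕ) : (graphNet H n k).Proper where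
  con_symm := core_symm
  rel_symm := by
    rintro u w a c ⟨h1, h2⟩
    refine ⟨fun h => ?_, fun h => ?_⟩
    · subst h
      exact (h1 rfl).symm
    · obtain ⟨h3, h4⟩ := h2 (core_symm h)
      exact ⟨h3.symm, fun i hi j hj hi' hj' => (h4 j hj i hi hj' hi').symm⟩
  rel_of_not_con hne hc a c := ⟨fun h => absurd h hne, fun h => absurd h hc⟩

/-- The number of neighbours of `u` that are smaller than `v`, not counting pendant edges. -/
noncomputable def coreRank (H : SimpleGraph ℕ) (n u v : ℕ) : ℕ :=
  {w ∈ Finset.range v | Core H n u w}.card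

theorem coreRank_succ (n u v : ℕ) :
    coreRank H n u (v + 1) = coreRank H n u v + if Core H n u v then 1 else 0 := by
  rw [coreRank, Finset.range_add_one, Finset.filter_insert]
  split_ifs with h
  · rw [Finset.card_insert_of_notMem (by simp), coreRank]
  · rfl

theorem degTwo_graphNet {n k : ℕ} (h : ∀ u < n, coreRank H n u n ≤ 2) :
    (graphNet H n k).DegTwo 0 n := by
  intro v _ hv
  have h2 : Finset.card {w ∈ Finset.range n | Core H n v w} ≤ 2 := h v hv
  have : ∃ p q, {w ∈ Finset.range n | Core H n v w} ⊆ {p, q} := by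
    rcases Nat.le_succ_iff.mp h2 with h1 | h1
    · obtain ⟨p, hp⟩ := Finset.card_le_one_iff_subset_singleton.mp h1
      exact ⟨p, p, by simpa using hp⟩
    · obtain ⟨p, q, -, hpq⟩ := Finset.card_eq_two.mp h1
      exact ⟨p, q, hpq.subset⟩
  obtain ⟨p, q, hpq⟩ := this
  refine ⟨p, q, fun u _ hu _ hc => ?_⟩
  simpa using hpq (Finset.mem_filter.mpr ⟨Finset.mem_range.mpr hu, hc⟩)

variable {n k : ℕ}

theorem rank_le_three {g : ℕ → ℕ → ℕ} (hg : IsLab H 4 g) (u : ℕ) : rank H u n ≤ 3 := by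
  by_contra h
  have hh : ∀ i < 4, ∃ v, H.Adj u v ∧ rank H u v = i := fun i hi => by
    obtain ⟨v, -, h'⟩ := exists_rank_eq (show i < rank H u n by omega)
    exact ⟨v, h'⟩
  obtain ⟨a, ha, hra⟩ := hh 0 (by omega)
  obtain ⟨b, hb, hrb⟩ := hh 1 (by omega)
  obtain ⟨c, hc, hrc⟩ := hh 2 (by omega)
  obtain ⟨d, hd, hrd⟩ := hh 3 (by omega)
  refine hg.not_four ha hb hc hd ?_ ?_ ?_ ?_ ?_ ?_ <;> rintro rfl <;> omega

theorem coreRank_le_two {g : ℕ → ℕ → ℕ} (hg : IsLab H 4 g) (u : ℕ) :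
    coreRank H n u n ≤ 2 := by
  by_contra h
  obtain ⟨a, b, c, ha, hb, hc, hab, hac, hbc⟩ := Finset.two_lt_card_iff.mp (not_le.mp h)
  simp only [Finset.mem_filter, Finset.mem_range] at ha hb hc
  -- the neighbour along the edge labeled `2` would be a leaf
  have key : ∀ a, Core H n u a → (∀ x, H.Adj a x → x = u) → False := by
    intro a ha hx
    have h2 : 1 < rank H a n := by have := ha.2.2; unfold rank4 at this; omega
    obtain ⟨v, hv, hv', h1⟩ := exists_rank_eq (show 0 < rank H a n by omega)
    obtain ⟨w, hw, hw', h2⟩ := exists_rank_eq h2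
    rw [hx v hv'] at h1
    rw [hx w hw'] at h2
    omega
  rcases (hg.three ha.2.1 hb.2.1 hc.2.1 hab hac hbc).2 with h2 | h2 | h2
  · exact key a ha.2 fun x hx => hg.leaf ha.2.1 hb.2.1 hc.2.1 hab hac hbc h2 hx
  · exact key b hb.2 fun x hx => hg.leaf hb.2.1 ha.2.1 hc.2.1 hab.symm hbc hac h2 hx
  · exact key c hc.2 fun x hx => hg.leaf hc.2.1 ha.2.1 hb.2.1 hac.symm hbc.symm hab h2 hx

/-- A labeling of the graph gives a solution of the network. -/
theorem exists_sol (hk : k ≤ 4) (hn : ∀ u v, H.Adj u v → v < n) {g : ℕ → ℕ → ℕ} (hg : IsLab H k g) :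
    ∃ X, (graphNet H n k).Sol 0 n X := by
  have h3 : ∀ u, rank H u n ≤ 3 := fun u => rank_le_three (hg.mono hk) u
  have h4 : ∀ u, rank4 H u n = rank H u n := fun u => by have := h3 u; unfold rank4; omega
  let X : ℕ → Dom := fun u i =>
    if h : ∃ v, H.Adj u v ∧ rank H u v = i.val then
      ⟨g u h.choose, by have := hg.le h.choose_spec.1; omega⟩ else 0
  have hX : ∀ {u v}, H.Adj u v → lab (X u) (rank H u v) = g u v := by
    intro u v huv
    have h1 : rank H u v < 3 := (rank_lt huv (hn u v huv)).trans_le (h3 u)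
    have hex : ∃ w, H.Adj u w ∧ rank H u w = (⟨rank H u v, h1⟩ : Fin 3).val := ⟨v, huv, rfl⟩
    rw [lab, dif_pos h1]
    simp only [X]
    rw [dif_pos hex]
    change g u hex.choose = g u v
    rw [rank_inj hex.choose_spec.1 huv hex.choose_spec.2]
  have hat : ∀ u, AtVertex k (rank4 H u n) (X u) := by
    intro u
    rw [h4]
    refine ⟨fun i hi => ?_, fun i hi j hj hne => ?_⟩
    · obtain ⟨v, -, hv, rfl⟩ := exists_rank_eq hi
      rw [hX hv]
      exact hg.le hv
    · obtain ⟨v, -, hv, rfl⟩ := exists_rank_eq hi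
      obtain ⟨w, -, hw, rfl⟩ := exists_rank_eq hj
      rw [hX hv, hX hw]
      exact hg.sep hv hw fun h => hne (by rw [h])
  refine ⟨X, fun u w _ hu _ hw => ⟨fun h => ?_, fun h => ?_⟩⟩
  · subst h
    exact ⟨hat u, hat u⟩
  · have huw := h.1
    have e1 : rank4 H u w = rank H u w := by
      have := rank_lt huw hw; have := h3 u; unfold rank4; omega
    have e2 : rank4 H w u = rank H w u := by
      have := rank_lt huw.symm hu; have := h3 w; unfold rank4; omega
    rw [e1, e2, h4, h4]
    refine ⟨by rw [hX huw, hX huw.symm, hg.symm], fun i hi j hj hir hjr => ?_⟩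
    obtain ⟨x, -, hx, rfl⟩ := exists_rank_eq hi
    obtain ⟨y, -, hy, rfl⟩ := exists_rank_eq hj
    rw [hX hx, hX hy]
    exact hg.far huw hx hy (fun h => hir (by rw [h])) fun h => hjr (by rw [h])

/-- The label of an edge read off from the labels at a non-leaf end. -/
noncomputable def readLabel (H : SimpleGraph ℕ) (n : ℕ) (X : ℕ → Dom) (u v : ℕ) : ℕ :=
  if 2 ≤ rank4 H u n then lab (X u) (rank4 H u v)
  else if 2 ≤ rank4 H v n then lab (X v) (rank4 H v u) else 0

/-- A solution of the network gives a labeling of the graph. -/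
theorem isLab_readLabel (hn : ∀ u v, H.Adj u v → v < n) (h3 : ∀ u < n, rank H u n ≤ 3)
    {X : ℕ → Dom} (hX : (graphNet H n k).Sol 0 n X) :
    IsLab H k fun u v => if H.Adj u v then readLabel H n X u v else 0 := by
  have hn' : ∀ {u v}, H.Adj u v → u < n := fun h => hn _ _ h.symm
  have h4 : ∀ {u v}, H.Adj u v → rank4 H u n = rank H u n := fun {u v} h => by
    have := h3 u (hn' h); unfold rank4; omega
  have hr : ∀ {u v}, H.Adj u v → rank4 H u v = rank H u v := fun {u v} h => by
    have := h3 u (hn' h); have := rank_lt h (hn _ _ h); unfold rank4; omega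
  have hlt : ∀ {u v}, H.Adj u v → rank4 H u v < rank4 H u n := fun {u v} h => by
    rw [h4 h, hr h]; exact rank_lt h (hn _ _ h)
  have hinj : ∀ {u v w}, H.Adj u v → H.Adj u w → rank4 H u v = rank4 H u w → v = w :=
    fun {u v w} h h' e => rank_inj h h' (by rwa [hr h, hr h'] at e)
  have hat : ∀ u < n, AtVertex k (rank4 H u n) (X u) := fun u hu =>
    ((hX u u (Nat.zero_le _) hu (Nat.zero_le _) hu).1 rfl).1
  have hedge : ∀ {u v}, H.Adj u v → 2 ≤ rank4 H u n → 2 ≤ rank4 H v n →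
      AtEdge (rank4 H u v) (rank4 H v u) (rank4 H u n) (rank4 H v n) (X u) (X v) :=
    fun {u v} h h1 h2 => (hX u v (Nat.zero_le _) (hn' h) (Nat.zero_le _) (hn _ _ h)).2 ⟨h, h1, h2⟩
  have hsymm : ∀ {u v}, H.Adj u v → readLabel H n X u v = readLabel H n X v u := by
    intro u v h
    unfold readLabel
    split_ifs with h1 h2
    · exact (hedge h h1 h2).1
    all_goals rfl
  have htwo : ∀ {v u w}, H.Adj v u → H.Adj v w → u ≠ w → 2 ≤ rank4 H v n := by
    intro v u w hu hw hne
    have h1 := hlt hu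
    have h2 := hlt hw
    by_contra h
    exact hne (hinj hu hw (by omega))
  refine ⟨fun u v => ?_, fun {u v} h => ?_, fun {v u w} hu hw hne => ?_,
    fun {u v x y} h hx hy hxv hyu => ?_⟩
  · by_cases h : H.Adj u v
    · rw [if_pos h, if_pos h.symm, hsymm h]
    · rw [if_neg h, if_neg fun h' => h h'.symm]
  · rw [if_pos h]
    unfold readLabel
    split_ifs
    · exact (hat u (hn' h)).1 _ (hlt h)
    · exact (hat v (hn _ _ h)).1 _ (hlt h.symm)
    · exact Nat.zero_le _
  · rw [if_pos hu, if_pos hw, readLabel, readLabel, if_pos (htwo hu hw hne),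
      if_pos (htwo hu hw hne)]
    exact (hat v (hn' hu)).2 _ (hlt hu) _ (hlt hw) fun e => hne (hinj hu hw e)
  · have hu2 := htwo hx h hxv
    have hv2 := htwo hy h.symm hyu
    rw [if_pos hx, if_pos hy, readLabel, readLabel, if_pos hu2, if_pos hv2]
    exact (hedge h hu2 hv2).2 _ (hlt hx) _ (hlt hy) (fun e => hxv (hinj hx h e))
      fun e => hyu (hinj hy h.symm e)

end

/-! ### The search algorithm -/

section ops
variable {σ Γ : Type}

/-- Read the entry in row `x` and column `y`. -/
def opRead (x y : Fin 3) (f : σ → Γ → σ) : Op σ Γ := fun e _ S => (f S.1 (S.2 (e x) (e y)), S.2)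

theorem implementable_read {d : ℕ} (x y : Fin 3) (hx : x.val < d) (hy : y.val < d)
    (f : σ → Γ → σ) : Implementable d (opRead x y f) := by
  have : opRead x y f = opAcc x y fun s γ => (f s γ, γ) := by
    funext e n S
    refine Prod.ext rfl ?_
    funext i j
    simp only [opRead, opAcc, setAt]
    split_ifs with h
    · rw [h.1, h.2]
    · rfl
  rw [this]
  exact implementable_acc x y hx hy _

/-- Induction over the rounds of a loop. -/
theorem opFor_ind (x : Fin 3) {F : Op σ Γ} {e : Fin 3 → ℕ} {n : ℕ} {S : σ × (ℕ → ℕ → Γ)}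
    (I : ℕ → σ × (ℕ → ℕ → Γ) → Prop) (h0 : I 0 S)
    (hs : ∀ i < n, ∀ S, I i S → I (i + 1) (F (Function.update e x i) n S)) :
    I n (opFor x F e n S) := by
  have : ∀ m ≤ n, I m ((List.range m).foldl (fun S i => F (Function.update e x i) n S) S) := by
    intro m
    induction m with
    | zero => exact fun _ => h0
    | succ m ih =>
      intro hm
      rw [List.range_succ, List.foldl_append]
      exact hs m hm _ (ih (by omega))
  exact this n le_rfl

/-- For all rows `x`: change the state by `h`, treat all entries of the row by `B`, change the state
by `h'`. -/
def opPass (x y : Fin 3) (h : σ → σ) (B : Op σ Γ) (h' : σ → σ) : Op σ Γ :=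
  opFor x (opSeq (opLoad h) (opSeq (opFor y B) (opLoad h')))

/-- A pass in which `B` changes only the current entry. Entries satisfy `Pre` before they are
treated and `Post` afterwards; `J i j` holds for the state when the entry `(i, j)` is reached, and
`J' i` holds for it between the rows. -/
theorem opPass_spec {x y : Fin 3} (hxy : x ≠ y) {h h' : σ → σ} {B : Op σ Γ}
    {Pre Post : ℕ → ℕ → Γ → Prop} {J : ℕ → ℕ → σ → Prop} {J' : ℕ → σ → Prop} {e : Fin 3 → ℕ} {n : ℕ}
    {S : σ × (ℕ → ℕ → Γ)} (hpre : ∀ u < n, ∀ v < n, Pre u v (S.2 u v)) (hJ : J' 0 S.1)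
    (hrow : ∀ i < n, ∀ s, J' i s → J i 0 (h s)) (hend : ∀ i < n, ∀ s, J i n s → J' (i + 1) (h' s))
    (hB : ∀ i < n, ∀ j < n, ∀ s M e', e' x = i → e' y = j → (∀ z, z ≠ x → z ≠ y → e' z = e z) →
      J i j s → (∀ u < n, ∀ v < n, Pre u v (M u v) ∨ Post u v (M u v)) → Pre i j (M i j) →
      ∃ s' a, B e' n (s, M) = (s', setAt M i j a) ∧ Post i j a ∧ J i (j + 1) s') :
    J' n (opPass x y h B h' e n S).1 ∧
      ∀ u < n, ∀ v < n, Post u v ((opPass x y h B h' e n S).2 u v) := by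
  have key := opFor_ind x (F := opSeq (opLoad h) (opSeq (opFor y B) (opLoad h'))) (e := e) (n := n)
    (S := S) (fun i S => J' i S.1 ∧ ∀ u < n, ∀ v < n, (u < i → Post u v (S.2 u v)) ∧
      (i ≤ u → Pre u v (S.2 u v))) ⟨hJ, fun u hu v hv => ⟨by omega, fun _ => hpre u hu v hv⟩⟩ ?_
  · exact ⟨key.1, fun u hu v hv => (key.2 u hu v hv).1 hu⟩
  rintro i hi S ⟨h1, h2⟩
  have inner := opFor_ind y (F := B) (e := Function.update e x i) (n := n) (S := (h S.1, S.2))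
    (fun j S => J i j S.1 ∧ ∀ u < n, ∀ v < n, (u < i ∨ u = i ∧ v < j → Post u v (S.2 u v)) ∧
      (i < u ∨ u = i ∧ j ≤ v → Pre u v (S.2 u v))) ⟨hrow i hi _ h1, fun u hu v hv =>
        ⟨fun h => (h2 u hu v hv).1 (by omega), fun h => (h2 u hu v hv).2 (by omega)⟩⟩ ?_
  · refine ⟨hend i hi _ inner.1, fun u hu v hv => ⟨fun h => ?_, fun h => ?_⟩⟩
    · exact (inner.2 u hu v hv).1 (by omega)
    · exact (inner.2 u hu v hv).2 (by omega)
  rintro j hj ⟨s, M⟩ ⟨h3, h4⟩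
  obtain ⟨s', a, hB1, hB2, hB3⟩ := hB i hi j hj s M (Function.update (Function.update e x i) y j)
    (by simp [hxy]) (by simp) (fun z hz hz' => by simp [hz, hz']) h3
    (fun u hu v hv => by
      by_cases h : u < i ∨ u = i ∧ v < j
      · exact .inr ((h4 u hu v hv).1 h)
      · exact .inl ((h4 u hu v hv).2 (by omega)))
    ((h4 i hi j hj).2 (by omega))
  rw [hB1]
  refine ⟨hB3, fun u hu v hv => ?_⟩
  by_cases h : u = i ∧ v = j
  · obtain ⟨rfl, rfl⟩ := h
    simp only [setAt, and_self, if_true]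
    exact ⟨fun _ => hB2, fun h => by omega⟩
  · simp only [setAt, if_neg h]
    exact ⟨fun h' => (h4 u hu v hv).1 (by omega), fun h' => (h4 u hu v hv).2 (by omega)⟩

theorem implementable_pass {d : ℕ} {x y : Fin 3} (hx : x.val = d) (hy : y.val = d + 1) (h h' : σ → σ)
    {B : Op σ Γ} (hB : Implementable (d + 2) B) : Implementable d (opPass x y h B h') :=
  implementable_for x hx (implementable_seq (implementable_load _ _)
    (implementable_seq (implementable_for y hy hB) (implementable_load _ _)))

end ops

/-- The working data at a matrix entry `(u, v)`: adjacency, whether `u = v`, whether `u < v`, the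
rank of `v` at `u`, the degree of `u`, the current constraint between `u` and `v`, the output label;
on the diagonal also the value chosen for `u`, and whether it has been chosen. -/
structure Cell : Type where
  adj : Prop
  diag : Prop
  lt : Prop
  con : Prop
  done : Prop
  rank : Fin 5
  deg : Fin 5
  lab : Fin 5
  rel : Dom → Dom → Prop
  val : Dom

instance : Finite Cell :=
  Finite.of_injective (fun γ : Cell => ((γ.adj, γ.diag, γ.lt, γ.con, γ.done), (γ.rank, γ.deg, γ.lab),
    γ.rel, γ.val)) fun a b h => by
      cases a; cases b; simp only [Prod.mk.injEq] at h
      obtain ⟨⟨rfl, rfl, rfl, rfl, rfl⟩, ⟨rfl, rfl, rfl⟩, rfl, rfl⟩ := h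
      rfl

/-- An entry of which only the adjacency is known. -/
def Cell.blank (p : Prop) : Cell :=
  ⟨p, False, False, False, False, 0, 0, 0, fun _ _ => False, fun _ => 0⟩

/-- The finite memory: whether no labeling exists, a flag, a counter, copies of three entries, and a
set of values. -/
structure Mem : Type where
  fail : Prop
  flag : Prop
  cnt : Fin 5
  a : Cell
  b : Cell
  c : Cell
  cand : Dom → Prop

instance : Finite Mem :=
  Finite.of_injective (fun s : Mem => ((s.fail, s.flag, s.cnt), (s.a, s.b, s.c), s.cand))
    fun a b h => by
      cases a; cases b; simp only [Prod.mk.injEq] at h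
      obtain ⟨⟨rfl, rfl, rfl⟩, ⟨rfl, rfl, rfl⟩, rfl⟩ := h
      rfl

/-- Count up to `4`. -/
def inc (c : Fin 5) : Fin 5 := ⟨min (c.val + 1) 4, by omega⟩

open Classical in
/-- Increment the counter if `p` holds. -/
noncomputable def Mem.count (s : Mem) (p : Prop) : Mem := if p then { s with cnt := inc s.cnt } else s

abbrev MemOp : Type := Op Mem Cell

/-- Forget everything but the adjacency matrix. -/
def pReset : MemOp := opPass 0 1 id
  (opAcc 0 1 fun s γ => (s, Cell.blank γ.adj)) id

/-- Mark the diagonal. -/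
def pDiag : MemOp := opFor 0 (opAcc 0 0 fun s γ => (s, { γ with diag := True }))

/-- Compute the order relation and the ranks. -/
noncomputable def pRank : MemOp := opPass 0 1 (fun s => { s with flag := False, cnt := 0 })
  (opAcc 0 1 fun s γ => (({ s with flag := s.flag ∨ γ.diag } : Mem).count γ.adj,
    { γ with lt := s.flag, rank := s.cnt })) id

/-- Compute the degrees, and fail if one is at least four. -/
noncomputable def pDeg : MemOp := opPass 0 1 id
  (opSeq (opLoad fun s => { s with cnt := 0 })
    (opSeq (opFor 2 (opRead 0 2 fun s γ => s.count γ.adj))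
      (opAcc 0 1 fun s γ => ({ s with fail := s.fail ∨ s.cnt = 4 }, { γ with deg := s.cnt })))) id

/-- Set up the constraint network for labels at most `k`, and fail if a vertex has three neighbours
that are not leaves. -/
noncomputable def pCon (k : ℕ) : MemOp := opPass 0 1 (fun s => { s with cnt := 0 })
  (opSeq (opRead 1 0 fun s γ => { s with a := γ })
    (opAcc 0 1 fun s γ => (s.count (γ.adj ∧ 2 ≤ γ.deg.val ∧ 2 ≤ s.a.deg.val),
      { γ with
        con := γ.adj ∧ 2 ≤ γ.deg.val ∧ 2 ≤ s.a.deg.val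
        rel := fun x y => (γ.diag → AtVertex k γ.deg x ∧ AtVertex k γ.deg y) ∧
          (γ.adj ∧ 2 ≤ γ.deg.val ∧ 2 ≤ s.a.deg.val →
            AtEdge γ.rank s.a.rank γ.deg s.a.deg x y) })))
  fun s => { s with fail := s.fail ∨ 3 ≤ s.cnt.val }

/-- Eliminate the vertices in increasing order. -/
def pElim : MemOp := opFor 0 (opPass 1 2 id
  (opSeq (opRead 1 0 fun s γ => { s with a := γ })
    (opSeq (opRead 0 0 fun s γ => { s with b := γ })
      (opSeq (opRead 0 2 fun s γ => { s with c := γ })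
        (opSeq (opRead 0 1 fun s γ => { s with flag := γ.lt ∧ s.c.lt ∧ s.a.con ∧ s.c.con })
          (opAcc 1 2 fun s γ => (s,
            { γ with
              con := γ.con ∨ s.flag
              rel := fun x y => γ.rel x y ∧ (s.flag →
                ∃ z, s.b.rel z z ∧ s.a.rel x z ∧ s.c.rel z y) })))))) id)

/-- Fail if some vertex has no value left. -/
def pCheck : MemOp := opFor 0 (opRead 0 0 fun s γ => { s with fail := s.fail ∨ ¬ ∃ b, γ.rel b b })

/-- Restrict the set of candidates for the value of `v` by the entry `γ` of `(v, u)` and the value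
at `u`, if `v < u`; the flag is cleared if that value is not known. -/
def restrict (s : Mem) (γ : Cell) : Mem :=
  { s with
    flag := s.flag ∧ (γ.lt → s.b.done)
    cand := fun x => s.cand x ∧ (γ.lt ∧ γ.con → γ.rel x s.b.val) }

open Classical in
/-- Choose values, always for the last vertex that has none: for each vertex `v` without a value it
is tested whether all later vertices have one. Each round deals with one vertex. -/
noncomputable def pBack : MemOp := opFor 0 (opFor 1
  (opSeq (opRead 1 1 fun s γ => { s with flag := ¬ γ.done, cand := fun x => γ.rel x x })
    (opSeq (opFor 2 (opSeq (opRead 2 2 fun s γ => { s with b := γ }) (opRead 1 2 restrict)))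
      (opAcc 1 1 fun s γ => (s, if s.flag then
        { γ with done := True, val := Classical.epsilon s.cand } else γ)))))

/-- The label of a value at rank `i`. -/
def labFin (a : Dom) (i : ℕ) : Fin 5 := if h : i < 3 then a ⟨i, h⟩ else 0

/-- The label of the edge at the entry `γ`, from the values at its two ends. -/
def cellLabel (s : Mem) (γ : Cell) : Fin 5 :=
  if 2 ≤ γ.deg.val then labFin s.a.val γ.rank
  else if 2 ≤ s.c.deg.val then labFin s.b.val s.c.rank else 0

/-- Compute the labels. -/
def pLab : MemOp := opPass 0 1 id
  (opSeq (opRead 0 0 fun s γ => { s with a := γ })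
    (opSeq (opRead 1 1 fun s γ => { s with b := γ })
      (opSeq (opRead 1 0 fun s γ => { s with c := γ })
        (opAcc 0 1 fun s γ => (s, { γ with lab := cellLabel s γ }))))) id

/-- Search for a labeling with labels at most `k`. -/
noncomputable def pSearch (k : ℕ) : MemOp :=
  opSeq (opLoad fun s => { s with fail := False }) <| opSeq pReset <| opSeq pDiag <| opSeq pRank <|
    opSeq pDeg <| opSeq (pCon k) <| opSeq pElim <| opSeq pCheck <| opSeq pBack pLab

theorem implementable_search (k : ℕ) : Implementable 0 (pSearch k) := by
  have h01 : (0 : Fin 3).val < 1 := by decide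
  have h02 : (0 : Fin 3).val < 2 := by decide
  have h12 : (1 : Fin 3).val < 2 := by decide
  have h03 : (0 : Fin 3).val < 3 := by decide
  have h13 : (1 : Fin 3).val < 3 := by decide
  have h23 : (2 : Fin 3).val < 3 := by decide
  refine implementable_seq (implementable_load _ _) <| implementable_seq ?_ <|
    implementable_seq ?_ <| implementable_seq ?_ <| implementable_seq ?_ <|
    implementable_seq ?_ <| implementable_seq ?_ <| implementable_seq ?_ <|
    implementable_seq ?_ ?_
  · exact implementable_pass (d := 0) rfl rfl _ _ (implementable_acc _ _ h02 h12 _)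
  · exact implementable_for (d := 0) _ rfl (implementable_acc _ _ h01 h01 _)
  · exact implementable_pass (d := 0) rfl rfl _ _ (implementable_acc _ _ h02 h12 _)
  · exact implementable_pass (d := 0) rfl rfl _ _ (implementable_seq (implementable_load _ _)
      (implementable_seq (implementable_for (d := 2) _ rfl (implementable_read _ _ h03 h23 _))
        (implementable_acc _ _ h02 h12 _)))
  · exact implementable_pass (d := 0) rfl rfl _ _ (implementable_seq (implementable_read _ _ h12 h02 _)
      (implementable_acc _ _ h02 h12 _))
  · exact implementable_for (d := 0) _ rfl (implementable_pass (d := 1) (x := 1) (y := 2) rfl rfl _ _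
      (implementable_seq (implementable_read _ _ h13 h03 _)
        (implementable_seq (implementable_read _ _ h03 h03 _)
          (implementable_seq (implementable_read _ _ h03 h23 _)
            (implementable_seq (implementable_read _ _ h03 h13 _)
              (implementable_acc _ _ h13 h23 _))))))
  · exact implementable_for (d := 0) _ rfl (implementable_read _ _ h01 h01 _)
  · exact implementable_for (d := 0) _ rfl (implementable_for (d := 1) _ rfl
      (implementable_seq (implementable_read _ _ h12 h12 _)
        (implementable_seq (implementable_for (d := 2) _ rfl
          (implementable_seq (implementable_read _ _ h23 h23 _)
            (implementable_read _ _ h13 h23 _)))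
          (implementable_acc _ _ h12 h12 _))))
  · exact implementable_pass (d := 0) rfl rfl _ _ (implementable_seq (implementable_read _ _ h02 h02 _)
      (implementable_seq (implementable_read _ _ h12 h12 _)
        (implementable_seq (implementable_read _ _ h12 h02 _) (implementable_acc _ _ h02 h12 _))))

/-! ### Correctness of the search algorithm -/

section
open Classical

theorem rank4_succ (H : SimpleGraph ℕ) (u v : ℕ) :
    rank4 H u (v + 1) = if H.Adj u v then min (rank4 H u v + 1) 4 else rank4 H u v := by
  unfold rank4
  rw [rank_succ]
  split_ifs <;> omega

@[simp] theorem count_fail (s : Mem) (p : Prop) : (s.count p).fail = s.fail := by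
  unfold Mem.count; split_ifs <;> rfl

@[simp] theorem count_flag (s : Mem) (p : Prop) : (s.count p).flag = s.flag := by
  unfold Mem.count; split_ifs <;> rfl

theorem count_cnt (s : Mem) (p : Prop) :
    (s.count p).cnt.val = if p then min (s.cnt.val + 1) 4 else s.cnt.val := by
  unfold Mem.count; split_ifs <;> rfl

theorem val_labFin (a : Dom) (i : ℕ) : (labFin a i).val = lab a i := by
  unfold labFin lab
  split_ifs <;> rfl

/-- The fields of the entry `(u, v)` that describe the graph are correct. -/
structure Static (H : SimpleGraph ℕ) (n u v : ℕ) (γ : Cell) : Prop where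
  adj : γ.adj ↔ H.Adj u v
  diag : γ.diag ↔ u = v
  lt : γ.lt ↔ u < v
  rank : γ.rank.val = rank4 H u v
  deg : γ.deg.val = rank4 H u n

/-- The entry `(u, v)` holds the constraint of the network `N`. -/
def InNet (N : Net Dom) (u v : ℕ) (γ : Cell) : Prop :=
  (γ.con ↔ N.con u v) ∧ ∀ x y, γ.rel x y ↔ N.rel u v x y

variable {H : SimpleGraph ℕ} {n k : ℕ} {e : Fin 3 → ℕ} {S : Mem × (ℕ → ℕ → Cell)} {Q : Prop}

theorem pReset_spec (hM : ∀ u < n, ∀ v < n, (S.2 u v).adj ↔ H.Adj u v) (hf : ¬ S.1.fail) :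
    ¬ (pReset e n S).1.fail ∧ ∀ u < n, ∀ v < n, ((pReset e n S).2 u v).diag = False ∧
      (((pReset e n S).2 u v).adj ↔ H.Adj u v) ∧ ¬ ((pReset e n S).2 u v).done := by
  refine opPass_spec (x := 0) (y := 1) (by decide) (Pre := fun u v (γ : Cell) => γ.adj ↔ H.Adj u v)
    (Post := fun u v (γ : Cell) => γ.diag = False ∧ (γ.adj ↔ H.Adj u v) ∧ ¬ γ.done)
    (J := fun _ _ (s : Mem) => ¬ s.fail) (J' := fun _ (s : Mem) => ¬ s.fail) hM hf (fun _ _ _ h => h)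
    (fun _ _ _ h => h) ?_
  intro i hi j hj s M e' h0 h1 _ hs _ hp
  simp only [opAcc, h0, h1]
  exact ⟨_, _, rfl, ⟨rfl, hp, fun h => h⟩, hs⟩

theorem pDiag_spec (hM : ∀ u < n, ∀ v < n, (S.2 u v).diag = False ∧
      ((S.2 u v).adj ↔ H.Adj u v) ∧ ¬ (S.2 u v).done) (hf : ¬ S.1.fail) :
    ¬ (pDiag e n S).1.fail ∧ ∀ u < n, ∀ v < n, (((pDiag e n S).2 u v).diag ↔ u = v) ∧
      (((pDiag e n S).2 u v).adj ↔ H.Adj u v) ∧ ¬ ((pDiag e n S).2 u v).done := by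
  have := opFor_ind 0 (F := opAcc 0 0 fun (s : Mem) γ => (s, { γ with diag := True })) (e := e)
    (n := n) (S := S) (fun i S => ¬ S.1.fail ∧ ∀ u < n, ∀ v < n,
      ((S.2 u v).diag ↔ u = v ∧ u < i) ∧ ((S.2 u v).adj ↔ H.Adj u v) ∧ ¬ (S.2 u v).done)
    ⟨hf, fun u hu v hv => ⟨by rw [(hM u hu v hv).1]; simp, (hM u hu v hv).2⟩⟩ ?_
  · exact ⟨this.1, fun u hu v hv => ⟨(this.2 u hu v hv).1.trans (and_iff_left hu),
      (this.2 u hu v hv).2⟩⟩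
  rintro i hi ⟨s, M⟩ ⟨h1, h2⟩
  simp only [opAcc, Function.update_self]
  refine ⟨h1, fun u hu v hv => ?_⟩
  have := h2 u hu v hv
  unfold setAt
  split_ifs with h
  · obtain ⟨rfl, rfl⟩ := h
    exact ⟨by simp, this.2⟩
  · refine ⟨this.1.trans ?_, this.2⟩
    constructor <;> intro h' <;> omega

theorem pRank_spec (hM : ∀ u < n, ∀ v < n, ((S.2 u v).diag ↔ u = v) ∧
      ((S.2 u v).adj ↔ H.Adj u v) ∧ ¬ (S.2 u v).done) (hf : ¬ S.1.fail) :
    ¬ (pRank e n S).1.fail ∧ ∀ u < n, ∀ v < n, (((pRank e n S).2 u v).diag ↔ u = v) ∧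
      (((pRank e n S).2 u v).adj ↔ H.Adj u v) ∧ ¬ ((pRank e n S).2 u v).done ∧
      (((pRank e n S).2 u v).lt ↔ u < v) ∧ ((pRank e n S).2 u v).rank.val = rank4 H u v := by
  refine opPass_spec (x := 0) (y := 1) (by decide)
    (Pre := fun u v (γ : Cell) => (γ.diag ↔ u = v) ∧ (γ.adj ↔ H.Adj u v) ∧ ¬ γ.done)
    (Post := fun u v (γ : Cell) => (γ.diag ↔ u = v) ∧ (γ.adj ↔ H.Adj u v) ∧ ¬ γ.done ∧ (γ.lt ↔ u < v) ∧
      γ.rank.val = rank4 H u v)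
    (J := fun i j (s : Mem) => ¬ s.fail ∧ (s.flag ↔ i < j) ∧ s.cnt.val = rank4 H i j)
    (J' := fun _ (s : Mem) => ¬ s.fail) hM hf (fun i _ s h => ⟨h, by simp, by simp [rank4, rank]⟩)
    (fun _ _ _ h => h.1) ?_
  rintro i hi j hj s M e' h0 h1 _ ⟨hs1, hs2, hs3⟩ _ ⟨hp1, hp2, hp3⟩
  simp only [opAcc, h0, h1]
  refine ⟨_, _, rfl, ⟨hp1, hp2, hp3, hs2, hs3⟩, by simpa using hs1, ?_, ?_⟩
  · simp only [count_flag, hs2, hp1]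
    omega
  · rw [count_cnt, rank4_succ]
    simp only [hp2, hs3]

theorem pDeg_spec (hM : ∀ u < n, ∀ v < n, ((S.2 u v).diag ↔ u = v) ∧
      ((S.2 u v).adj ↔ H.Adj u v) ∧ ¬ (S.2 u v).done ∧ ((S.2 u v).lt ↔ u < v) ∧
      (S.2 u v).rank.val = rank4 H u v) (hf : ¬ S.1.fail) :
    ((pDeg e n S).1.fail ↔ ∃ u < n, 4 ≤ rank H u n) ∧ ∀ u < n, ∀ v < n,
      Static H n u v ((pDeg e n S).2 u v) ∧ ¬ ((pDeg e n S).2 u v).done := by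
  refine opPass_spec (x := 0) (y := 1) (by decide)
    (Pre := fun u v (γ : Cell) => (γ.diag ↔ u = v) ∧ (γ.adj ↔ H.Adj u v) ∧ ¬ γ.done ∧ (γ.lt ↔ u < v) ∧
      γ.rank.val = rank4 H u v)
    (Post := fun u v (γ : Cell) => Static H n u v γ ∧ ¬ γ.done)
    (J := fun i j (s : Mem) => s.fail ↔ ∃ u < n, (u < i ∨ u = i ∧ 0 < j) ∧ 4 ≤ rank H u n)
    (J' := fun i (s : Mem) => s.fail ↔ ∃ u < i, 4 ≤ rank H u n) hM (by simpa using hf) ?_ ?_ ?_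
  · intro i hi s h
    refine h.trans ⟨fun ⟨u, hu, h⟩ => ⟨u, by omega, .inl hu, h⟩, fun ⟨u, _, hu, h⟩ => ⟨u, by omega, h⟩⟩
  · intro i hi s h
    refine h.trans ⟨fun ⟨u, _, hu, h⟩ => ⟨u, by omega, h⟩, fun ⟨u, hu, h⟩ => ⟨u, by omega, by omega, h⟩⟩
  rintro i hi j hj s M e' h0 h1 _ hs hall ⟨hp1, hp2, hp3, hp4, hp5⟩
  have scan := opFor_ind 2 (F := opRead 0 2 fun (s : Mem) γ => s.count γ.adj) (e := e') (n := n)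
    (S := ({ s with cnt := 0 }, M))
    (fun m S => S.2 = M ∧ S.1.fail = s.fail ∧ S.1.cnt.val = rank4 H i m)
    ⟨rfl, rfl, by simp [rank4, rank]⟩ (by
      rintro m hm ⟨s', M'⟩ ⟨h1', h2, h3⟩
      subst h1'
      have hadj : (M' i m).adj ↔ H.Adj i m := by
        rcases hall i hi m hm with h | h
        · exact h.2.1
        · exact h.1.adj
      have e0 : Function.update e' 2 m 0 = i := by simpa using h0
      dsimp only at h2 h3
      simp only [opRead, e0, Function.update_self]
      refine ⟨trivial, by simpa using h2, ?_⟩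
      rw [count_cnt, rank4_succ]
      simp only [hadj, h3])
  obtain ⟨h2, h3, h4⟩ := scan
  simp only [opSeq, opLoad, opAcc, h0, h1, h2]
  refine ⟨_, _, rfl, ⟨⟨hp2, hp1, hp4, hp5, h4⟩, hp3⟩, ?_⟩
  change (_ ∨ _) ↔ _
  rw [h3, Fin.ext_iff, h4, hs]
  have h5 : rank4 H i n = (4 : Fin 5).val ↔ 4 ≤ rank H i n := by
    unfold rank4; change _ = 4 ↔ _; omega
  rw [h5]
  constructor
  · rintro (⟨u, hu, h, h'⟩ | h)
    · exact ⟨u, hu, by omega, h'⟩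
    · exact ⟨i, hi, by omega, h⟩
  · rintro ⟨u, hu, h, h'⟩
    by_cases hui : u = i
    · exact .inr (hui ▸ h')
    · exact .inl ⟨u, hu, by omega, h'⟩

theorem pCon_spec (hM : ∀ u < n, ∀ v < n, Static H n u v (S.2 u v) ∧ ¬ (S.2 u v).done)
    (hf : S.1.fail ↔ Q) :
    ((pCon k e n S).1.fail ↔ Q ∨ ∃ u < n, 3 ≤ coreRank H n u n) ∧ ∀ u < n, ∀ v < n,
      (Static H n u v ((pCon k e n S).2 u v) ∧ ¬ ((pCon k e n S).2 u v).done) ∧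
        InNet (graphNet H n k) u v ((pCon k e n S).2 u v) := by
  refine opPass_spec (x := 0) (y := 1) (by decide)
    (Pre := fun u v (γ : Cell) => Static H n u v γ ∧ ¬ γ.done)
    (Post := fun u v (γ : Cell) => (Static H n u v γ ∧ ¬ γ.done) ∧ InNet (graphNet H n k) u v γ)
    (J := fun i j (s : Mem) => (s.fail ↔ Q ∨ ∃ u < i, 3 ≤ coreRank H n u n) ∧
      s.cnt.val = min (coreRank H n i j) 4)
    (J' := fun i (s : Mem) => s.fail ↔ Q ∨ ∃ u < i, 3 ≤ coreRank H n u n) hM (by simpa using hf) ?_ ?_ ?_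
  · exact fun i hi s h => ⟨h, by simp [coreRank]⟩
  · rintro i hi s ⟨h1, h2⟩
    change (_ ∨ _) ↔ _
    rw [h1, h2]
    constructor
    · rintro ((h | ⟨u, hu, h⟩) | h)
      · exact .inl h
      · exact .inr ⟨u, by omega, h⟩
      · exact .inr ⟨i, by omega, by omega⟩
    · rintro (h | ⟨u, hu, h⟩)
      · exact .inl (.inl h)
      · by_cases hui : u = i
        · subst hui; exact .inr (by omega)
        · exact .inl (.inr ⟨u, by omega, h⟩)
  rintro i hi j hj s M e' h0 h1 _ ⟨hs1, hs2⟩ hall hp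
  have hji : Static H n j i (M j i) := by
    rcases hall j hj i hi with h | h
    · exact h.1
    · exact h.1.1
  have hcore : (M i j).adj ∧ 2 ≤ (M i j).deg.val ∧ 2 ≤ (M j i).deg.val ↔ Core H n i j := by
    rw [hp.1.adj, hp.1.deg, hji.deg]; rfl
  simp only [opSeq, opRead, opAcc, h0, h1]
  refine ⟨_, _, rfl, ⟨⟨⟨hp.1.adj, hp.1.diag, hp.1.lt, hp.1.rank, hp.1.deg⟩, hp.2⟩, hcore,
    fun x y => ?_⟩, ?_, ?_⟩
  · simp only [graphNet, hp.1.adj, hp.1.diag, hp.1.rank, hp.1.deg, hji.rank, hji.deg]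
    exact Iff.rfl
  · simpa using hs1
  · rw [count_cnt, coreRank_succ]
    simp only [hcore, hs2]
    split_ifs <;> omega

theorem pElim_spec {N : Net Dom} (hM : ∀ u < n, ∀ v < n,
      (Static H n u v (S.2 u v) ∧ ¬ (S.2 u v).done) ∧ InNet N u v (S.2 u v)) (hf : S.1.fail ↔ Q) :
    ((pElim e n S).1.fail ↔ Q) ∧ ∀ u < n, ∀ v < n,
      (Static H n u v ((pElim e n S).2 u v) ∧ ¬ ((pElim e n S).2 u v).done) ∧
        InNet (N.elims n) u v ((pElim e n S).2 u v) := by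
  refine opFor_ind 0 (fun m S => (S.1.fail ↔ Q) ∧ ∀ u < n, ∀ v < n,
      (Static H n u v (S.2 u v) ∧ ¬ (S.2 u v).done) ∧ InNet (N.elims m) u v (S.2 u v)) ⟨hf, hM⟩ ?_
  rintro m hm S ⟨h1, h2⟩
  refine opPass_spec (x := 1) (y := 2) (by decide)
    (Pre := fun u v (γ : Cell) => (Static H n u v γ ∧ ¬ γ.done) ∧ InNet (N.elims m) u v γ)
    (Post := fun u v (γ : Cell) => (Static H n u v γ ∧ ¬ γ.done) ∧ InNet (N.elims (m + 1)) u v γ)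
    (J := fun _ _ (s : Mem) => s.fail ↔ Q) (J' := fun _ (s : Mem) => s.fail ↔ Q) h2 h1 (fun _ _ _ h => h)
    (fun _ _ _ h => h) ?_
  rintro i hi j hj s M e' h0 h1 h2 hs hall ⟨hp, hp1, hp2⟩
  have e0 : e' 0 = m := by rw [h2 0 (by decide) (by decide)]; simp
  have hst : ∀ u < n, ∀ v < n, Static H n u v (M u v) := fun u hu v hv => by
    rcases hall u hu v hv with h | h <;> exact h.1.1
  -- entries in row or column `m` have not been changed in this round
  have hnet : ∀ u < n, ∀ v < n, u ≤ m ∨ v ≤ m → InNet (N.elims m) u v (M u v) := by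
    intro u hu v hv huv
    rcases hall u hu v hv with h | h
    · exact h.2
    · have := N.elims_eq (Nat.le_succ m) huv
      have h := h.2
      unfold InNet at h ⊢
      rwa [← this.1, ← this.2]
  obtain ⟨ha1, ha2⟩ := hnet i hi m hm (.inr le_rfl)
  obtain ⟨hb1, hb2⟩ := hnet m hm m hm (.inr le_rfl)
  obtain ⟨hc1, hc2⟩ := hnet m hm j hj (.inl le_rfl)
  simp only [opSeq, opRead, opAcc, h0, h1, e0]
  refine ⟨_, _, rfl, ⟨⟨⟨hp.1.adj, hp.1.diag, hp.1.lt, hp.1.rank, hp.1.deg⟩, hp.2⟩, ?_,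
    fun x y => ?_⟩, hs⟩
  · simp only [Net.elims, Net.elim, hp1, ha1, hc1, (hst m hm i hi).lt, (hst m hm j hj).lt]
  · simp only [Net.elims, Net.elim, hp2, ha1, hc1, (hst m hm i hi).lt, (hst m hm j hj).lt, ha2, hb2,
      hc2]

theorem pCheck_spec : (pCheck e n S).2 = S.2 ∧
    ((pCheck e n S).1.fail ↔ S.1.fail ∨ ∃ v < n, ¬ ∃ b, (S.2 v v).rel b b) := by
  refine opFor_ind 0 (fun m S' => S'.2 = S.2 ∧
    (S'.1.fail ↔ S.1.fail ∨ ∃ v < m, ¬ ∃ b, (S.2 v v).rel b b)) ⟨rfl, by simp⟩ ?_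
  rintro m hm ⟨s, M⟩ ⟨h1, h2⟩
  dsimp only at h1 h2
  subst h1
  simp only [opRead, Function.update_self, true_and]
  rw [h2, or_assoc]
  refine or_congr_right ⟨?_, ?_⟩
  · rintro (⟨v, hv, h⟩ | h)
    · exact ⟨v, by omega, h⟩
    · exact ⟨m, by omega, h⟩
  · rintro ⟨v, hv, h⟩
    by_cases hvm : v = m
    · exact .inr (hvm ▸ h)
    · exact .inl ⟨v, by omega, h⟩

/-- The scan in which the candidates for the value of `v` are restricted. -/
theorem restrict_spec {N : Net Dom} {M : ℕ → ℕ → Cell} {s : Mem} {v : ℕ} (hv : v < n)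
    (he : e 1 = v)
    (hst : ∀ u < n, ∀ v < n, Static H n u v (M u v) ∧ InNet N u v (M u v)) :
    let S' := opFor 2 (opSeq (opRead 2 2 fun (s : Mem) (γ : Cell) => { s with b := γ })
      (opRead 1 2 restrict)) e n (s, M)
    S'.2 = M ∧ S'.1.fail = s.fail ∧
      (S'.1.flag ↔ s.flag ∧ ∀ u < n, v < u → (M u u).done) ∧
      ∀ x, S'.1.cand x ↔ s.cand x ∧ ∀ u < n, v < u → N.con v u → N.rel v u x (M u u).val := by
  refine opFor_ind 2 (fun m (S' : Mem × (ℕ → ℕ → Cell)) => S'.2 = M ∧ S'.1.fail = s.fail ∧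
      (S'.1.flag ↔ s.flag ∧ ∀ u < m, v < u → (M u u).done) ∧
      ∀ x, S'.1.cand x ↔ s.cand x ∧ ∀ u < m, v < u → N.con v u → N.rel v u x (M u u).val)
    ⟨rfl, rfl, by simp, by simp⟩ ?_
  rintro m hm ⟨s', M'⟩ ⟨h1, h2, h3, h4⟩
  dsimp only at h1 h2 h3 h4
  subst h1
  obtain ⟨g1, g2, g3⟩ := hst v hv m hm
  have e1 : Function.update e 2 m 1 = v := by simpa using he
  simp only [opSeq, opRead, Function.update_self, e1, restrict]
  refine ⟨trivial, h2, ?_, fun x => ?_⟩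
  · rw [h3, g1.lt, and_assoc]
    refine and_congr_right fun _ => ⟨fun ⟨h, h'⟩ u hu => ?_, fun h =>
      ⟨fun u hu => h u (by omega), h m (by omega)⟩⟩
    by_cases hum : u = m
    · exact hum ▸ h'
    · exact h u (by omega)
  · rw [h4, g1.lt, g2, g3, and_assoc]
    refine and_congr_right fun _ => ⟨fun ⟨h, h'⟩ u hu h1 h2 => ?_, fun h =>
      ⟨fun u hu => h u (by omega), fun h' => h m (by omega) h'.1 h'.2⟩⟩
    by_cases hum : u = m
    · subst hum; exact h' ⟨h1, h2⟩
    · exact h u (by omega) h1 h2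

/-- The values stored on the diagonal. -/
def values (M : ℕ → ℕ → Cell) (u : ℕ) : Dom := (M u u).val

/-- Values have been chosen exactly for the variables from `m` on, and they satisfy the
constraints. -/
def Chosen (N : Net Dom) (n m : ℕ) (M : ℕ → ℕ → Cell) : Prop :=
  (∀ v < n, (M v v).done ↔ m ≤ v) ∧ (N.elims m).Sol m n (values M)

theorem pBack_spec {N : Net Dom} (hN : N.Proper) (hd : N.DegTwo 0 n) (hM : ∀ u < n, ∀ v < n,
      (Static H n u v (S.2 u v) ∧ ¬ (S.2 u v).done) ∧ InNet (N.elims n) u v (S.2 u v))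
    (hne : ∀ v < n, ∃ b, (N.elims n).rel v v b b) :
    N.Sol 0 n (values (pBack e n S).2) := by
  suffices h : (∀ u < n, ∀ v < n, Static H n u v ((pBack e n S).2 u v) ∧
      InNet (N.elims n) u v ((pBack e n S).2 u v)) ∧
      ∃ m, m + n ≤ n ∧ Chosen N n m (pBack e n S).2 by
    obtain ⟨-, m, hm, h⟩ := h
    obtain rfl : m = 0 := by omega
    exact h.2
  refine opFor_ind 0 (fun t S => (∀ u < n, ∀ v < n, Static H n u v (S.2 u v) ∧
    InNet (N.elims n) u v (S.2 u v)) ∧ ∃ m, m + t ≤ n ∧ Chosen N n m S.2)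
    ⟨fun u hu v hv => ⟨(hM u hu v hv).1.1, (hM u hu v hv).2⟩, n, by omega,
      fun v hv => iff_of_false (hM v hv v hv).1.2 (by omega), fun u w _ _ _ _ => by omega⟩ ?_
  rintro t ht S ⟨h1, m, hm, h2⟩
  -- within a round: either the round has dealt with a variable, or its turn is still to come
  have inner := opFor_ind 1 (F := opSeq (opRead 1 1 fun (s : Mem) (γ : Cell) =>
      { s with flag := ¬ γ.done, cand := fun x => γ.rel x x })
    (opSeq (opFor 2 (opSeq (opRead 2 2 fun (s : Mem) (γ : Cell) => { s with b := γ })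
      (opRead 1 2 restrict)))
      (opAcc 1 1 fun (s : Mem) (γ : Cell) => (s, if s.flag then
        { γ with done := True, val := Classical.epsilon s.cand } else γ))))
    (e := Function.update e 0 t) (n := n) (S := S)
    (fun v S => (∀ u < n, ∀ v < n, Static H n u v (S.2 u v) ∧
      InNet (N.elims n) u v (S.2 u v)) ∧ ∃ m, m + t ≤ n ∧
        (m + (t + 1) ≤ n ∨ v < m) ∧ Chosen N n m S.2)
    ⟨h1, m, hm, by omega, h2⟩ ?_
  · obtain ⟨h3, m, h4', h4, h5⟩ := inner
    exact ⟨h3, m, by omega, h5⟩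
  rintro v hv ⟨s, M⟩ ⟨h3, m, hm, hvm, hdone, hsol⟩
  simp only [opSeq]
  have hread := restrict_spec (e := Function.update (Function.update e 0 t) 1 v)
    (s := { s with flag := ¬ (M v v).done, cand := fun x => (M v v).rel x x }) hv (by simp) h3
  simp only [opRead, Function.update_self]
  generalize opFor 2 (opSeq (opRead 2 2 fun (s : Mem) (γ : Cell) => { s with b := γ })
    (opRead 1 2 restrict))
    (Function.update (Function.update e 0 t) 1 v) n
    ({ s with flag := ¬ (M v v).done, cand := fun x => (M v v).rel x x }, M) = S' at hread
  obtain ⟨s', M'⟩ := S'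
  obtain ⟨g1, g2, g3, g4⟩ := hread
  dsimp only at g1 g2 g3 g4
  subst g1
  have hflag : s'.flag ↔ v + 1 = m := by
    rw [g3, hdone v hv]
    constructor
    · rintro ⟨h, h'⟩
      by_contra hne
      have := (hdone (v + 1) (by omega)).mp (h' (v + 1) (by omega) (by omega))
      omega
    · rintro rfl
      exact ⟨by omega, fun u hu hvu => (hdone u hu).mpr hvu⟩
  simp only [opAcc, Function.update_self]
  by_cases hf : s'.flag
  · obtain rfl := hflag.mp hf
    have hcand : ∀ x, s'.cand x ↔ N.Fits n v (values M') x := by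
      intro x
      rw [g4, (h3 v hv v hv).2.2]
      exact and_congr_right fun _ => ⟨fun h u h1 h2 => h u h2 h1, fun h u h1 h2 => h u h2 h1⟩
    have hex : ∃ x, s'.cand x := by
      obtain ⟨b, hb⟩ := Net.exists_fits hN hd hv hsol (hne v hv)
      exact ⟨b, (hcand b).mpr hb⟩
    have hfit := (hcand _).mp (Classical.epsilon_spec hex)
    have hext := Net.Sol.extend_elims hN hv hsol hfit
    simp only [if_pos hf]
    refine ⟨fun u hu w hw => ?_, v, by omega, by omega, fun u hu => ?_, ?_⟩
    · have := h3 u hu w hw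
      unfold setAt
      split_ifs with h
      · obtain ⟨rfl, rfl⟩ := h
        exact ⟨⟨this.1.adj, this.1.diag, this.1.lt, this.1.rank, this.1.deg⟩, this.2⟩
      · exact this
    · unfold setAt
      split_ifs with h
      · simp [h.1]
      · rw [hdone u hu]
        omega
    · convert hext using 1
      funext u
      unfold values setAt
      by_cases h : u = v
      · subst h; simp
      · simp [h]
  · simp only [if_neg hf]
    have : setAt M' v v (M' v v) = M' := by
      funext a b
      unfold setAt
      split_ifs with h
      · rw [h.1, h.2]
      · rfl
    rw [this]
    exact ⟨h3, m, hm, by rw [hflag] at hf; omega, hdone, hsol⟩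

/-- The choice of values does not change the rest of the data, whether it succeeds or not. -/
theorem pBack_static (hM : ∀ u < n, ∀ v < n, Static H n u v (S.2 u v)) :
    (pBack e n S).1.fail = S.1.fail ∧ ∀ u < n, ∀ v < n, Static H n u v ((pBack e n S).2 u v) := by
  refine opFor_ind 0 (fun _ (S' : Mem × (ℕ → ℕ → Cell)) => S'.1.fail = S.1.fail ∧
    ∀ u < n, ∀ v < n, Static H n u v (S'.2 u v)) ⟨rfl, hM⟩ ?_
  intro t _ S' hS'
  refine opFor_ind 1 (fun _ (S' : Mem × (ℕ → ℕ → Cell)) => S'.1.fail = S.1.fail ∧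
    ∀ u < n, ∀ v < n, Static H n u v (S'.2 u v)) hS' ?_
  rintro v _ ⟨s, M⟩ ⟨h1, h2⟩
  dsimp only at h1 h2
  simp only [opSeq]
  have scan := opFor_ind 2 (F := opSeq (opRead 2 2 fun (s : Mem) (γ : Cell) => { s with b := γ })
    (opRead 1 2 restrict)) (e := Function.update (Function.update e 0 t) 1 v) (n := n)
    (S := opRead 1 1 (fun (s : Mem) (γ : Cell) =>
        { s with flag := ¬ γ.done, cand := fun x => γ.rel x x })
      (Function.update (Function.update e 0 t) 1 v) n (s, M))
    (fun _ (S' : Mem × (ℕ → ℕ → Cell)) => S'.1.fail = S.1.fail ∧ S'.2 = M) ⟨h1, rfl⟩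
    (fun _ _ _ h => h)
  obtain ⟨g1, g2⟩ := scan
  simp only [opAcc, g2, Function.update_self]
  refine ⟨g1, fun a ha b hb => ?_⟩
  have := h2 a ha b hb
  unfold setAt
  split_ifs with h h'
  · obtain ⟨rfl, rfl⟩ := h
    exact ⟨this.adj, this.diag, this.lt, this.rank, this.deg⟩
  · obtain ⟨rfl, rfl⟩ := h
    exact this
  · exact this

theorem pLab_spec (hM : ∀ u < n, ∀ v < n, Static H n u v (S.2 u v)) (hf : S.1.fail ↔ Q) :
    ((pLab e n S).1.fail ↔ Q) ∧ ∀ u < n, ∀ v < n, (((pLab e n S).2 u v).adj ↔ H.Adj u v) ∧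
      ((pLab e n S).2 u v).lab.val = readLabel H n (values S.2) u v := by
  have := opPass_spec (x := 0) (y := 1) (by decide) (h := id) (h' := id)
    (B := opSeq (opRead 0 0 fun (s : Mem) (γ : Cell) => { s with a := γ })
    (opSeq (opRead 1 1 fun s γ => { s with b := γ })
      (opSeq (opRead 1 0 fun s γ => { s with c := γ })
        (opAcc 0 1 fun s γ => (s, { γ with lab := cellLabel s γ })))))
    (Pre := fun u v (γ : Cell) => Static H n u v γ ∧ (u = v → γ.val = values S.2 u))
    (Post := fun u v (γ : Cell) => (Static H n u v γ ∧ (u = v → γ.val = values S.2 u)) ∧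
      γ.lab.val = readLabel H n (values S.2) u v)
    (J := fun _ _ (s : Mem) => s.fail ↔ Q) (J' := fun _ (s : Mem) => s.fail ↔ Q)
    (e := e) (n := n) (S := S)
    (fun u hu v hv => ⟨hM u hu v hv, fun h => by subst h; rfl⟩) hf (fun _ _ _ h => h)
    (fun _ _ _ h => h) ?_
  · exact ⟨this.1, fun u hu v hv => ⟨(this.2 u hu v hv).1.1.adj, (this.2 u hu v hv).2⟩⟩
  rintro i hi j hj s M e' h0 h1 _ hs hall ⟨hp1, hp2⟩
  have hst : ∀ u < n, ∀ v < n, Static H n u v (M u v) ∧ (u = v → (M u v).val = values S.2 u) :=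
    fun u hu v hv => by
      rcases hall u hu v hv with h | h
      · exact h
      · exact h.1
  simp only [opSeq, opRead, opAcc, h0, h1]
  refine ⟨_, _, rfl, ⟨⟨⟨hp1.adj, hp1.diag, hp1.lt, hp1.rank, hp1.deg⟩, hp2⟩, ?_⟩, hs⟩
  have hji := (hst j hj i hi).1
  simp only [cellLabel, readLabel, hp1.deg, hji.deg, hp1.rank, hji.rank,
    (hst i hi i hi).2 rfl, (hst j hj j hj).2 rfl]
  split_ifs
  · exact val_labFin _ _
  · exact val_labFin _ _
  · rfl

/-- The search decides whether a labeling with labels at most `k` exists, and finds one. -/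
theorem pSearch_spec (hk : k ≤ 4) (hn : ∀ u v, H.Adj u v → v < n)
    (hM : ∀ u < n, ∀ v < n, (S.2 u v).adj ↔ H.Adj u v) :
    ((pSearch k e n S).1.fail ↔ ¬ ∃ g, IsLab H k g) ∧
    (∀ u < n, ∀ v < n, ((pSearch k e n S).2 u v).adj ↔ H.Adj u v) ∧
    (¬ (pSearch k e n S).1.fail →
      IsLab H k fun u v => if H.Adj u v then ((pSearch k e n S).2 u v).lab.val else 0) := by
  unfold pSearch
  simp only [opSeq]
  have r0 := pReset_spec (e := e) (S := opLoad (fun s : Mem => { s with fail := False }) e n S) hM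
    (fun h => h)
  generalize pReset e n (opLoad (fun s : Mem => { s with fail := False }) e n S) = S0 at r0 ⊢
  have r1 := pDiag_spec (e := e) r0.2 r0.1
  generalize pDiag e n S0 = S1 at r1 ⊢
  have r2 := pRank_spec (e := e) r1.2 r1.1
  generalize pRank e n S1 = S2 at r2 ⊢
  have r3 := pDeg_spec (e := e) r2.2 r2.1
  generalize pDeg e n S2 = S3 at r3 ⊢
  have r4 := pCon_spec (k := k) (e := e) r3.2 r3.1
  generalize pCon k e n S3 = S4 at r4 ⊢
  have r5 := pElim_spec (e := e) r4.2 r4.1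
  generalize pElim e n S4 = S5 at r5 ⊢
  have r6 := pCheck_spec (e := e) (n := n) (S := S5)
  generalize pCheck e n S5 = S6 at r6 ⊢
  rw [← r6.1] at r5
  have r7 := pBack_static (e := e) (S := S6) (fun u hu v hv => (r5.2 u hu v hv).1.1)
  have r7' := pBack_spec (e := e) (n := n) (S := S6) (proper_graphNet (H := H) n k) (H := H)
  generalize pBack e n S6 = S7 at r7 r7' ⊢
  have r8 := pLab_spec (e := e) r7.2 Iff.rfl
  generalize pLab e n S7 = S8 at r8 ⊢
  have hfail : S8.1.fail ↔ ((∃ u < n, 4 ≤ rank H u n) ∨ ∃ u < n, 3 ≤ coreRank H n u n) ∨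
      ∃ v < n, ¬ ∃ b, ((graphNet H n k).elims n).rel v v b b := by
    rw [r8.1, r7.1, r6.2, r5.1]
    refine or_congr_right (exists_congr fun v => and_congr_right fun hv => not_congr
      (exists_congr fun b => ?_))
    rw [← r6.1]
    exact (r5.2 v hv v hv).2.2 b b
  have hlab : ¬ S8.1.fail →
      IsLab H k fun u v => if H.Adj u v then (S8.2 u v).lab.val else 0 := by
    intro h
    rw [hfail] at h
    push Not at h
    obtain ⟨⟨h1, h2⟩, h3⟩ := h
    have hsol := r7' (degTwo_graphNet fun u hu => by have := h2 u hu; omega) r5.2 h3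
    have := isLab_readLabel hn (fun u hu => by have := h1 u hu; omega) hsol
    convert this using 3 with u v
    split_ifs with huv
    · exact (r8.2 u (hn _ _ huv.symm) v (hn _ _ huv)).2
    · rfl
  refine ⟨⟨fun h => ?_, fun h => ?_⟩, fun u hu v hv => (r8.2 u hu v hv).1, hlab⟩
  · rintro ⟨g, hg⟩
    rw [hfail] at h
    rcases h with (⟨u, hu, h⟩ | ⟨u, hu, h⟩) | ⟨v, hv, h⟩
    · have := rank_le_three (n := n) (hg.mono hk) u
      omega
    · have := coreRank_le_two (n := n) (hg.mono hk) u
      omega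
    · obtain ⟨X, hX⟩ := exists_sol hk hn hg
      exact h (Net.exists_of_sol hX hv)
  · by_contra hf
    exact h ⟨_, hlab hf⟩

end

/-! ### The problems that are solved in polynomial time -/

section
open Classical

/-- A graph on `{0, …, n - 1}` as a graph on `ℕ`. -/
def natGraph {n : ℕ} (G : SimpleGraph (Fin n)) : SimpleGraph ℕ where
  Adj i j := ∃ (hi : i < n) (hj : j < n), G.Adj ⟨i, hi⟩ ⟨j, hj⟩
  symm := ⟨fun _ _ ⟨hi, hj, h⟩ => ⟨hj, hi, h.symm⟩⟩
  loopless := ⟨fun _ ⟨_, _, h⟩ => h.ne rfl⟩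

theorem natGraph_adj_val {n : ℕ} {G : SimpleGraph (Fin n)} {u v : Fin n} :
    (natGraph G).Adj u.val v.val ↔ G.Adj u v := ⟨fun ⟨_, _, h⟩ => h, fun h => ⟨u.2, v.2, h⟩⟩

theorem IsLab.of_natGraph {n k : ℕ} {G : SimpleGraph (Fin n)} {g : ℕ → ℕ → ℕ}
    (hg : IsLab (natGraph G) k g) : IsLab G k fun u v => g u v :=
  hg.comap ⟨Fin.val, fun h => natGraph_adj_val.mpr h⟩ Fin.val_injective

theorem lambdaEdge_le_iff_natGraph {n k : ℕ} {G : SimpleGraph (Fin n)} :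
    lambdaEdge G ≤ k ↔ ∃ g, IsLab (natGraph G) k g := by
  rw [lambdaEdge_le_iff]
  refine ⟨fun ⟨g, hg⟩ => ?_, fun ⟨g, hg⟩ => ⟨_, hg.of_natGraph⟩⟩
  let g' : ℕ → ℕ → ℕ := fun i j => if h : i < n ∧ j < n then g ⟨i, h.1⟩ ⟨j, h.2⟩ else 0
  have hg' : ∀ {i j} (hi : i < n) (hj : j < n), g' i j = g ⟨i, hi⟩ ⟨j, hj⟩ :=
    fun hi hj => dif_pos ⟨hi, hj⟩
  refine ⟨g', fun i j => ?_, ?_, ?_, ?_⟩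
  · by_cases h : i < n ∧ j < n
    · rw [hg' h.1 h.2, hg' h.2 h.1, hg.symm]
    · simp only [g']
      rw [dif_neg h, dif_neg fun h' => h h'.symm]
  · rintro i j ⟨hi, hj, h⟩
    rw [hg' hi hj]
    exact hg.le h
  · rintro v u w ⟨hv, hu, h⟩ ⟨_, hw, h'⟩ hne
    rw [hg' hv hu, hg' hv hw]
    exact hg.sep h h' fun e => hne (congrArg Fin.val e)
  · rintro u v x y ⟨hu, hv, h⟩ ⟨_, hx, h1⟩ ⟨_, hy, h2⟩ hne hne'
    rw [hg' hu hx, hg' hv hy]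
    exact hg.far h h1 h2 (fun e => hne (congrArg Fin.val e)) fun e => hne' (congrArg Fin.val e)

/-- The matrix `M` contains the adjacencies of `G`. -/
def Stores {n : ℕ} (G : SimpleGraph (Fin n)) (M : ℕ → ℕ → Cell) : Prop :=
  ∀ u < n, ∀ v < n, (M u v).adj ↔ (natGraph G).Adj u v

/-- The labels stored in the matrix `M`. -/
noncomputable def stored {n : ℕ} (G : SimpleGraph (Fin n)) (M : ℕ → ℕ → Cell) (u v : ℕ) : ℕ :=
  if (natGraph G).Adj u v then (M u v).lab.val else 0

variable {n k : ℕ} {G : SimpleGraph (Fin n)} {e : Fin 3 → ℕ} {S : Mem × (ℕ → ℕ → Cell)}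

theorem pSearch_fail (hk : k ≤ 4) (hS : Stores G S.2) :
    ((pSearch k e n S).1.fail ↔ ¬ lambdaEdge G ≤ k) ∧ Stores G (pSearch k e n S).2 ∧
      (¬ (pSearch k e n S).1.fail → IsLab (natGraph G) k (stored G (pSearch k e n S).2)) := by
  have := pSearch_spec (e := e) hk (fun u v (h : (natGraph G).Adj u v) => h.2.1) hS
  rw [← lambdaEdge_le_iff_natGraph] at this
  exact this

/-- The initial memory. -/
def Mem.blank : Mem := ⟨False, False, 0, Cell.blank False, Cell.blank False, Cell.blank False,
  fun _ => False⟩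

theorem stores_startMatrix (G : FinGraph) :
    Stores G.2 (startMatrix (fun b => Cell.blank (b = true)) G) := by
  intro u hu v hv
  simp only [startMatrix, Cell.blank, decide_eq_true_eq]
  rfl

theorem polyTimeDecidable_of_implementable {F : MemOp} (hF : Implementable 0 F)
    (P : FinGraph → Prop)
    (h : ∀ (G : FinGraph) S, Stores G.2 S.2 → ((F (fun _ => G.1) G.1 S).1.fail ↔ ¬ P G)) :
    PolyTimeDecidable P := by
  refine ⟨fun G => decide (P G), fun G => by simp, polyTime_of_implementable hF Mem.blank
    (fun b => Cell.blank (b = true)) (fun s => decide (¬ s.fail)) (fun _ => false) (fun _ => false)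
    Computability.encodeBool _ ?_⟩
  rintro G S rfl
  have h1 := h G (Mem.blank, startMatrix (fun b => Cell.blank (b = true)) G) (stores_startMatrix G)
  simp only [h1, not_not]
  rfl

theorem polyTimeDecidable_le (hk : k ≤ 4) : PolyTimeDecidable fun G => lambdaEdge G.2 ≤ k :=
  polyTimeDecidable_of_implementable (implementable_search k) _ fun _ _ hS => (pSearch_fail hk hS).1

theorem polyTimeDecidable_eq (hk : k ≤ 4) : PolyTimeDecidable fun G => lambdaEdge G.2 = k := by
  rcases k with _ | k
  · simpa using polyTimeDecidable_le (k := 0) (by omega)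
  refine polyTimeDecidable_of_implementable (F := opSeq (pSearch k)
    (opIte (fun s => decide s.fail) (pSearch (k + 1)) (opLoad fun s => { s with fail := True })))
    (implementable_seq (implementable_search k)
      (implementable_ite _ (implementable_search _) (implementable_load _ _))) _ fun G S hS => ?_
  obtain ⟨h1, h2, -⟩ := pSearch_fail (k := k) (e := fun _ => G.1) (by omega) hS
  simp only [opSeq, opIte, decide_eq_true_eq]
  split_ifs with h
  · rw [(pSearch_fail hk h2).1]
    rw [h1] at h
    omega
  · rw [h1] at h
    simp only [opLoad, true_iff]
    omega

/-- Search for a labeling with labels at most `0`, then for one with labels at most `1`, and so on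
up to `k`, until a labeling is found. -/
noncomputable def pOptimal : ℕ → MemOp
  | 0 => pSearch 0
  | k + 1 => opSeq (pOptimal k) (opIte (fun s => decide s.fail) (pSearch (k + 1)) (opLoad id))

theorem implementable_optimal (k : ℕ) : Implementable 0 (pOptimal k) := by
  induction k with
  | zero => exact implementable_search 0
  | succ k ih =>
    exact implementable_seq ih
      (implementable_ite _ (implementable_search _) (implementable_load _ _))

theorem pOptimal_spec (hk : k ≤ 4) (hS : Stores G S.2) :
    ((pOptimal k e n S).1.fail ↔ ¬ lambdaEdge G ≤ k) ∧ Stores G (pOptimal k e n S).2 ∧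
      (¬ (pOptimal k e n S).1.fail →
        IsLab (natGraph G) (lambdaEdge G) (stored G (pOptimal k e n S).2)) := by
  induction k with
  | zero =>
    obtain ⟨h1, h2, h3⟩ := pSearch_fail (e := e) hk hS
    change (_ ↔ _) ∧ _ ∧ (¬ (pSearch 0 e n S).1.fail → IsLab _ _ (stored G (pSearch 0 e n S).2))
    refine ⟨h1, h2, fun h => ?_⟩
    have h4 := h3 h
    have h0 : lambdaEdge G = 0 := by
      rw [h1] at h
      omega
    rwa [h0]
  | succ k ih =>
    obtain ⟨h1, h2, h3⟩ := ih (by omega)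
    simp only [pOptimal, opSeq, opIte, decide_eq_true_eq]
    split_ifs with h
    · obtain ⟨g1, g2, g3⟩ := pSearch_fail (e := e) hk h2
      refine ⟨g1, g2, fun h' => ?_⟩
      have h4 := g3 h'
      have h0 : lambdaEdge G = k + 1 := by
        rw [g1] at h'
        rw [h1] at h
        omega
      rwa [h0]
    · refine ⟨iff_of_false h ?_, h2, fun _ => h3 h⟩
      rw [h1] at h
      omega

/-- The output for an entry of the matrix. -/
noncomputable def outSymbol (lam : ℕ) : Option Cell → OutSymbol lam
  | none => .endRow
  | some γ => if γ.adj then .label ⟨min γ.lab.val lam, by omega⟩ else .nonEdge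

theorem polyTimeSearch {lam : ℕ} (hlam : lam ≤ 4) : PolyTimeSearch lam := by
  let R : FinGraph → Mem × (ℕ → ℕ → Cell) := fun G => pOptimal lam (fun _ => G.1) G.1
    (Mem.blank, startMatrix (fun b => Cell.blank (b = true)) G)
  refine ⟨fun G => (if (R G).1.fail then .notFound else .found) ::
    if decide (¬ (R G).1.fail) then (List.range G.1).flatMap fun i =>
      (List.range G.1).map (fun j => outSymbol lam (some ((R G).2 i j))) ++ [outSymbol lam none]
    else [], fun G => ?_, polyTime_of_implementable (implementable_optimal lam) Mem.blank
    (fun b => Cell.blank (b = true)) (fun s => if s.fail then .notFound else .found)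
    (fun s => decide (¬ s.fail)) (outSymbol lam) _ _ ?_⟩
  · obtain ⟨h1, h2, h3⟩ := pOptimal_spec (e := fun _ => G.1)
      (S := (Mem.blank, startMatrix (fun b => Cell.blank (b = true)) G)) hlam (stores_startMatrix G)
    change ((R G).1.fail ↔ _) at h1
    change Stores G.2 (R G).2 at h2
    change ¬ (R G).1.fail → IsLab _ _ (stored G.2 (R G).2) at h3
    refine ⟨fun hle => ?_, fun hle => ?_⟩
    · have hf : ¬ (R G).1.fail := by rw [h1]; exact not_not.mpr hle
      have hg := (h3 hf).of_natGraph
      refine ⟨fun a => ⟨edgeLabel hg a, by have := edgeLabel_le hg a; omega⟩,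
        isEdgeLabeling_edgeLabel hg, maxLabel_edgeLabel hg, ?_⟩
      simp only [hf, not_false_eq_true, decide_true, if_true, if_false, encodeLabeling]
      have e1 : List.range G.1 = (List.finRange G.1).map Fin.val := by simp
      rw [e1, List.flatMap_map]
      congr 2
      funext i
      rw [List.map_map]
      congr 2
      funext j
      simp only [Function.comp, outSymbol, h2 i i.2 j j.2, natGraph_adj_val]
      split_ifs with h
      · congr 2
        have h5 : stored G.2 (R G).2 i j = ((R G).2 i j).lab.val := if_pos (natGraph_adj_val.mpr h)
        have h6 := hg.le h
        rw [edgeLabel_mk]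
        rw [h5] at h6 ⊢
        omega
      · rfl
    · have hf : (R G).1.fail := h1.mpr hle
      simp only [hf, not_true_eq_false, decide_false, if_true, Bool.false_eq_true, if_false]
  · rintro G S rfl
    rfl

end

/-! ### Graphs of maximum degree two, with leaves attached -/

section
variable {V : Type}

theorem cycleGraph_adj_iff {n : ℕ} (hn : 3 ≤ n) {i j : Fin n} :
    (SimpleGraph.cycleGraph n).Adj i j ↔ j.val = (i.val + 1) % n ∨ i.val = (j.val + 1) % n := by
  obtain ⟨m, rfl⟩ : ∃ m, n = m + 1 := ⟨n - 1, by omega⟩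
  have key : ∀ i j : Fin (m + 1), (j - i).val = 1 ↔ j.val = (i.val + 1) % (m + 1) := by
    intro i j
    have hi := i.2
    have hj := j.2
    rw [Fin.sub_def]
    change (m + 1 - i.val + j.val) % (m + 1) = 1 ↔ _
    have e1 : (i.val + 1) % (m + 1) = if i.val + 1 = m + 1 then 0 else i.val + 1 := by
      split_ifs with h
      · rw [h, Nat.mod_self]
      · exact Nat.mod_eq_of_lt (by omega)
    have e2 : (m + 1 - i.val + j.val) % (m + 1) =
        if i.val ≤ j.val then j.val - i.val else m + 1 - i.val + j.val := by
      split_ifs with h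
      · rw [show m + 1 - i.val + j.val = j.val - i.val + (m + 1) by omega, Nat.add_mod_right]
        exact Nat.mod_eq_of_lt (by omega)
      · exact Nat.mod_eq_of_lt (by omega)
    rw [e1, e2]
    split_ifs <;> omega
  rw [SimpleGraph.cycleGraph_adj', key, key, or_comm]

/-- A connected graph is the only nonempty set of vertices closed under adjacency. -/
theorem mem_of_closed {G : SimpleGraph V} (hG : G.Preconnected) {T : Set V} {x : V} (hx : x ∈ T)
    (hT : ∀ y ∈ T, ∀ z, G.Adj y z → z ∈ T) (y : V) : y ∈ T := by
  obtain ⟨p⟩ := hG x y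
  induction p with
  | nil => exact hx
  | cons h p ih => exact ih (hT _ hx _ h)

/-- The first `m` terms of the sequence `φ` form a path. -/
def IsSeq (C : SimpleGraph V) (m : ℕ) (φ : ℕ → V) : Prop :=
  (∀ i < m, ∀ j < m, φ i = φ j → i = j) ∧ ∀ i, i + 1 < m → C.Adj (φ i) (φ (i + 1))

/-- A finite graph without nonempty proper closed sets and of maximum degree two is a path or a
cycle. -/
theorem exists_path_or_cycle [Finite V] [Nonempty V] {C : SimpleGraph V}
    (hconn : ∀ (T : Set V) (x : V), x ∈ T → (∀ y ∈ T, ∀ z, C.Adj y z → z ∈ T) → ∀ y, y ∈ T)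
    (hdeg : ∀ v x y z, C.Adj v x → C.Adj v y → C.Adj v z → x = y ∨ x = z ∨ y = z) :
    ∃ n, (1 ≤ n ∧ Nonempty (SimpleGraph.pathGraph n ≃g C)) ∨
      (3 ≤ n ∧ Nonempty (SimpleGraph.cycleGraph n ≃g C)) := by
  -- a longest path
  obtain ⟨v₀⟩ := ‹Nonempty V›
  have hbound : ∀ m φ, IsSeq C m φ → m ≤ Nat.card V := by
    intro m φ hφ
    have := Nat.card_le_card_of_injective (fun i : Fin m => φ i)
      fun i j h => Fin.ext (hφ.1 i i.2 j j.2 h)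
    simpa using this
  obtain ⟨m, ⟨φ, hφ⟩, hmax⟩ : ∃ m, (∃ φ, IsSeq C m φ) ∧ ∀ m', (∃ φ, IsSeq C m' φ) → m' ≤ m := by
    classical
    have h1 : ∃ φ, IsSeq C 1 φ := ⟨fun _ => v₀, fun i hi j hj _ => by omega, fun i hi => by omega⟩
    have hb : 1 ≤ Nat.card V := h1.elim fun φ h => hbound 1 φ h
    exact ⟨_, Nat.findGreatest_spec (P := fun m => ∃ φ, IsSeq C m φ) hb h1,
      fun m' hm' => Nat.le_findGreatest (hm'.elim fun φ h => hbound m' φ h) hm'⟩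
  have hm1 : 1 ≤ m := hmax 1 ⟨fun _ => v₀, fun i hi j hj _ => by omega, fun i hi => by omega⟩
  obtain ⟨hinj, hadj⟩ := hφ
  have hback : ∀ i, 0 < i → i < m → C.Adj (φ i) (φ (i - 1)) := fun i hi him => by
    have := hadj (i - 1) (by omega)
    rw [show i - 1 + 1 = i by omega] at this
    exact this.symm
  have hsurj : ∀ y, ∃ i < m, φ i = y := by
    refine hconn {y | ∃ i < m, φ i = y} (φ 0) ⟨0, by omega, rfl⟩ ?_
    rintro _ ⟨i, hi, rfl⟩ z hz
    by_contra hno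
    simp only [Set.mem_ofPred_eq, not_exists, not_and] at hno
    rcases Nat.eq_zero_or_pos i with rfl | hi0
    · -- extend at the front
      have := hmax (m + 1) ⟨fun i => if i = 0 then z else φ (i - 1), fun i hi j hj h => ?_,
        fun i hi => ?_⟩
      · omega
      · dsimp only at h
        split_ifs at h with h1 h2 h2
        · omega
        · exact absurd h.symm (hno _ (by omega))
        · exact absurd h (hno _ (by omega))
        · have := hinj _ (by omega) _ (by omega) h
          omega
      · dsimp only
        rw [if_neg (Nat.succ_ne_zero i)]
        split_ifs with h1
        · subst h1; exact hz.symm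
        · have := hadj (i - 1) (by omega)
          rwa [show i - 1 + 1 = i by omega] at this
    by_cases him : i + 1 = m
    · -- extend at the back
      have := hmax (m + 1) ⟨fun j => if j = m then z else φ j, fun j hj l hl h => ?_,
        fun j hj => ?_⟩
      · omega
      · dsimp only at h
        split_ifs at h with h1 h2 h2
        · omega
        · exact absurd h.symm (hno _ (by omega))
        · exact absurd h (hno _ (by omega))
        · exact hinj _ (by omega) _ (by omega) h
      · dsimp only
        rw [if_neg (by omega)]
        split_ifs with h1
        · rw [show j = i by omega]; exact hz
        · exact hadj j (by omega)
    · rcases hdeg _ _ _ _ (hback i hi0 hi) (hadj i (by omega)) hz with h | h | h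
      · have := hinj _ (by omega) _ (by omega) h
        omega
      · exact hno _ (by omega) h
      · exact hno _ (by omega) h
  -- two vertices of the path that are adjacent but not consecutive are its ends
  have hends : ∀ i j, i < j → j < m → C.Adj (φ i) (φ j) → j ≠ i + 1 → i = 0 ∧ j + 1 = m ∧ 3 ≤ m := by
    intro i j hij hj h hne
    have hi0 : i = 0 := by
      by_contra hi0
      rcases hdeg _ _ _ _ (hback i (by omega) (by omega)) (hadj i (by omega)) h with h | h | h <;>
      · have := hinj _ (by omega) _ (by omega) h
        omega
    refine ⟨hi0, ?_, by omega⟩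
    by_contra hjm
    rcases hdeg _ _ _ _ (hback j (by omega) (by omega)) (hadj j (by omega)) h.symm with h | h | h <;>
    · have := hinj _ (by omega) _ (by omega) h
      omega
  let ψ : Fin m ≃ V := Equiv.ofBijective (fun i => φ i)
    ⟨fun i j h => Fin.ext (hinj i i.2 j j.2 h), fun y => by
      obtain ⟨i, hi, h⟩ := hsurj y
      exact ⟨⟨i, hi⟩, h⟩⟩
  by_cases hc : 3 ≤ m ∧ C.Adj (φ 0) (φ (m - 1))
  · refine ⟨m, .inr ⟨hc.1, ⟨ψ, ?_⟩⟩⟩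
    intro i j
    change C.Adj (φ i) (φ j) ↔ _
    rw [cycleGraph_adj_iff hc.1]
    have hmod : ∀ i : Fin m, (i.val + 1) % m = if i.val + 1 = m then 0 else i.val + 1 := by
      intro i
      have := i.2
      split_ifs with h
      · rw [h, Nat.mod_self]
      · exact Nat.mod_eq_of_lt (by omega)
    have hstep : ∀ i j : Fin m, j.val = (i.val + 1) % m → C.Adj (φ i) (φ j) := by
      intro i j h
      rw [hmod] at h
      split_ifs at h with h1
      · rw [h, show i.val = m - 1 by omega]
        exact hc.2.symm
      · rw [h]
        exact hadj i (by omega)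
    constructor
    · intro h
      have hi := i.2
      have hj := j.2
      rw [hmod, hmod]
      rcases lt_trichotomy i.val j.val with hij | hij | hij
      · by_cases h1 : j.val = i.val + 1
        · left; split_ifs <;> omega
        · have := hends i j hij j.2 h h1
          right; split_ifs <;> omega
      · rw [hij] at h
        exact absurd rfl h.ne
      · by_cases h1 : i.val = j.val + 1
        · right; split_ifs <;> omega
        · have := hends j i hij i.2 h.symm h1
          left; split_ifs <;> omega
    · rintro (h | h)
      · exact hstep i j h
      · exact (hstep j i h).symm
  · refine ⟨m, .inl ⟨hm1, ⟨ψ, ?_⟩⟩⟩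
    intro i j
    change C.Adj (φ i) (φ j) ↔ _
    rw [SimpleGraph.pathGraph_adj]
    have hlt : ∀ i j : Fin m, i.val < j.val → C.Adj (φ i) (φ j) → i.val + 1 = j.val := by
      intro i j hij h
      by_contra h1
      obtain ⟨e1, e2, e3⟩ := hends i j hij j.2 h fun e => h1 e.symm
      refine hc ⟨e3, ?_⟩
      rwa [e1, show j.val = m - 1 by omega] at h
    constructor
    · intro h
      rcases lt_trichotomy i.val j.val with hij | hij | hij
      · exact .inl (hlt i j hij h)
      · rw [hij] at h
        exact absurd rfl h.ne
      · exact .inr (hlt j i hij h.symm)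
    · rintro (h | h)
      · rw [← h]; exact hadj i (by have := j.2; omega)
      · rw [← h]; exact (hadj j (by have := i.2; omega)).symm

/-- The set `W` consists of leaves attached to the other vertices, at most one at each. -/
structure IsLeafSet (G : SimpleGraph V) (W : Set V) : Prop where
  leaf : ∀ {w}, w ∈ W → ∃ v, v ∉ W ∧ ∀ x, G.Adj w x ↔ x = v
  unique : ∀ {v w w'}, w ∈ W → w' ∈ W → G.Adj v w → G.Adj v w' → w = w'

/-- A graph with leaves attached is determined by the graph without them. -/
theorem IsLeafSet.iso {G : SimpleGraph V} {W : Set V} (hW : IsLeafSet G W) {U : Type}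
    {H : SimpleGraph U} (φ : H ≃g G.induce Wᶜ) :
    Nonempty (G ≃g withPendants H {i | ∃ w ∈ W, G.Adj (φ i) w}) := by
  set S : Set U := {i | ∃ w ∈ W, G.Adj (φ i) w} with hS
  let ψ : U ⊕ S → V := fun a => match a with
    | .inl i => φ i
    | .inr s => s.2.choose
  have hs : ∀ s : S, ψ (.inr s) ∈ W ∧ G.Adj (φ s.1) (ψ (.inr s)) := fun s => s.2.choose_spec
  have hinj : Function.Injective φ := φ.injective
  have hnot : ∀ i, (φ i : V) ∉ W := fun i => (φ i).2
  have hnb : ∀ {i w}, w ∈ W → G.Adj (φ i) w → ∀ {j}, G.Adj (φ j) w → i = j := by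
    intro i w hw hi j hj
    obtain ⟨v, -, hv⟩ := hW.leaf hw
    exact hinj (Subtype.ext (((hv _).mp hi.symm).trans ((hv _).mp hj.symm).symm))
  have hbij : Function.Bijective ψ := by
    constructor
    · rintro (i | s) (j | t) h
      · exact congrArg _ (hinj (Subtype.ext h))
      · exact absurd ((hs t).1) (by rw [← h]; exact hnot i)
      · exact absurd ((hs s).1) (by rw [h]; exact hnot j)
      · refine congrArg _ (Subtype.ext (hnb (hs s).1 (hs s).2 ?_))
        rw [h]
        exact (hs t).2
    · intro v
      by_cases hv : v ∈ W
      · obtain ⟨u, hu, hu'⟩ := hW.leaf hv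
        have h1 : (φ (φ.symm ⟨u, hu⟩) : V) = u := by simp
        have h2 : G.Adj (φ (φ.symm ⟨u, hu⟩)) v := by rw [h1]; exact ((hu' u).mpr rfl).symm
        let s : S := ⟨φ.symm ⟨u, hu⟩, v, hv, h2⟩
        exact ⟨.inr s, hW.unique (hs s).1 hv (hs s).2 h2⟩
      · exact ⟨.inl (φ.symm ⟨v, hv⟩), by simp [ψ]⟩
  let e : U ⊕ S ≃ V := Equiv.ofBijective ψ hbij
  refine ⟨RelIso.symm ⟨e, ?_⟩⟩
  rintro (i | s) (j | t)
  · exact (φ.map_rel_iff (a := i) (b := j))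
  · change G.Adj (φ i) (ψ (.inr t)) ↔ i = t.1
    exact ⟨fun h => hnb (hs t).1 h (hs t).2, fun h => by rw [h]; exact (hs t).2⟩
  · change G.Adj (ψ (.inr s)) (φ j) ↔ j = s.1
    exact ⟨fun h => hnb (hs s).1 h.symm (hs s).2, fun h => by rw [h]; exact (hs s).2.symm⟩
  · change G.Adj (ψ (.inr s)) (ψ (.inr t)) ↔ False
    refine iff_false_intro fun h => ?_
    obtain ⟨v, hv, hv'⟩ := hW.leaf (hs s).1
    rw [hv'] at h
    exact hv (h ▸ (hs t).1)

theorem IsLeafSet.exists_iso [Finite V] {G : SimpleGraph V} {W : Set V} (hW : IsLeafSet G W)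
    (hG : G.Connected)
    (hdeg : ∀ v x y z, G.Adj v x → G.Adj v y → G.Adj v z → v ∉ W → x ∉ W → y ∉ W → z ∉ W →
      x = y ∨ x = z ∨ y = z) :
    ∃ n, (1 ≤ n ∧ ∃ φ : SimpleGraph.pathGraph n ≃g G.induce Wᶜ,
        Nonempty (G ≃g genPath n {i | ∃ w ∈ W, G.Adj (φ i) w})) ∨
      (3 ≤ n ∧ ∃ φ : SimpleGraph.cycleGraph n ≃g G.induce Wᶜ,
        Nonempty (G ≃g genCycle n {i | ∃ w ∈ W, G.Adj (φ i) w})) := by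
  have hne : Nonempty (Wᶜ : Set V) := by
    obtain ⟨v⟩ := hG.nonempty
    by_cases hv : v ∈ W
    · obtain ⟨u, hu, -⟩ := hW.leaf hv
      exact ⟨⟨u, hu⟩⟩
    · exact ⟨⟨v, hv⟩⟩
  suffices h : ∃ n, (1 ≤ n ∧ Nonempty (SimpleGraph.pathGraph n ≃g G.induce Wᶜ)) ∨
      (3 ≤ n ∧ Nonempty (SimpleGraph.cycleGraph n ≃g G.induce Wᶜ)) by
    obtain ⟨n, ⟨hn, ⟨φ⟩⟩ | ⟨hn, ⟨φ⟩⟩⟩ := h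
    · exact ⟨n, .inl ⟨hn, φ, hW.iso φ⟩⟩
    · exact ⟨n, .inr ⟨hn, φ, hW.iso φ⟩⟩
  refine exists_path_or_cycle ?_ ?_
  · -- a closed set is closed in the whole graph after adding the attached leaves
    intro T x hx hT y
    have := mem_of_closed hG.preconnected (T := {v | (∃ h : v ∈ Wᶜ, ⟨v, h⟩ ∈ T) ∨
      v ∈ W ∧ ∃ t ∈ T, G.Adj t.1 v}) (x := x.1) (.inl ⟨x.2, hx⟩) ?_ y.1
    · rcases this with ⟨h, h'⟩ | ⟨h, -⟩
      · exact h'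
      · exact absurd h y.2
    · rintro v (⟨h, h'⟩ | ⟨h, t, ht, htv⟩) z hz
      · by_cases hzW : z ∈ W
        · exact .inr ⟨hzW, _, h', hz⟩
        · exact .inl ⟨hzW, hT _ h' ⟨z, hzW⟩ hz⟩
      · obtain ⟨u, hu, hu'⟩ := hW.leaf h
        obtain rfl := (hu' z).mp hz
        obtain rfl := (hu' t.1).mp htv.symm
        exact .inl ⟨hu, ht⟩
  · rintro v x y z hx hy hz
    have := hdeg v x y z hx hy hz v.2 x.2 y.2 z.2
    simpa only [Subtype.ext_iff] using this

end

/-! ### Connected graphs with labelings with labels at most four -/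

section
variable {V : Type} {G : SimpleGraph V} {g : V → V → ℕ}

/-- The leaves at the edges labeled `2` at vertices of degree three. -/
def labelTwoLeaves (G : SimpleGraph V) (g : V → V → ℕ) : Set V :=
  {w | ∃ v x y, G.Adj v w ∧ G.Adj v x ∧ G.Adj v y ∧ w ≠ x ∧ w ≠ y ∧ x ≠ y ∧ g v w = 2}

theorem IsLab.isLeafSet (hg : IsLab G 4 g) : IsLeafSet G (labelTwoLeaves G g) where
  leaf := by
    rintro w ⟨v, x, y, hw, hx, hy, hwx, hwy, hxy, h2⟩
    refine ⟨v, ?_, fun z => ⟨fun hz => hg.leaf hw hx hy hwx hwy hxy h2 hz, fun h => h ▸ hw.symm⟩⟩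
    rintro ⟨u, a, b, hv, ha, hb, hva, hvb, hab, h2'⟩
    -- a leaf has only one neighbour
    have h1 := hg.leaf hv ha hb hva hvb hab h2' hw
    have h2 := hg.leaf hv ha hb hva hvb hab h2' hx
    exact hwx (h1.trans h2.symm)
  unique := by
    rintro v w w' ⟨u, x, y, hw, hx, hy, hwx, hwy, hxy, h2⟩
      ⟨u', x', y', hw', hx', hy', hwx', hwy', hxy', h2'⟩ h h'
    by_contra hne
    have e1 := hg.leaf hw hx hy hwx hwy hxy h2 h.symm
    have e2 := hg.leaf hw' hx' hy' hwx' hwy' hxy' h2' h'.symm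
    subst e1
    subst e2
    have := hg.sep h h' hne
    omega

theorem IsLab.exists_iso [Finite V] (hg : IsLab G 4 g) (hG : G.Connected) :
    ∃ n, (1 ≤ n ∧ ∃ φ : SimpleGraph.pathGraph n ≃g G.induce (labelTwoLeaves G g)ᶜ,
        Nonempty (G ≃g genPath n {i | ∃ w ∈ labelTwoLeaves G g, G.Adj (φ i) w})) ∨
      (3 ≤ n ∧ ∃ φ : SimpleGraph.cycleGraph n ≃g G.induce (labelTwoLeaves G g)ᶜ,
        Nonempty (G ≃g genCycle n {i | ∃ w ∈ labelTwoLeaves G g, G.Adj (φ i) w})) := by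
  refine hg.isLeafSet.exists_iso hG ?_
  intro v x y z hx hy hz _ hxW hyW hzW
  by_contra! h
  rcases (hg.three hx hy hz h.1 h.2.1 h.2.2).2 with h2 | h2 | h2
  · exact hxW ⟨v, y, z, hx, hy, hz, h.1, h.2.1, h.2.2, h2⟩
  · exact hyW ⟨v, x, z, hy, hx, hz, h.1.symm, h.2.2, h.2.1, h2⟩
  · exact hzW ⟨v, x, y, hz, hx, hy, h.2.1.symm, h.2.2.symm, h.1, h2⟩

theorem isGeneralized_of_lambdaEdge_le [Finite V] (hG : G.Connected) (h : lambdaEdge G ≤ 4) :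
    IsGeneralizedPath G ∨ IsGeneralizedCycle G := by
  obtain ⟨g, hg⟩ := (lambdaEdge_le_iff 4).mp h
  obtain ⟨n, ⟨hn, φ, e⟩ | ⟨hn, φ, e⟩⟩ := hg.exists_iso hG
  · exact .inl ⟨n, _, hn, e⟩
  · exact .inr ⟨n, _, hn, e⟩

/-- With labels at most `3`, no walk has five edges of which any two consecutive ones differ. -/
theorem IsLab.not_strand (hg : IsLab G 3 g) {p : ℕ → V} (hp : ∀ t < 5, G.Adj (p t) (p (t + 1)))
    (hp' : ∀ t < 4, p t ≠ p (t + 2)) : False := by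
  have hs : ∀ t < 4, g (p t) (p (t + 1)) + 2 ≤ g (p (t + 1)) (p (t + 2)) ∨
      g (p (t + 1)) (p (t + 2)) + 2 ≤ g (p t) (p (t + 1)) := fun t ht => by
    have := hg.sep (hp t (by omega)).symm (hp (t + 1) (by omega)) (hp' t ht)
    rwa [hg.symm (p (t + 1)) (p t)] at this
  have hf : ∀ t < 3, g (p t) (p (t + 1)) ≠ g (p (t + 2)) (p (t + 3)) := fun t ht => by
    have := hg.far (hp (t + 1) (by omega)) (hp t (by omega)).symm (hp (t + 2) (by omega))
      (hp' t (by omega)) (hp' (t + 1) (by omega)).symm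
    rwa [hg.symm (p (t + 1)) (p t)] at this
  have hl : ∀ t < 5, g (p t) (p (t + 1)) ≤ 3 := fun t ht => hg.le (hp t ht)
  have s0 := hs 0 (by omega)
  have s1 := hs 1 (by omega)
  have s2 := hs 2 (by omega)
  have s3 := hs 3 (by omega)
  have f0 := hf 0 (by omega)
  have f1 := hf 1 (by omega)
  have f2 := hf 2 (by omega)
  have l0 := hl 0 (by omega)
  have l1 := hl 1 (by omega)
  have l2 := hl 2 (by omega)
  have l3 := hl 3 (by omega)
  have l4 := hl 4 (by omega)
  simp only [Nat.reduceAdd] at *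
  omega

/-- Without leaves, nothing is attached. -/
def withPendantsEmpty {U : Type} (H : SimpleGraph U) : withPendants H ∅ ≃g H where
  toEquiv := Equiv.sumEmpty U (∅ : Set U)
  map_rel_iff' := by
    rintro (a | s) (b | t)
    · exact Iff.rfl
    · exact t.2.elim
    · exact s.2.elim
    · exact s.2.elim

theorem exists_iso_pathGraph [Finite V] (hG : G.Connected) (h : lambdaEdge G ≤ 3) :
    ∃ n, 1 ≤ n ∧ n ≤ 5 ∧ Nonempty (G ≃g SimpleGraph.pathGraph n) := by
  obtain ⟨g, hg⟩ := (lambdaEdge_le_iff 3).mp h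
  have hg4 : IsLab G 4 g := hg.mono (by omega)
  have hW : labelTwoLeaves G g = ∅ := by
    rw [Set.eq_empty_iff_forall_notMem]
    rintro w ⟨v, x, y, hw, hx, hy, hwx, hwy, hxy, h2⟩
    have := hg.le hx
    have := hg.le hy
    have := hg.sep hw hx hwx
    have := hg.sep hw hy hwy
    have := hg.sep hx hy hxy
    omega
  have hS : ∀ {U : Type} (φ : U → V), {i | ∃ w ∈ labelTwoLeaves G g, G.Adj (φ i) w} = ∅ := by
    intro U φ
    rw [hW]
    simp
  obtain ⟨n, ⟨hn, φ, ⟨e⟩⟩ | ⟨hn, φ, ⟨e⟩⟩⟩ := hg4.exists_iso hG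
  · rw [hS] at e
    have e' := e.trans (withPendantsEmpty _)
    refine ⟨n, hn, ?_, ⟨e'⟩⟩
    by_contra hn5
    refine hg.not_strand (p := fun t => e'.symm ⟨t % n, Nat.mod_lt _ (by omega)⟩) (fun t ht => ?_)
      fun t ht => ?_
    · refine e'.symm.map_rel_iff.mpr ?_
      rw [SimpleGraph.pathGraph_adj]
      left
      change t % n + 1 = (t + 1) % n
      rw [Nat.mod_eq_of_lt (by omega), Nat.mod_eq_of_lt (by omega)]
    · refine e'.symm.injective.ne fun h => ?_
      have h := congrArg Fin.val h
      dsimp only at h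
      rw [Nat.mod_eq_of_lt (by omega), Nat.mod_eq_of_lt (by omega)] at h
      omega
  · rw [hS] at e
    have e' := e.trans (withPendantsEmpty _)
    exfalso
    refine hg.not_strand (p := fun t => e'.symm ⟨t % n, Nat.mod_lt _ (by omega)⟩) (fun t ht => ?_)
      fun t ht => ?_
    · refine e'.symm.map_rel_iff.mpr ?_
      rw [cycleGraph_adj_iff hn]
      left
      simp
    · refine e'.symm.injective.ne fun h => ?_
      have h := congrArg Fin.val h
      dsimp only at h
      have h1 : (t + 0) % n = (t + 2) % n := h
      have := Nat.ModEq.add_left_cancel' t h1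
      rw [Nat.ModEq, Nat.mod_eq_of_lt (by omega), Nat.mod_eq_of_lt (by omega)] at this
      omega

/-! ### The paths with at most five vertices -/

theorem IsLab.pathGraph {n k : ℕ} {a : ℕ → ℕ} (hle : ∀ t, t + 1 < n → a t ≤ k)
    (hsep : ∀ t, t + 2 < n → a t + 2 ≤ a (t + 1) ∨ a (t + 1) + 2 ≤ a t)
    (hfar : ∀ t, t + 3 < n → a t ≠ a (t + 2)) :
    IsLab (SimpleGraph.pathGraph n) k fun i j => a (min i.val j.val) where
  symm i j := by rw [min_comm]
  le {i j} h := by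
    rw [SimpleGraph.pathGraph_adj] at h
    exact hle _ (by omega)
  sep {v u w} hu hw hne := by
    rw [SimpleGraph.pathGraph_adj] at hu hw
    have hne : u.val ≠ w.val := fun h => hne (Fin.ext h)
    rcases hu with hu | hu <;> rcases hw with hw | hw
    · omega
    · rw [min_eq_left (by omega), min_eq_right (by omega), show v.val = w.val + 1 by omega]
      exact (hsep w (by omega)).symm
    · rw [min_eq_right (by omega), min_eq_left (by omega), show v.val = u.val + 1 by omega]
      exact hsep u (by omega)
    · omega
  far {u v x y} h hx hy hne hne' := by
    rw [SimpleGraph.pathGraph_adj] at h hx hy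
    have hne : x.val ≠ v.val := fun h => hne (Fin.ext h)
    have hne' : y.val ≠ u.val := fun h => hne' (Fin.ext h)
    rcases h with h | h
    · rw [min_eq_right (by omega), min_eq_left (by omega), show v.val = x.val + 2 by omega]
      exact hfar x (by omega)
    · rw [min_eq_left (by omega), min_eq_right (by omega), show u.val = y.val + 2 by omega]
      exact (hfar y (by omega)).symm

theorem lambdaEdge_pathGraph_le {n k : ℕ} {a : ℕ → ℕ} (hle : ∀ t, t + 1 < n → a t ≤ k)
    (hsep : ∀ t, t + 2 < n → a t + 2 ≤ a (t + 1) ∨ a (t + 1) + 2 ≤ a t)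
    (hfar : ∀ t, t + 3 < n → a t ≠ a (t + 2)) : lambdaEdge (SimpleGraph.pathGraph n) ≤ k :=
  (lambdaEdge_le_iff k).mpr ⟨_, IsLab.pathGraph hle hsep hfar⟩

/-- The labels of the edges of a path on five vertices. -/
def fiveLabel : ℕ → ℕ
  | 0 => 1
  | 1 => 3
  | 2 => 0
  | _ => 2

theorem lambdaEdge_pathGraph_zero {n : ℕ} (hn : n ≤ 2) :
    lambdaEdge (SimpleGraph.pathGraph n) = 0 :=
  Nat.le_zero.mp (lambdaEdge_pathGraph_le (a := fun _ => 0) (fun _ _ => le_rfl) (fun _ _ => by omega)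
    fun _ _ => by omega)

theorem lambdaEdge_pathGraph_three : lambdaEdge (SimpleGraph.pathGraph 3) = 2 := by
  refine le_antisymm (lambdaEdge_pathGraph_le (a := fun t => 2 * t) (fun t ht => by omega)
    (fun t ht => by omega) fun t ht => by omega) ?_
  obtain ⟨g, hg⟩ := (lambdaEdge_le_iff (G := SimpleGraph.pathGraph 3) _).mp le_rfl
  have h0 : (SimpleGraph.pathGraph 3).Adj 1 0 := by rw [SimpleGraph.pathGraph_adj]; decide
  have h2 : (SimpleGraph.pathGraph 3).Adj 1 2 := by rw [SimpleGraph.pathGraph_adj]; decide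
  have := hg.sep h0 h2 (by decide)
  have := hg.le h0
  have := hg.le h2
  omega

theorem lambdaEdge_pathGraph_four_five {n : ℕ} (hn : 4 ≤ n) (hn' : n ≤ 5) :
    lambdaEdge (SimpleGraph.pathGraph n) = 3 := by
  refine le_antisymm (lambdaEdge_pathGraph_le (a := fiveLabel) (fun t ht => ?_)
    (fun t ht => ?_) fun t ht => ?_) ?_
  · have : t < 4 := by omega
    interval_cases t <;> decide
  · have : t < 3 := by omega
    interval_cases t <;> decide
  · have : t < 2 := by omega
    interval_cases t <;> decide
  · obtain ⟨g, hg⟩ := (lambdaEdge_le_iff (G := SimpleGraph.pathGraph n) _).mp le_rfl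
    let p : ∀ i < 4, Fin n := fun i hi => ⟨i, by omega⟩
    have h (i : ℕ) (hi : i < 3) : (SimpleGraph.pathGraph n).Adj (p i (by omega))
        (p (i + 1) (by omega)) := by rw [SimpleGraph.pathGraph_adj]; exact .inl rfl
    have h0 := h 0 (by omega)
    have h1 := h 1 (by omega)
    have h2 := h 2 (by omega)
    have s1 := hg.sep h0.symm h1 (by simp [p])
    have s2 := hg.sep h1.symm h2 (by simp [p])
    have f := hg.far h1 h0.symm h2 (by simp [p]) (by simp [p])
    have l0 := hg.le h0.symm
    have l1 := hg.le h1
    have l2 := hg.le h2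
    rw [hg.symm (p (1 + 1) (by omega)) (p 1 (by omega))] at s2
    simp only [Nat.reduceAdd] at *
    omega

/-- The connected graphs with a labeling with labels at most three. -/
theorem lambdaEdge_small [Finite V] (hG : G.Connected) :
    (lambdaEdge G = 0 ↔
      Nonempty (G ≃g SimpleGraph.pathGraph 1) ∨ Nonempty (G ≃g SimpleGraph.pathGraph 2)) ∧
    lambdaEdge G ≠ 1 ∧ (lambdaEdge G = 2 ↔ Nonempty (G ≃g SimpleGraph.pathGraph 3)) ∧
    (lambdaEdge G = 3 ↔
      Nonempty (G ≃g SimpleGraph.pathGraph 4) ∨ Nonempty (G ≃g SimpleGraph.pathGraph 5)) := by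
  have e1 := lambdaEdge_pathGraph_zero (n := 1) (by omega)
  have e2 := lambdaEdge_pathGraph_zero (n := 2) (by omega)
  have e3 := lambdaEdge_pathGraph_three
  have e4 := lambdaEdge_pathGraph_four_five (n := 4) (by omega) (by omega)
  have e5 := lambdaEdge_pathGraph_four_five (n := 5) (by omega) (by omega)
  have hcongr : ∀ {n}, Nonempty (G ≃g SimpleGraph.pathGraph n) →
      lambdaEdge G = lambdaEdge (SimpleGraph.pathGraph n) := fun ⟨e⟩ => lambdaEdge_congr e
  have hcases : lambdaEdge G ≤ 3 →
      (lambdaEdge G = 0 ∧ (Nonempty (G ≃g SimpleGraph.pathGraph 1) ∨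
        Nonempty (G ≃g SimpleGraph.pathGraph 2))) ∨
      (lambdaEdge G = 2 ∧ Nonempty (G ≃g SimpleGraph.pathGraph 3)) ∨
      (lambdaEdge G = 3 ∧ (Nonempty (G ≃g SimpleGraph.pathGraph 4) ∨
        Nonempty (G ≃g SimpleGraph.pathGraph 5))) := by
    intro h
    obtain ⟨n, h1, h5, e⟩ := exists_iso_pathGraph hG h
    have := hcongr e
    interval_cases n
    · exact .inl ⟨by omega, .inl e⟩
    · exact .inl ⟨by omega, .inr e⟩
    · exact .inr (.inl ⟨by omega, e⟩)
    · exact .inr (.inr ⟨by omega, .inl e⟩)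
    · exact .inr (.inr ⟨by omega, .inr e⟩)
  refine ⟨⟨fun h => ?_, ?_⟩, fun h => ?_, ⟨fun h => ?_, fun e => (hcongr e).trans e3⟩,
    ⟨fun h => ?_, ?_⟩⟩
  · rcases hcases (by omega) with ⟨-, e⟩ | ⟨h', -⟩ | ⟨h', -⟩
    · exact e
    · omega
    · omega
  · rintro (e | e)
    · exact (hcongr e).trans e1
    · exact (hcongr e).trans e2
  · rcases hcases (by omega) with ⟨h', -⟩ | ⟨h', -⟩ | ⟨h', -⟩ <;> omega
  · rcases hcases (by omega) with ⟨h', -⟩ | ⟨-, e⟩ | ⟨h', -⟩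
    · omega
    · exact e
    · omega
  · rcases hcases (by omega) with ⟨h', -⟩ | ⟨h', -⟩ | ⟨-, e⟩
    · omega
    · omega
    · exact e
  · rintro (e | e)
    · exact (hcongr e).trans e4
    · exact (hcongr e).trans e5

end

/-! ### Labels along a path -/

/-- The conditions on the labels `x, y, z` of three consecutive edges of a path, where `p` and `q`
tell whether a pendant edge, with label `2`, is attached at the two inner vertices. -/
abbrev Win (p q : Prop) (x y z : ℕ) : Prop :=
  (x ≤ 4 ∧ y ≤ 4 ∧ z ≤ 4) ∧ (x + 2 ≤ y ∨ y + 2 ≤ x) ∧ (y + 2 ≤ z ∨ z + 2 ≤ y) ∧ x ≠ z ∧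
    (p → (x = 0 ∨ x = 4) ∧ (y = 0 ∨ y = 4) ∧ z ≠ 2) ∧
    (q → (y = 0 ∨ y = 4) ∧ (z = 0 ∨ z = 4) ∧ x ≠ 2)

instance (p q : Prop) [Decidable p] [Decidable q] (x y z : ℕ) : Decidable (Win p q x y z) := by
  unfold Win
  infer_instance

theorem Win.mono {p q p' q' : Prop} {x y z : ℕ} (h : Win p q x y z) (hp : p' → p) (hq : q' → q) :
    Win p' q' x y z :=
  ⟨h.1, h.2.1, h.2.2.1, h.2.2.2.1, fun h' => h.2.2.2.2.1 (hp h'), fun h' => h.2.2.2.2.2 (hq h')⟩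

theorem Win.compl {p q : Prop} {x y z : ℕ} (h : Win p q x y z) :
    Win p q (4 - x) (4 - y) (4 - z) := by
  obtain ⟨h1, h2, h3, h4, h5, h6⟩ := h
  refine ⟨by omega, by omega, by omega, by omega, fun hp => ?_, fun hq => ?_⟩
  · have := h5 hp; omega
  · have := h6 hq; omega

/-- There are labels of the edges `i, …, j + 1` of a path in which the vertex between the edges `t`
and `t + 1` carries a pendant edge if `h t`, such that the first two labels are `x` and the last
two are `y`. -/
def Conn (h : ℕ → Prop) (i j : ℕ) (x y : ℕ × ℕ) : Prop :=
  ∃ a : ℕ → ℕ, (a i, a (i + 1)) = x ∧ (a j, a (j + 1)) = y ∧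
    ∀ t, i ≤ t → t < j → Win (h t) (h (t + 1)) (a t) (a (t + 1)) (a (t + 2))

section
variable {h h' : ℕ → Prop} {i j k : ℕ} {x y z : ℕ × ℕ}

theorem Conn.refl (i : ℕ) (x : ℕ × ℕ) : Conn h i i x x :=
  ⟨fun t => if t = i then x.1 else x.2, by simp, by simp, fun t h1 h2 => by omega⟩

theorem Conn.trans (hij : i ≤ j) (hjk : j ≤ k) (h1 : Conn h i j x y) (h2 : Conn h j k y z) :
    Conn h i k x z := by
  obtain ⟨a, ha, ha', hw⟩ := h1
  obtain ⟨b, hb, hb', hw'⟩ := h2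
  have hab : (a j, a (j + 1)) = (b j, b (j + 1)) := ha'.trans hb.symm
  simp only [Prod.mk.injEq] at hab
  let c : ℕ → ℕ := fun t => if t ≤ j then a t else b t
  have hca : ∀ t ≤ j + 1, c t = a t := by
    intro t ht
    simp only [c]
    split_ifs with h
    · rfl
    · rw [show t = j + 1 by omega, hab.2]
  have hcb : ∀ t, j ≤ t → c t = b t := by
    intro t ht
    simp only [c]
    split_ifs with h
    · rw [show t = j by omega, hab.1]
    · rfl
  refine ⟨c, ?_, ?_, fun t h1 h2 => ?_⟩
  · rw [hca i (by omega), hca (i + 1) (by omega), ha]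
  · rw [hcb k hjk, hcb (k + 1) (by omega), hb']
  · by_cases htj : t < j
    · rw [hca t (by omega), hca (t + 1) (by omega), hca (t + 2) (by omega)]
      exact hw t h1 htj
    · rw [hcb t (by omega), hcb (t + 1) (by omega), hcb (t + 2) (by omega)]
      exact hw' t (by omega) h2

/-- Labels may be shifted, and some of the pendant edges may be deleted. -/
theorem Conn.shift (h1 : Conn h i j x y) (s : ℕ) (hh : ∀ t, i ≤ t → t ≤ j → h' (t + s) → h t) :
    Conn h' (i + s) (j + s) x y := by
  obtain ⟨a, ha, ha', hw⟩ := h1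
  refine ⟨fun t => a (t - s), ?_, ?_, fun t h1 h2 => ?_⟩
  · simp only [show i + s + 1 = i + 1 + s by omega, Nat.add_sub_cancel, ha]
  · simp only [show j + s + 1 = j + 1 + s by omega, Nat.add_sub_cancel, ha']
  · obtain ⟨u, rfl⟩ : ∃ u, t = u + s := ⟨t - s, by omega⟩
    simp only [show u + s + 1 = u + 1 + s by omega, show u + s + 2 = u + 2 + s by omega,
      Nat.add_sub_cancel]
    exact (hw u (by omega) (by omega)).mono (hh u (by omega) (by omega))
      (hh (u + 1) (by omega) (by omega))

theorem Conn.compl (h1 : Conn h i j x y) : Conn h i j (4 - x.1, 4 - x.2) (4 - y.1, 4 - y.2) := by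
  obtain ⟨a, rfl, rfl, hw⟩ := h1
  exact ⟨fun t => 4 - a t, rfl, rfl, fun t h1 h2 => (hw t h1 h2).compl⟩

theorem conn_of_word (w : List ℕ) (d : ℕ)
    (hw : ∀ t < d, Win (h t) (h (t + 1)) (w.getD t 0) (w.getD (t + 1) 0) (w.getD (t + 2) 0)) :
    Conn h 0 d (w.getD 0 0, w.getD 1 0) (w.getD d 0, w.getD (d + 1) 0) :=
  ⟨fun t => w.getD t 0, rfl, rfl, fun t _ ht => hw t ht⟩

end

/-- The labels of the two edges of the path at a vertex with a pendant edge. -/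
def st (s : Bool) : ℕ × ℕ := if s then (4, 0) else (0, 4)

theorem st_not (s : Bool) : st (!s) = (4 - (st s).1, 4 - (st s).2) := by cases s <;> rfl

theorem st_injective : Function.Injective st := by decide

theorem exists_st {p q : Prop} {x y z : ℕ} (h : Win p q x y z) (hp : p) : ∃ s, (x, y) = st s := by
  obtain ⟨-, h2, -, -, h5, -⟩ := h
  rcases (h5 hp).1 with rfl | rfl
  · have := (h5 hp).2.1
    obtain rfl : y = 4 := by omega
    exact ⟨false, rfl⟩
  · have := (h5 hp).2.1
    obtain rfl : y = 0 := by omega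
    exact ⟨true, rfl⟩

theorem exists_st' {p q : Prop} {x y z : ℕ} (h : Win p q x y z) (hq : q) : ∃ s, (y, z) = st s := by
  obtain ⟨h1, h2, h3, h4, -, h6⟩ := h
  obtain ⟨h7, h8, h9⟩ := h6 hq
  rcases h7 with rfl | rfl
  · obtain rfl : z = 4 := by omega
    exact ⟨false, rfl⟩
  · obtain rfl : z = 0 := by omega
    exact ⟨true, rfl⟩

/-! ### Labels between two pendant edges -/

/-- Labels between two pendant edges at distance `d`, in given states. -/
def Arc (d : ℕ) (s s' : Bool) : Prop := Conn (fun t => t = 0 ∨ t = d) 0 d (st s) (st s')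

theorem Arc.trans {d e : ℕ} {s s' s'' : Bool} (h1 : Arc d s s') (h2 : Arc e s' s'') :
    Arc (d + e) s s'' := by
  have h2' := Conn.shift (h' := fun t => t = 0 ∨ t = d + e) h2 d fun t _ _ h => by omega
  have h1' := Conn.shift (h' := fun t => t = 0 ∨ t = d + e) h1 0 fun t _ _ h => by omega
  rw [Nat.zero_add] at h2'
  rw [Nat.add_comm e d] at h2'
  exact Conn.trans (by omega) (by omega) h1' h2'

theorem Arc.not {d : ℕ} {s s' : Bool} (h : Arc d s s') : Arc d (!s) (!s') := by
  unfold Arc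
  rw [st_not, st_not]
  exact h.compl

/-- Labels in which both states are the same. -/
def Keep (d : ℕ) : Prop := ∀ s, Arc d s s

/-- Labels in which the two states are different. -/
def Flip (d : ℕ) : Prop := ∀ s, Arc d s !s

theorem Keep.of_true {d : ℕ} (h : Arc d true true) : Keep d
  | true => h
  | false => h.not

theorem Flip.of_true {d : ℕ} (h : Arc d true false) : Flip d
  | true => h
  | false => h.not

theorem Keep.add {d e : ℕ} (h : Keep d) (h' : Keep e) : Keep (d + e) := fun s => (h s).trans (h' s)

theorem Flip.add {d e : ℕ} (h : Flip d) (h' : Keep e) : Flip (d + e) := fun s => (h s).trans (h' _)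

theorem keep_four : Keep 4 := .of_true (conn_of_word [4, 0, 3, 1, 4, 0] 4 (by decide))

theorem keep_nine : Keep 9 := .of_true (conn_of_word [4, 0, 3, 1, 4, 2, 0, 3, 1, 4, 0] 9 (by decide))

theorem keep_of_le {d : ℕ} (hd : 11 ≤ d) : Keep d := by
  induction d using Nat.strong_induction_on with
  | _ d ih =>
    by_cases h : d < 15
    · interval_cases d
      · exact .of_true (conn_of_word [4, 0, 3, 1, 4, 0, 2, 4, 0, 3, 1, 4, 0] 11 (by decide))
      · exact (keep_four.add keep_four).add keep_four
      · exact keep_nine.add keep_four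
      · exact .of_true
          (conn_of_word [4, 0, 3, 1, 4, 0, 2, 4, 0, 2, 4, 0, 3, 1, 4, 0] 14 (by decide))
    · have := (ih (d - 4) (by omega) (by omega)).add keep_four
      rwa [Nat.sub_add_cancel (by omega)] at this

theorem flip_ten : Flip 10 :=
  .of_true (conn_of_word [4, 0, 3, 1, 4, 0, 2, 4, 1, 3, 0, 4] 10 (by decide))

theorem flip_of_le {d : ℕ} (hd : 13 ≤ d) : Flip d := by
  induction d using Nat.strong_induction_on with
  | _ d ih =>
    by_cases h : d < 17
    · interval_cases d
      · exact .of_true (conn_of_word [4, 0, 3, 1, 4, 0, 2, 4, 0, 2, 4, 1, 3, 0, 4] 13 (by decide))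
      · exact flip_ten.add keep_four
      · exact .of_true
          (conn_of_word [4, 0, 3, 1, 4, 0, 2, 4, 1, 3, 0, 2, 4, 1, 3, 0, 4] 15 (by decide))
      · exact .of_true
          (conn_of_word [4, 0, 3, 1, 4, 0, 2, 4, 0, 2, 4, 0, 2, 4, 1, 3, 0, 4] 16 (by decide))
    · have := (ih (d - 4) (by omega) (by omega)).add keep_four
      rwa [Nat.sub_add_cancel (by omega)] at this

/-- The state after `k` changes. -/
def turn (k : ℕ) (s : Bool) : Bool := if Even k then s else !s

theorem turn_succ (k : ℕ) (s : Bool) : turn (k + 1) s = !turn k s := by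
  unfold turn
  simp only [Nat.even_add_one]
  split_ifs <;> simp

theorem turn_turn (k : ℕ) (s : Bool) : turn k (turn k s) = s := by
  unfold turn
  split_ifs <;> simp

theorem turn_eq_self {k : ℕ} {s : Bool} : turn k s = s ↔ Even k := by
  unfold turn
  split_ifs with h <;> simp [h]

theorem arc_of_gap {d : ℕ} (hd : d = 4 ∨ 8 ≤ d) (s : Bool) :
    Arc d s (turn (if d = 10 then 1 else 0) s) := by
  split_ifs with h
  · subst h
    exact flip_ten s
  · change Arc d s s
    rcases hd with rfl | hd
    · exact keep_four s
    · by_cases h11 : 11 ≤ d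
      · exact keep_of_le h11 s
      · interval_cases d
        · exact (keep_four.add keep_four) s
        · exact keep_nine s
        · omega

/-- The pairs of labels that can come after the pairs in the list `l`. -/
def succs (l : List (ℕ × ℕ)) : List (ℕ × ℕ) :=
  l.flatMap fun x => ((List.range 5).filter fun z => decide (Win False False x.1 x.2 z)).map
    fun z => (x.2, z)

/-- The labels of the two edges after a vertex with a pendant edge. -/
def out (s : Bool) : ℕ × ℕ := if s then (0, 3) else (4, 1)

/-- The labels of the two edges before a vertex with a pendant edge. -/
def into (s : Bool) : ℕ × ℕ := if s then (1, 4) else (3, 0)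

theorem arc_table : ∀ k < 11, ∀ s s' : Bool, into s' ∈ succs^[k] [out s] →
    (k + 2 = 4 ∨ 8 ≤ k + 2) ∧ (s' = s ↔ k + 2 ≠ 10) := by
  decide

theorem Arc.distance {d : ℕ} {s s' : Bool} (h : Arc d s s') (hd : 0 < d) :
    (d = 4 ∨ 8 ≤ d) ∧ (d < 13 → (s' = s ↔ d ≠ 10)) := by
  by_cases h13 : 13 ≤ d
  · exact ⟨by omega, by omega⟩
  obtain ⟨a, ha, ha', hw⟩ := h
  have hd2 : 2 ≤ d := by
    -- three consecutive edges cannot all have labels `0` and `4`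
    by_contra hd2
    obtain rfl : d = 1 := by omega
    obtain ⟨h1, h2, h3, h4, h5, h6⟩ := hw 0 le_rfl hd
    have := h5 (.inl rfl)
    have := h6 (.inr rfl)
    omega
  have hout : (a 1, a 2) = out s := by
    obtain ⟨h1, h2, h3, h4, h5, -⟩ := hw 0 le_rfl hd
    have h5 := h5 (.inl rfl)
    cases s <;> simp only [st, out, if_true, if_false, Bool.false_eq_true, Prod.mk.injEq] at ha ⊢ <;>
      simp only [Nat.zero_add] at * <;> omega
  have hinto : (a (d - 1), a d) = into s' := by
    obtain ⟨h1, h2, h3, h4, -, h6⟩ := hw (d - 1) (by omega) (by omega)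
    have h6 := h6 (.inr (by omega))
    rw [show d - 1 + 1 = d by omega, show d - 1 + 2 = d + 1 by omega] at *
    cases s' <;> simp only [st, into, if_true, if_false, Bool.false_eq_true, Prod.mk.injEq] at ha' ⊢ <;>
      omega
  have hreach : ∀ k, k + 2 ≤ d → (a (k + 1), a (k + 2)) ∈ succs^[k] [out s] := by
    intro k
    induction k with
    | zero => intro _; simp [← hout]
    | succ k ih =>
      intro hk
      rw [Function.iterate_succ_apply']
      have hw' := hw (k + 1) (by omega) (by omega)
      refine List.mem_flatMap.mpr ⟨_, ih (by omega), List.mem_map.mpr ⟨a (k + 1 + 2), ?_, rfl⟩⟩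
      rw [List.mem_filter, List.mem_range, decide_eq_true_eq]
      exact ⟨by have := hw'.1; omega, hw'.mono False.elim False.elim⟩
  have := hreach (d - 2) (by omega)
  rw [show d - 2 + 1 = d - 1 by omega, show d - 2 + 2 = d by omega, hinto] at this
  have := arc_table (d - 2) (by omega) s s' this
  rw [show d - 2 + 2 = d by omega] at this
  exact ⟨this.1, fun _ => this.2⟩

/-! ### Consecutive pendant edges -/

/-- The next pendant edge after the one at `t` is at distance `d`. -/
def Gap (h : ℕ → Prop) (t d : ℕ) : Prop :=
  0 < d ∧ h t ∧ h (t + d) ∧ ∀ k, 0 < k → k < d → ¬ h (t + k)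

section
variable {h : ℕ → Prop} {m n t d : ℕ}

theorem exists_gap {t' : ℕ} (ht : h t) (ht' : h t') (hlt : t < t') :
    ∃ d, Gap h t d ∧ t + d ≤ t' := by
  classical
  have hex : ∃ d, 0 < d ∧ h (t + d) := ⟨t' - t, by omega, by rwa [Nat.add_sub_cancel' hlt.le]⟩
  refine ⟨Nat.find hex, ⟨(Nat.find_spec hex).1, ht, (Nat.find_spec hex).2, fun k hk hkd hhk =>
    Nat.find_min hex hkd ⟨hk, hhk⟩⟩, ?_⟩
  have := Nat.find_min' hex (m := t' - t) ⟨by omega, by rwa [Nat.add_sub_cancel' hlt.le]⟩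
  omega

theorem Gap.unique {d' : ℕ} (h1 : Gap h t d) (h2 : Gap h t d') : d = d' := by
  by_contra hne
  rcases Nat.lt_or_gt_of_ne hne with hlt | hlt
  · exact h2.2.2.2 d h1.1 hlt h1.2.2.1
  · exact h1.2.2.2 d' h2.1 hlt h2.2.2.1

/-- Induction along the pendant edges. -/
theorem gap_induction (hm : h m) {P : ℕ → Prop} (h0 : P m)
    (hs : ∀ t d, m ≤ t → Gap h t d → P t → P (t + d)) {t : ℕ} (hmt : m ≤ t) (ht : h t) : P t := by
  have : ∀ k s, m ≤ s → s ≤ t → t - s ≤ k → h s → P s → P t := by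
    intro k
    induction k with
    | zero =>
      intro s _ h1 h2 _ hP
      rwa [show t = s by omega]
    | succ k ih =>
      intro s h0 h1 h2 hsh hP
      rcases h1.eq_or_lt with rfl | h1
      · exact hP
      · obtain ⟨d, hd, hle⟩ := exists_gap hsh ht h1
        exact ih (s + d) (by omega) hle (by have := hd.1; omega) hd.2.2.1 (hs s d h0 hd hP)
  exact this (t - m) m le_rfl hmt le_rfl hm h0

open Classical in
/-- The number of pendant edges at `m, …, t - 1` for which the next one is at distance `10`. -/
noncomputable def flips (h : ℕ → Prop) (m t : ℕ) : ℕ := {i ∈ Finset.Ico m t | Gap h i 10}.card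

theorem flips_self : flips h m m = 0 := by simp [flips]

theorem flips_add (hmt : m ≤ t) (hg : Gap h t d) :
    flips h m (t + d) = flips h m t + if d = 10 then 1 else 0 := by
  classical
  unfold flips
  rw [← Finset.Ico_union_Ico_eq_Ico hmt (Nat.le_add_right t d), Finset.filter_union,
    Finset.card_union_of_disjoint
      (Finset.disjoint_filter_filter (Finset.Ico_disjoint_Ico_consecutive m t (t + d)))]
  congr 1
  have hi : ∀ i ∈ Finset.Ico t (t + d), Gap h i 10 → i = t := by
    intro i hi h10
    rw [Finset.mem_Ico] at hi
    by_contra hne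
    refine hg.2.2.2 (i - t) (by omega) (by omega) ?_
    rw [Nat.add_sub_cancel' hi.1]
    exact h10.2.1
  split_ifs with h10
  · subst h10
    rw [Finset.card_eq_one]
    refine ⟨t, ?_⟩
    ext i
    simp only [Finset.mem_filter, Finset.mem_singleton]
    exact ⟨fun ⟨h1, h2⟩ => hi i h1 h2, fun h1 => by
      subst h1
      exact ⟨by simp, hg⟩⟩
  · rw [Finset.card_eq_zero, Finset.filter_eq_empty_iff]
    intro i h1 h2
    obtain rfl := hi i h1 h2
    exact h10 (hg.unique h2)

theorem Gap.periodic (hper : ∀ t, h (t + n) ↔ h t) : Gap h (t + n) d ↔ Gap h t d := by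
  have : ∀ k, h (t + n + k) ↔ h (t + k) := fun k => by
    rw [show t + n + k = t + k + n by omega, hper]
  simp only [Gap, hper, this]

theorem flips_periodic (hper : ∀ t, h (t + n) ↔ h t) (m : ℕ) : flips h m (m + n) = flips h 0 n := by
  classical
  have hp : Function.Periodic (fun t => Gap h t 10) n := fun t => propext (Gap.periodic hper)
  have h1 := Nat.filter_Ico_card_eq_of_periodic m n _ hp
  have h2 := Nat.filter_Ico_card_eq_of_periodic 0 n _ hp
  rw [Nat.zero_add] at h2
  unfold flips
  convert h1.trans h2.symm

/-- Labels between consecutive pendant edges. -/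
theorem Gap.conn (hg : Gap h t d) {s s' : Bool} (ha : Arc d s s') :
    Conn h t (t + d) (st s) (st s') := by
  have := Conn.shift (h' := h) ha t fun k _ hkd hk => by
    by_contra hne
    exact hg.2.2.2 k (by omega) (by omega) (by rwa [Nat.add_comm])
  rwa [Nat.zero_add, Nat.add_comm d t] at this

theorem Gap.arc (hg : Gap h t d) {a : ℕ → ℕ}
    (ha : ∀ t, Win (h t) (h (t + 1)) (a t) (a (t + 1)) (a (t + 2))) {s s' : Bool}
    (hs : (a t, a (t + 1)) = st s) (hs' : (a (t + d), a (t + d + 1)) = st s') : Arc d s s' := by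
  refine ⟨fun k => a (t + k), hs, hs', fun k _ _ => (ha (t + k)).mono ?_ ?_⟩
  · rintro (rfl | rfl)
    · exact hg.2.1
    · exact hg.2.2.1
  · rintro (h | rfl)
    · omega
    · exact hg.2.2.1

/-- Walk from pendant edge to pendant edge, changing the state only at distance `10`. -/
theorem conn_turn (hgap : ∀ t d, Gap h t d → d = 4 ∨ 8 ≤ d) (hm : h m) (s : Bool) (hmt : m ≤ t)
    (ht : h t) : Conn h m t (st s) (st (turn (flips h m t) s)) := by
  refine (gap_induction hm (P := fun t => m ≤ t ∧ Conn h m t (st s) (st (turn (flips h m t) s)))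
    ⟨le_rfl, ?_⟩ ?_ hmt ht).2
  · rw [flips_self]
    exact Conn.refl _ _
  · rintro t d hmt hg ⟨-, hc⟩
    refine ⟨by omega, hc.trans hmt (by omega) ?_⟩
    have h1 := hg.conn (arc_of_gap (hgap t d hg) (turn (flips h m t) s))
    rw [flips_add hmt hg]
    split_ifs at h1 ⊢
    · rwa [turn_succ]
    · exact h1

/-- Labels along a closed walk are continued periodically. -/
theorem exists_periodic (hn : 2 ≤ n) (hper : ∀ t, h (t + n) ↔ h t) {x : ℕ × ℕ}
    (hc : Conn h m (m + n) x x) : ∃ a : ℕ → ℕ, (∀ t, a (t + n) = a t) ∧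
      ∀ t, Win (h t) (h (t + 1)) (a t) (a (t + 1)) (a (t + 2)) := by
  obtain ⟨a, ha, ha', hw⟩ := hc
  have haa : (a (m + n), a (m + n + 1)) = (a m, a (m + 1)) := ha'.trans ha.symm
  simp only [Prod.mk.injEq] at haa
  have hmod : ∀ u, h (u % n) ↔ h u := by
    intro u
    have : ∀ q r, h (r + n * q) ↔ h r := by
      intro q r
      induction q with
      | zero => simp
      | succ q ih => rw [Nat.mul_succ, ← Nat.add_assoc, hper, ih]
    conv_rhs => rw [← Nat.mod_add_div u n]
    rw [this]
  have hmod' : ∀ u v, u % n = v % n → (h u ↔ h v) := fun u v e => by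
    rw [← hmod u, ← hmod v, e]
  -- the residue of `t` modulo `n`, counted from `m`
  let r : ℕ → ℕ := fun t => (t + m * (n - 1)) % n
  have hr : ∀ t, r t < n := fun t => Nat.mod_lt _ (by omega)
  have hrt : ∀ t, (m + r t) % n = t % n := by
    intro t
    simp only [r]
    rw [Nat.add_mod_mod, show m + (t + m * (n - 1)) = t + m * n by
      obtain ⟨k, rfl⟩ : ∃ k, n = k + 1 := ⟨n - 1, by omega⟩
      simp only [Nat.add_sub_cancel]
      ring, Nat.add_mul_mod_self_right]
  have hstep : ∀ t k, r (t + k) = (r t + k) % n := by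
    intro t k
    simp only [r]
    rw [Nat.mod_add_mod]
    congr 1
    omega
  have hwrap : ∀ u ≤ n + 1, a (m + u % n) = a (m + u) := by
    intro u hu
    by_cases h1 : u < n
    · rw [Nat.mod_eq_of_lt h1]
    · rw [Nat.mod_eq_sub_mod (by omega), Nat.mod_eq_of_lt (by omega)]
      by_cases h2 : u = n
      · rw [h2, Nat.sub_self]
        exact haa.1.symm
      · rw [show u = n + 1 by omega, show n + 1 - n = 1 by omega]
        exact haa.2.symm
  refine ⟨fun t => a (m + r t), fun t => ?_, fun t => ?_⟩
  · dsimp only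
    rw [hstep, Nat.add_mod_right, Nat.mod_eq_of_lt (hr t)]
  · dsimp only
    have hrn := hr t
    rw [hstep t 1, hstep t 2, hwrap (r t + 1) (by omega), hwrap (r t + 2) (by omega)]
    refine (hw (m + r t) (by omega) (by omega)).mono (hmod' _ _ (hrt t)).mpr ?_
    refine (hmod' _ _ ?_).mpr
    rw [Nat.add_mod, hrt, ← Nat.add_mod]

/-- Labels of a closed walk without pendant edges. -/
theorem exists_conn_of_no_hair (hn : 3 ≤ n) : ∃ x, Conn (fun _ => False) 0 n x x := by
  by_cases h5 : n = 5
  · subst h5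
    exact ⟨_, conn_of_word [0, 3, 1, 4, 2, 0, 3] 5 (by decide)⟩
  refine ⟨(4, 0), ?_⟩
  have three : Conn (fun _ => False) 0 3 (4, 0) (4, 0) := conn_of_word [4, 0, 2, 4, 0] 3 (by decide)
  have four : Conn (fun _ => False) 0 4 (4, 0) (4, 0) :=
    conn_of_word [4, 0, 3, 1, 4, 0] 4 (by decide)
  have add : ∀ i j, Conn (fun _ => False) 0 i (4, 0) (4, 0) →
      Conn (fun _ => False) 0 j (4, 0) (4, 0) → Conn (fun _ => False) 0 (i + j) (4, 0) (4, 0) := by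
    intro i j h1 h2
    have := h2.shift (h' := fun _ => False) i fun _ _ _ h => h
    rw [Nat.zero_add, Nat.add_comm j i] at this
    exact h1.trans (by omega) (by omega) this
  induction n using Nat.strong_induction_on with
  | _ n ih =>
    by_cases h3 : n = 3
    · exact h3 ▸ three
    by_cases h4 : n = 4
    · exact h4 ▸ four
    by_cases h8 : n = 8
    · exact h8 ▸ add 4 4 four four
    · by_cases h7 : n = 7
      · exact h7 ▸ add 4 3 four three
      have := add (n - 3) 3 (ih (n - 3) (by omega) (by omega) (by omega)) three
      rwa [Nat.sub_add_cancel hn] at this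

/-- Labels along a cycle with pendant edges exist if the distances allow it. Changes of the state
are forced at distance `10`; their number can be corrected at a distance of at least `13`. -/
theorem exists_labels (hn : 3 ≤ n) (hper : ∀ t, h (t + n) ↔ h t)
    (hgap : ∀ t d, Gap h t d → d = 4 ∨ 8 ≤ d)
    (hpar : Even (flips h 0 n) ∨ ∃ t d, Gap h t d ∧ 13 ≤ d) :
    ∃ a : ℕ → ℕ, (∀ t, a (t + n) = a t) ∧
      ∀ t, Win (h t) (h (t + 1)) (a t) (a (t + 1)) (a (t + 2)) := by
  by_cases hno : ∀ t, ¬ h t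
  · obtain rfl : h = fun _ => False := funext fun t => eq_false (hno t)
    obtain ⟨x, hx⟩ := exists_conn_of_no_hair hn
    exact exists_periodic (m := 0) (by omega) hper (by rwa [Nat.zero_add])
  push Not at hno
  rcases hpar with hev | ⟨m, d, hg, hd⟩
  · obtain ⟨m, hm⟩ := hno
    have := conn_turn hgap hm true (Nat.le_add_right m n) ((hper m).mpr hm)
    rw [flips_periodic hper, turn_eq_self.mpr hev] at this
    exact exists_periodic (by omega) hper this
  · have hm := hg.2.1
    have hle : m + d ≤ m + n := by
      obtain ⟨d', hd', hle⟩ := exists_gap hm ((hper m).mpr hm) (by omega)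
      rwa [hg.unique hd']
    -- the state after the long distance is chosen such that the walk closes up
    have h2 := conn_turn hgap hg.2.2.1 (turn (flips h (m + d) (m + n)) true) hle ((hper m).mpr hm)
    rw [turn_turn] at h2
    have h1 : Arc d true (turn (flips h (m + d) (m + n)) true) := by
      unfold turn
      split_ifs
      · exact keep_of_le (by omega) true
      · exact flip_of_le hd true
    exact exists_periodic (by omega) hper ((hg.conn h1).trans (by omega) hle h2)

theorem labels_distance (hper : ∀ t, h (t + n) ↔ h t) {a : ℕ → ℕ} (hpa : ∀ t, a (t + n) = a t)
    (ha : ∀ t, Win (h t) (h (t + 1)) (a t) (a (t + 1)) (a (t + 2))) :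
    (∀ t d, Gap h t d → d = 4 ∨ 8 ≤ d) ∧
      (Even (flips h 0 n) ∨ ∃ t d, Gap h t d ∧ 13 ≤ d) := by
  have hst : ∀ t, h t → ∃ s, (a t, a (t + 1)) = st s := fun t ht => exists_st (ha t) ht
  have harc : ∀ t d, Gap h t d → ∀ s s', (a t, a (t + 1)) = st s →
      (a (t + d), a (t + d + 1)) = st s' → (d = 4 ∨ 8 ≤ d) ∧ (d < 13 → (s' = s ↔ d ≠ 10)) :=
    fun t d hg s s' hs hs' => (hg.arc ha hs hs').distance hg.1
  refine ⟨fun t d hg => ?_, ?_⟩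
  · obtain ⟨s, hs⟩ := hst t hg.2.1
    obtain ⟨s', hs'⟩ := hst (t + d) hg.2.2.1
    exact (harc t d hg s s' hs hs').1
  by_contra! hcon
  obtain ⟨hodd, hlt⟩ := hcon
  by_cases hno : ∀ t, ¬ h t
  · refine hodd ?_
    have : flips h 0 n = 0 := by
      classical
      rw [flips, Finset.card_eq_zero, Finset.filter_eq_empty_iff]
      exact fun t _ hg => hno t hg.2.1
    rw [this]
    exact Even.zero
  push Not at hno
  obtain ⟨m, hm⟩ := hno
  obtain ⟨s, hs⟩ := hst m hm
  have key := gap_induction hm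
    (P := fun t => (a t, a (t + 1)) = st (turn (flips h m t) s)) ?_ ?_ (Nat.le_add_right m n)
    ((hper m).mpr hm)
  · rw [hpa, show m + n + 1 = m + 1 + n by omega, hpa, hs, flips_periodic hper] at key
    exact hodd (turn_eq_self.mp (st_injective key).symm)
  · rw [flips_self, hs]
    rfl
  · intro t d hmt hg hP
    obtain ⟨s', hs'⟩ := hst (t + d) hg.2.2.1
    have h1 := (harc t d hg _ s' hP hs').2 (hlt t d hg)
    rw [hs', flips_add hmt hg]
    congr 1
    split_ifs with h10
    · rw [turn_succ]
      have : s' ≠ turn (flips h m t) s := fun e => h1.mp e h10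
      revert this
      generalize turn (flips h m t) s = u
      cases s' <;> cases u <;> simp
    · exact h1.mpr h10

end

/-! ### Hairy vertices -/

section
variable {V : Type} {H : SimpleGraph V} {S : Set V}

theorem neighborSet_inr (s : S) : (withPendants H S).neighborSet (.inr s) = {.inl s.1} := by
  ext (a | t)
  · change a = s.1 ↔ _
    simp
  · change False ↔ _
    simp

theorem neighborSet_inl_of_mem {v : V} (hv : v ∈ S) : (withPendants H S).neighborSet (.inl v) =
    insert (.inr ⟨v, hv⟩) (Sum.inl '' H.neighborSet v) := by
  ext (a | t)
  · change H.Adj v a ↔ _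
    simp
  · change v = t.1 ↔ _
    simp only [Set.mem_insert_iff, Sum.inr.injEq, Set.mem_image, reduceCtorEq, and_false, exists_false,
      or_false]
    exact ⟨fun h => Subtype.ext h.symm, fun h => by rw [h]⟩

theorem neighborSet_inl_of_notMem {v : V} (hv : v ∉ S) : (withPendants H S).neighborSet (.inl v) =
    Sum.inl '' H.neighborSet v := by
  ext (a | t)
  · change H.Adj v a ↔ _
    simp
  · change v = t.1 ↔ _
    simp only [Set.mem_image, reduceCtorEq, and_false, exists_false, iff_false]
    exact fun h => hv (h ▸ t.2)

theorem isHairy_inl [Finite V] (hH : ∀ v, (H.neighborSet v).ncard ≤ 2) {v : V} :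
    IsHairy (withPendants H S) (.inl v) ↔ v ∈ S ∧ (H.neighborSet v).ncard = 2 := by
  have himg : (Sum.inl '' H.neighborSet v : Set (V ⊕ S)).ncard = (H.neighborSet v).ncard :=
    Set.ncard_image_of_injective _ Sum.inl_injective
  constructor
  · rintro ⟨h3, -⟩
    by_cases hv : v ∈ S
    · rw [neighborSet_inl_of_mem hv, Set.ncard_insert_of_notMem (by simp), himg] at h3
      exact ⟨hv, by omega⟩
    · rw [neighborSet_inl_of_notMem hv, himg] at h3
      have := hH v
      omega
  · rintro ⟨hv, h2⟩
    refine ⟨?_, .inr ⟨v, hv⟩, ?_, ?_⟩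
    · rw [neighborSet_inl_of_mem hv, Set.ncard_insert_of_notMem (by simp), himg, h2]
    · rfl
    · rw [neighborSet_inr, Set.ncard_singleton]

end

theorem ncard_neighborSet_cycleGraph {n : ℕ} (hn : 3 ≤ n) (i : Fin n) :
    ((SimpleGraph.cycleGraph n).neighborSet i).ncard = 2 := by
  have hi := i.2
  have hmod : ∀ t < n, (t + 1) % n = if t + 1 = n then 0 else t + 1 := by
    intro t ht
    split_ifs with h
    · rw [h, Nat.mod_self]
    · exact Nat.mod_eq_of_lt (by omega)
  rw [Set.ncard_eq_two]
  refine ⟨⟨(i.val + 1) % n, Nat.mod_lt _ (by omega)⟩,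
    ⟨if i.val = 0 then n - 1 else i.val - 1, by split_ifs <;> omega⟩, ?_, ?_⟩
  · intro h
    have h := congrArg Fin.val h
    dsimp only at h
    rw [hmod i hi] at h
    split_ifs at h <;> omega
  · ext j
    have hj := j.2
    rw [SimpleGraph.mem_neighborSet, cycleGraph_adj_iff hn]
    simp only [Set.mem_insert_iff, Set.mem_singleton_iff, Fin.ext_iff]
    refine or_congr_right ?_
    rw [hmod j hj]
    split_ifs <;> omega

theorem isHairy_genCycle {n : ℕ} (hn : 3 ≤ n) {S : Set (Fin n)} {i : Fin n} :
    IsHairy (genCycle n S) (.inl i) ↔ i ∈ S := by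
  rw [isHairy_inl fun v => (ncard_neighborSet_cycleGraph hn v).le,
    and_iff_left (ncard_neighborSet_cycleGraph hn i)]

theorem isHairy_genPath {n : ℕ} {S : Set (Fin n)} {i : Fin n} :
    IsHairy (genPath n S) (.inl i) ↔ i ∈ S ∧ 0 < i.val ∧ i.val + 1 < n := by
  have hsub : ∀ v : Fin n, (SimpleGraph.pathGraph n).neighborSet v ⊆
      {⟨v.val - 1, by omega⟩, ⟨min (v.val + 1) (n - 1), by omega⟩} := by
    intro v w hw
    rw [SimpleGraph.mem_neighborSet, SimpleGraph.pathGraph_adj] at hw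
    simp only [Set.mem_insert_iff, Set.mem_singleton_iff, Fin.ext_iff]
    omega
  have hle : ∀ v : Fin n, ((SimpleGraph.pathGraph n).neighborSet v).ncard ≤ 2 := fun v =>
    (Set.ncard_le_ncard (hsub v) (Set.toFinite _)).trans (Set.ncard_insert_le _ _ |>.trans (by simp))
  rw [isHairy_inl hle]
  refine and_congr_right fun _ => ⟨fun h => ?_, fun ⟨h0, h1⟩ => ?_⟩
  · by_contra hcon
    -- an end of the path has at most one neighbour
    have hone : ∃ w, (SimpleGraph.pathGraph n).neighborSet i ⊆ {w} := by
      by_cases h0 : i.val = 0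
      · refine ⟨⟨min (i.val + 1) (n - 1), by omega⟩, fun w hw => ?_⟩
        rw [SimpleGraph.mem_neighborSet, SimpleGraph.pathGraph_adj] at hw
        simp only [Set.mem_singleton_iff, Fin.ext_iff]
        omega
      · refine ⟨⟨i.val - 1, by omega⟩, fun w hw => ?_⟩
        rw [SimpleGraph.mem_neighborSet, SimpleGraph.pathGraph_adj] at hw
        simp only [Set.mem_singleton_iff, Fin.ext_iff]
        omega
    obtain ⟨w, hw⟩ := hone
    have := Set.ncard_le_ncard hw (Set.toFinite _)
    rw [Set.ncard_singleton] at this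
    omega
  · rw [Set.ncard_eq_two]
    refine ⟨⟨i.val - 1, by omega⟩, ⟨i.val + 1, h1⟩, ?_, ?_⟩
    · rw [Ne, Fin.ext_iff]
      dsimp only
      omega
    · ext w
      rw [SimpleGraph.mem_neighborSet, SimpleGraph.pathGraph_adj]
      simp only [Set.mem_insert_iff, Set.mem_singleton_iff, Fin.ext_iff]
      omega

/-! ### From labels of sequences to labelings of graphs and back -/

/-- A graph made of directed cycles, given by the relation `Nx` between a vertex and the next one,
with pendant edges attached: labels `α v` and `β v` before and after each vertex `v` give a labeling
in which all pendant edges have label `2`. -/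
theorem exists_isLab_of_next {V : Type} {H : SimpleGraph V} {S : Set V} {Nx : V → V → Prop}
    (hH : ∀ u v, H.Adj u v ↔ Nx u v ∨ Nx v u) (htot : ∀ u, ∃ v, Nx u v)
    (hdet : ∀ {u v w}, Nx u v → Nx u w → v = w) (hinj : ∀ {u v w}, Nx u w → Nx v w → u = v)
    (hasymm : ∀ {u v}, Nx u v → ¬ Nx v u) {α β : V → ℕ} (hαβ : ∀ {u v}, Nx u v → β u = α v)
    (hW : ∀ {u v}, Nx u v → Win (u ∈ S) (v ∈ S) (α u) (β u) (β v)) :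
    ∃ g, IsLab (withPendants H S) 4 g := by
  classical
  let g : V ⊕ S → V ⊕ S → ℕ := fun x y => match x, y with
    | .inl u, .inl v => if Nx u v then β u else if Nx v u then β v else 0
    | _, _ => 2
  have g1 : ∀ {u v}, Nx u v → g (.inl u) (.inl v) = β u := fun h => if_pos h
  have g2 : ∀ {u v}, Nx v u → g (.inl u) (.inl v) = α u := fun {u v} h => by
    change (if Nx u v then β u else if Nx v u then β v else 0) = α u
    rw [if_neg (hasymm h), if_pos h, hαβ h]
  have g3 : ∀ {u} (s : S), g (.inl u) (.inr s) = 2 := fun s => rfl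
  -- the three kinds of edges at a vertex
  have hadj : ∀ {v x}, (withPendants H S).Adj (.inl v) x →
      (∃ w, Nx v w ∧ x = .inl w ∧ g (.inl v) x = β v) ∨
      (∃ w, Nx w v ∧ x = .inl w ∧ g (.inl v) x = α v) ∨
      (∃ s : S, v = s.1 ∧ x = .inr s ∧ g (.inl v) x = 2) := by
    rintro v (w | s) h
    · rcases (hH v w).mp h with h | h
      · exact .inl ⟨w, h, rfl, g1 h⟩
      · exact .inr (.inl ⟨w, h, rfl, g2 h⟩)
    · exact .inr (.inr ⟨s, h, rfl, g3 (u := v) s⟩)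
  have hinr : ∀ {s : S} {x}, (withPendants H S).Adj (.inr s) x → x = .inl s.1 := by
    rintro s (w | t) h
    · exact congrArg _ h
    · exact h.elim
  have hsymm : ∀ x y, g x y = g y x := by
    rintro (u | s) (v | t)
    · change (if Nx u v then β u else if Nx v u then β v else 0) =
        (if Nx v u then β v else if Nx u v then β u else 0)
      by_cases h : Nx u v
      · rw [if_pos h, if_neg (hasymm h), if_pos h]
      · rw [if_neg h, if_neg h]
    all_goals rfl
  have hfar : ∀ {u v x y}, Nx u v → (withPendants H S).Adj (.inl u) x →
      (withPendants H S).Adj (.inl v) y → x ≠ .inl v → y ≠ .inl u →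
      g (.inl u) x ≠ g (.inl v) y := by
    intro u v x y h hx hy hxv hyu
    have hw := hW h
    obtain ⟨-, w2, w3, w4, w5, w6⟩ := hw
    rcases hadj hx with ⟨w, hw, rfl, hgx⟩ | ⟨w, hw, rfl, hgx⟩ | ⟨s, hs, rfl, hgx⟩
    · exact absurd (congrArg _ (hdet hw h)) hxv
    · rcases hadj hy with ⟨w', hw', rfl, hgy⟩ | ⟨w', hw', rfl, hgy⟩ | ⟨s', hs', rfl, hgy⟩
      · rw [hgx, hgy]; exact w4
      · exact absurd (congrArg _ (hinj hw' h)) hyu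
      · rw [hgx, hgy]; exact (w6 (hs' ▸ s'.2)).2.2
    · have w5 := w5 (hs ▸ s.2)
      rcases hadj hy with ⟨w', hw', rfl, hgy⟩ | ⟨w', hw', rfl, hgy⟩ | ⟨s', hs', rfl, hgy⟩
      · rw [hgx, hgy]; exact w5.2.2.symm
      · exact absurd (congrArg _ (hinj hw' h)) hyu
      · have w6 := w6 (hs' ▸ s'.2)
        omega
  refine ⟨g, hsymm, ?_, ?_, ?_⟩
  · rintro (u | s) y h
    · obtain ⟨v, hv⟩ := htot u
      have := hW hv
      rcases hadj h with ⟨w, -, -, hg⟩ | ⟨w, -, -, hg⟩ | ⟨s, -, -, hg⟩ <;> omega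
    · rw [hinr h]
      exact Nat.le_of_ble_eq_true rfl
  · rintro (v | s) x y hx hy hne
    · obtain ⟨v', hv'⟩ := htot v
      obtain ⟨-, w2, -, -, w5, -⟩ := hW hv'
      rcases hadj hx with ⟨w, hw, rfl, hgx⟩ | ⟨w, hw, rfl, hgx⟩ | ⟨s, hs, rfl, hgx⟩ <;>
        rcases hadj hy with ⟨w', hw', rfl, hgy⟩ | ⟨w', hw', rfl, hgy⟩ | ⟨s', hs', rfl, hgy⟩ <;>
        simp only [hgx, hgy]
      · exact absurd (congrArg _ (hdet hw hw')) hne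
      · exact w2.symm
      · have := w5 (hs' ▸ s'.2); omega
      · exact w2
      · exact absurd (congrArg _ (hinj hw hw')) hne
      · have := w5 (hs' ▸ s'.2); omega
      · have := w5 (hs ▸ s.2); omega
      · have := w5 (hs ▸ s.2); omega
      · exact absurd (congrArg Sum.inr (Subtype.ext (hs.symm.trans hs'))) hne
    · exact absurd ((hinr hx).trans (hinr hy).symm) hne
  · rintro (u | s) (v | t) x y h hx hy hxv hyu
    · rcases (hH u v).mp h with h | h
      · exact hfar h hx hy hxv hyu
      · exact (hfar h hy hx hyu hxv).symm
    · exact absurd ((hinr hy).trans (hinr h.symm).symm) hyu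
    · exact absurd ((hinr hx).trans (hinr h).symm) hxv
    · exact absurd ((hinr hx).trans (hinr h).symm) hxv

/-- The labels on a path of three edges at whose inner vertices further edges labeled `2` may be
attached. -/
theorem IsLab.win {V : Type} {G : SimpleGraph V} {g : V → V → ℕ} (hg : IsLab G 4 g)
    {x₀ x₁ x₂ x₃ : V} (h01 : G.Adj x₀ x₁) (h12 : G.Adj x₁ x₂) (h23 : G.Adj x₂ x₃) (h02 : x₀ ≠ x₂)
    (h13 : x₁ ≠ x₃) {p q : Prop} (hp : p → ∃ y, G.Adj x₁ y ∧ y ≠ x₀ ∧ y ≠ x₂ ∧ g x₁ y = 2)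
    (hq : q → ∃ y, G.Adj x₂ y ∧ y ≠ x₁ ∧ y ≠ x₃ ∧ g x₂ y = 2) :
    Win p q (g x₀ x₁) (g x₁ x₂) (g x₂ x₃) := by
  have l0 := hg.le h01
  have l1 := hg.le h12
  have l2 := hg.le h23
  have s1 := hg.sep h01.symm h12 h02
  have s2 := hg.sep h12.symm h23 h13
  have f := hg.far h12 h01.symm h23 h02 h13.symm
  rw [hg.symm x₁ x₀] at s1 f
  rw [hg.symm x₂ x₁] at s2
  refine ⟨⟨l0, l1, l2⟩, s1, s2, f, fun h => ?_, fun h => ?_⟩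
  · obtain ⟨y, hy, hy0, hy2, h2⟩ := hp h
    have t1 := hg.sep hy h01.symm hy0
    have t2 := hg.sep hy h12 hy2
    have t3 := hg.far h12 hy h23 hy2 h13.symm
    rw [hg.symm x₁ x₀] at t1
    omega
  · obtain ⟨y, hy, hy1, hy3, h2⟩ := hq h
    have t1 := hg.sep hy h12.symm hy1
    have t2 := hg.sep hy h23 hy3
    have t3 := hg.far h12.symm hy h01.symm hy1 h02
    rw [hg.symm x₂ x₁] at t1
    rw [hg.symm x₁ x₀] at t3
    omega

/-! ### Generalized cycles -/

/-- The positions of the pendant edges of a generalized cycle, when going around it repeatedly. -/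
def around {n : ℕ} (S : Set (Fin n)) (t : ℕ) : Prop := ∃ i ∈ S, i.val = t % n

section
variable {n : ℕ} {S : Set (Fin n)}

theorem around_iff {t : ℕ} {i : Fin n} (h : i.val = t % n) : around S t ↔ i ∈ S :=
  ⟨fun ⟨j, hj, hjt⟩ => by rwa [show i = j from Fin.ext (h.trans hjt.symm)], fun hi => ⟨i, hi, h⟩⟩

theorem around_val {i : Fin n} : around S i.val ↔ i ∈ S :=
  around_iff (Nat.mod_eq_of_lt i.2).symm

theorem around_add (t : ℕ) : around S (t + n) ↔ around S t := by simp [around]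

theorem mod_val_cases {n t : ℕ} (ht : t < n) :
    (t + 1) % n = if t + 1 = n then 0 else t + 1 := by
  split_ifs with h
  · rw [h, Nat.mod_self]
  · exact Nat.mod_eq_of_lt (by omega)

theorem exists_isLab_genCycle (hn : 3 ≤ n) {a : ℕ → ℕ} (hpa : ∀ t, a (t + n) = a t)
    (ha : ∀ t, Win (around S t) (around S (t + 1)) (a t) (a (t + 1)) (a (t + 2))) :
    ∃ g, IsLab (genCycle n S) 4 g := by
  have hmod : ∀ t < n, ∀ k, a ((t + 1) % n + k) = a (t + 1 + k) := by
    intro t ht k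
    rw [mod_val_cases ht]
    split_ifs with h
    · rw [h, Nat.add_comm n k, hpa, Nat.zero_add]
    · rfl
  refine exists_isLab_of_next (Nx := fun u v => v.val = (u.val + 1) % n) (α := fun u => a u)
    (β := fun u => a (u + 1)) (fun u v => cycleGraph_adj_iff hn)
    (fun u => ⟨⟨_, Nat.mod_lt _ (by omega)⟩, rfl⟩) (fun h1 h2 => Fin.ext (h1.trans h2.symm)) ?_ ?_ ?_ ?_
  · intro u v w h1 h2
    have hu := u.2
    have hv := v.2
    rw [mod_val_cases hu] at h1
    rw [mod_val_cases hv] at h2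
    refine Fin.ext ?_
    split_ifs at h1 h2 <;> omega
  · intro u v h1 h2
    have hu := u.2
    have hv := v.2
    rw [mod_val_cases hu] at h1
    rw [mod_val_cases hv] at h2
    split_ifs at h1 h2 <;> omega
  · intro u v h
    have := hmod u u.2 0
    rw [h]
    exact this.symm
  · intro u v h
    have h1 := hmod u u.2 1
    rw [h, h1]
    exact (ha u).mono around_val.mpr (around_iff h).mpr

theorem labels_of_genCycle (hn : 3 ≤ n) {g : Fin n ⊕ S → Fin n ⊕ S → ℕ}
    (hg : IsLab (genCycle n S) 4 g) : ∃ a : ℕ → ℕ, (∀ t, a (t + n) = a t) ∧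
      ∀ t, Win (around S t) (around S (t + 1)) (a t) (a (t + 1)) (a (t + 2)) := by
  let p : ℕ → Fin n ⊕ S := fun t => .inl ⟨t % n, Nat.mod_lt _ (by omega)⟩
  have hpp : ∀ t, p (t + n) = p t := fun t => by simp [p]
  have hadj : ∀ t, (genCycle n S).Adj (p t) (p (t + 1)) := by
    intro t
    change (SimpleGraph.cycleGraph n).Adj _ _
    rw [cycleGraph_adj_iff hn]
    left
    simp
  have hne : ∀ t, p t ≠ p (t + 2) := by
    intro t h
    have h := congrArg Fin.val (Sum.inl_injective h)
    have h1 : (t + 0) % n = (t + 2) % n := h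
    have := Nat.ModEq.add_left_cancel' t h1
    rw [Nat.ModEq, Nat.mod_eq_of_lt (by omega), Nat.mod_eq_of_lt (by omega)] at this
    omega
  have hhair : ∀ t, around S (t + 1) → ∃ y, (genCycle n S).Adj (p (t + 1)) y ∧ y ≠ p t ∧
      y ≠ p (t + 2) ∧ g (p (t + 1)) y = 2 := by
    rintro t ⟨i, hi, hit⟩
    have hi' : p (t + 1) = .inl i := congrArg _ (Fin.ext hit.symm)
    have hy : (genCycle n S).Adj (p (t + 1)) (.inr ⟨i, hi⟩) := by
      rw [hi']
      rfl
    refine ⟨_, hy, by simp [p], by simp [p], ?_⟩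
    have h0 := (hadj t).symm
    have h2 := hadj (t + 1)
    -- neither of the two neighbours on the cycle is a leaf
    rcases (hg.three hy h0 h2 (by simp [p]) (by simp [p]) (hne t)).2 with h | h | h
    · exact h
    · have := hg.leaf h0 hy h2 (by simp [p]) (hne t) (by simp [p]) h
        (x := p (t + (n - 1))) (by
          have := (hadj (t + (n - 1))).symm
          rwa [show t + (n - 1) + 1 = t + n by omega, hpp] at this)
      refine absurd this.symm ?_
      rw [← hpp (t + 1), show t + 1 + n = t + (n - 1) + 2 by omega]
      exact (hne _).symm
    · have := hg.leaf h2 hy h0 (by simp [p]) (hne t).symm (by simp [p]) h (hadj (t + 2))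
      exact absurd this.symm (hne (t + 1))
  refine ⟨fun t => g (p (t + (n - 1))) (p t), fun t => ?_, fun t => ?_⟩
  · dsimp only
    rw [show t + n + (n - 1) = t + (n - 1) + n by omega, hpp, hpp]
  · have e1 : p (t + 1 + (n - 1)) = p t := by rw [show t + 1 + (n - 1) = t + n by omega, hpp]
    have e2 : p (t + 2 + (n - 1)) = p (t + 1) := by
      rw [show t + 2 + (n - 1) = t + 1 + n by omega, hpp]
    have e0 : p (t + (n - 1) + 1) = p t := by rw [show t + (n - 1) + 1 = t + n by omega, hpp]
    have e3 : p (t + (n - 1) + 2) = p (t + 1) := by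
      rw [show t + (n - 1) + 2 = t + 1 + n by omega, hpp]
    dsimp only
    rw [e1, e2]
    refine hg.win (by rw [← e0]; exact hadj _) (hadj t) (hadj (t + 1)) (by rw [← e3]; exact hne _)
      (hne t) (fun h => ?_) (hhair t)
    have := hhair (t + (n - 1)) (by rwa [show t + (n - 1) + 1 = t + n by omega, around_add])
    rwa [e0, e3] at this

theorem stepForward_mem {i : Fin n} {d : ℕ} : stepForward i d ∈ S ↔ around S (i.val + d) :=
  (around_iff rfl).symm

theorem consecutiveOnCycle_iff (hn : 3 ≤ n) {i : Fin n} {d : ℕ} :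
    ConsecutiveOnCycle S i d ↔ Gap (around S) i.val d := by
  unfold ConsecutiveOnCycle Gap
  simp only [isHairy_genCycle hn, stepForward_mem, around_val]

theorem gap_mod {t d : ℕ} : Gap (around S) (t % n) d ↔ Gap (around S) t d := by
  have : ∀ q r, Gap (around S) (r + n * q) d ↔ Gap (around S) r d := by
    intro q r
    induction q with
    | zero => simp
    | succ q ih => rw [Nat.mul_succ, ← Nat.add_assoc, Gap.periodic around_add, ih]
  conv_rhs => rw [← Nat.mod_add_div t n]
  rw [this]

theorem cycleCondition_iff (hn : 3 ≤ n) : CycleCondition S ↔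
    (∀ t d, Gap (around S) t d → d = 4 ∨ 8 ≤ d) ∧
      (Even (flips (around S) 0 n) ∨ ∃ t d, Gap (around S) t d ∧ 13 ≤ d) := by
  have hex : ∀ {t d}, Gap (around S) t d → ∃ i : Fin n, ConsecutiveOnCycle S i d := fun {t d} h =>
    ⟨⟨t % n, Nat.mod_lt _ (by omega)⟩, (consecutiveOnCycle_iff hn).mpr (gap_mod.mpr h)⟩
  have hcard : {i : Fin n | ConsecutiveOnCycle S i 10}.ncard = flips (around S) 0 n := by
    classical
    rw [← Set.ncard_image_of_injective _ Fin.val_injective, flips, ← Set.ncard_coe_finset]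
    congr 1
    ext t
    simp only [Set.mem_image, Set.mem_ofPred_eq, Finset.coe_filter, Finset.mem_Ico,
      consecutiveOnCycle_iff hn]
    exact ⟨fun ⟨i, hi, h⟩ => h ▸ ⟨⟨Nat.zero_le _, i.2⟩, hi⟩, fun ⟨⟨_, h⟩, hg⟩ => ⟨⟨t, h⟩, hg, rfl⟩⟩
  unfold CycleCondition
  rw [hcard]
  refine and_congr ⟨fun h t d hg => ?_, fun h i d hc => h _ d ((consecutiveOnCycle_iff hn).mp hc)⟩
    (or_congr_right ⟨fun ⟨i, d, hc, hd⟩ => ⟨i, d, (consecutiveOnCycle_iff hn).mp hc, hd⟩,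
      fun ⟨t, d, hg, hd⟩ => ?_⟩)
  · obtain ⟨i, hi⟩ := hex hg
    exact h i d hi
  · obtain ⟨i, hi⟩ := hex hg
    exact ⟨i, d, hi, hd⟩

theorem lambdaEdge_genCycle_le_iff (hn : 3 ≤ n) :
    lambdaEdge (genCycle n S) ≤ 4 ↔ CycleCondition S := by
  rw [cycleCondition_iff hn, lambdaEdge_le_iff]
  constructor
  · rintro ⟨g, hg⟩
    obtain ⟨a, ha, ha'⟩ := labels_of_genCycle hn hg
    exact labels_distance around_add ha ha'
  · rintro ⟨h1, h2⟩
    obtain ⟨a, ha, ha'⟩ := exists_labels hn around_add h1 h2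
    exact exists_isLab_genCycle hn ha ha'

end

/-! ### Generalized paths -/

section
variable {n : ℕ} {S : Set (Fin n)}

theorem dist_genPath {i j : Fin n} (hij : i ≤ j) :
    (genPath n S).dist (.inl i) (.inl j) = j.val - i.val := by
  have hwalk : ∀ k (j : Fin n), j.val = i.val + k →
      ∃ w : (genPath n S).Walk (.inl i) (.inl j), w.length = k := by
    intro k
    induction k with
    | zero =>
      intro j hj
      obtain rfl : i = j := Fin.ext (by omega)
      exact ⟨.nil, rfl⟩
    | succ k ih =>
      intro j hj
      obtain ⟨w, hw⟩ := ih ⟨i.val + k, by omega⟩ rfl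
      have hadj : (genPath n S).Adj (.inl ⟨i.val + k, by omega⟩) (.inl j) := by
        change (SimpleGraph.pathGraph n).Adj _ _
        rw [SimpleGraph.pathGraph_adj]
        left
        dsimp only
        omega
      exact ⟨w.concat hadj, by rw [SimpleGraph.Walk.length_concat, hw]⟩
  -- along an edge, the position on the path changes by at most one
  let f : Fin n ⊕ S → ℕ := fun x => match x with
    | .inl i => i.val
    | .inr s => s.1.val
  have hf : ∀ x y, (genPath n S).Adj x y → f y ≤ f x + 1 := by
    rintro (i | s) (j | t) h
    · have h : (SimpleGraph.pathGraph n).Adj i j := h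
      rw [SimpleGraph.pathGraph_adj] at h
      change j.val ≤ i.val + 1
      omega
    · have h : i = t.1 := h
      change t.1.val ≤ i.val + 1
      rw [h]
      omega
    · have h : j = s.1 := h
      change j.val ≤ s.1.val + 1
      rw [h]
      omega
    · exact h.elim
  have hlip : ∀ x y (w : (genPath n S).Walk x y), f y ≤ f x + w.length := by
    intro x y w
    induction w with
    | nil => simp
    | cons h w ih =>
      have := hf _ _ h
      rw [SimpleGraph.Walk.length_cons]
      omega
  obtain ⟨w, hw⟩ := hwalk (j.val - i.val) j (by have : i.val ≤ j.val := hij; omega)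
  refine le_antisymm (hw ▸ SimpleGraph.dist_le w) ?_
  obtain ⟨w', hw'⟩ := (SimpleGraph.Walk.reachable w).exists_walk_length_eq_dist
  have : j.val ≤ i.val + w'.length := hlip _ _ w'
  omega

/-- At a vertex with three neighbours of which `x` is not a leaf, one of the edges other than the
one to `x` is labeled `2`. -/
theorem IsLab.exists_two {V : Type} {G : SimpleGraph V} {g : V → V → ℕ} (hg : IsLab G 4 g)
    {v x y z x' : V} (hx : G.Adj v x) (hy : G.Adj v y) (hz : G.Adj v z) (hxy : x ≠ y) (hxz : x ≠ z)
    (hyz : y ≠ z) (hx' : G.Adj x x') (hne : x' ≠ v) :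
    ∃ y' z', G.Adj v y' ∧ G.Adj v z' ∧ y' ≠ x ∧ z' ≠ x ∧ z' ≠ y' ∧ g v z' = 2 := by
  rcases (hg.three hx hy hz hxy hxz hyz).2 with h | h | h
  · exact absurd (hg.leaf hx hy hz hxy hxz hyz h hx') hne
  · exact ⟨z, y, hz, hy, hxz.symm, hxy.symm, hyz, h⟩
  · exact ⟨y, z, hy, hz, hxy.symm, hxz.symm, hyz.symm, h⟩

theorem distance_of_isLab_genPath {g : Fin n ⊕ S → Fin n ⊕ S → ℕ} (hg : IsLab (genPath n S) 4 g)
    {i j : Fin n} (hij : i < j) (hiS : i ∈ S) (hi0 : 0 < i.val) (hjS : j ∈ S)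
    (hj1 : j.val + 1 < n) : j.val - i.val = 4 ∨ 8 ≤ j.val - i.val := by
  have hij : i.val < j.val := hij
  have hadj : ∀ {a b : Fin n}, a.val + 1 = b.val → (genPath n S).Adj (.inl a) (.inl b) :=
    fun h => SimpleGraph.pathGraph_adj.mpr (.inl h)
  have hlr : ∀ {a b : Fin n}, a.val ≠ b.val → (Sum.inl a : Fin n ⊕ S) ≠ .inl b :=
    fun h e => h (congrArg Fin.val (Sum.inl_injective e))
  -- the edge before `i` and the edge after `j` are chosen such that they are not labeled `2`
  obtain ⟨y, z, hy, hz, hyx, hzx, hzy, h2⟩ := hg.exists_two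
    (v := .inl i) (x := .inl ⟨i.val + 1, by omega⟩) (y := .inl ⟨i.val - 1, by omega⟩)
    (z := .inr ⟨i, hiS⟩) (x' := .inl ⟨i.val + 2, by omega⟩) (hadj rfl)
    (hadj (by dsimp only; omega)).symm rfl (hlr (by dsimp only; omega)) (by simp) (by simp)
    (hadj (by dsimp only)) (hlr (by dsimp only; omega))
  obtain ⟨y', z', hy', hz', hyx', hzx', hzy', h2'⟩ := hg.exists_two
    (v := .inl j) (x := .inl ⟨j.val - 1, by omega⟩) (y := .inl ⟨j.val + 1, by omega⟩)
    (z := .inr ⟨j, hjS⟩) (x' := .inl ⟨j.val - 2, by omega⟩) (hadj (by dsimp only; omega)).symm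
    (hadj rfl) rfl (hlr (by dsimp only; omega)) (by simp) (by simp)
    (hadj (by dsimp only; omega)).symm (hlr (by dsimp only; omega))
  obtain ⟨d, hd⟩ : ∃ d, j.val = i.val + d := ⟨j.val - i.val, by omega⟩
  rw [hd, Nat.add_sub_cancel_left]
  have hd0 : 0 < d := by omega
  let p : ℕ → Fin n ⊕ S := fun t => if t = 0 then y else if h : t ≤ d + 1 then
    .inl ⟨i.val + (t - 1), by omega⟩ else y'
  have p0 : p 0 = y := rfl
  have pm : ∀ t, 0 < t → ∀ (h : t ≤ d + 1), p t = .inl ⟨i.val + (t - 1), by omega⟩ := by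
    intro t h0 h
    simp only [p]
    rw [if_neg (by omega), dif_pos h]
  have p1 : p 1 = .inl i := pm 1 (by omega) (by omega)
  have pd : p (d + 1) = .inl j := by
    rw [pm (d + 1) (by omega) le_rfl]
    exact congrArg _ (Fin.ext (by dsimp only; omega))
  have pd' : p d = .inl ⟨j.val - 1, by omega⟩ := by
    rw [pm d hd0 (by omega)]
    exact congrArg _ (Fin.ext (by dsimp only; omega))
  have p2 : p 2 = .inl ⟨i.val + 1, by omega⟩ := pm 2 (by omega) (by omega)
  have pe : p (d + 2) = y' := by
    simp only [p]
    rw [if_neg (by omega), dif_neg (by omega)]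
  have padj : ∀ t ≤ d + 1, (genPath n S).Adj (p t) (p (t + 1)) := by
    intro t ht
    by_cases h0 : t = 0
    · rw [h0, p0, Nat.zero_add, p1]
      exact hy.symm
    by_cases h1 : t = d + 1
    · rw [h1, pd, pe]
      exact hy'
    · rw [pm t (by omega) ht, pm (t + 1) (by omega) (by omega)]
      exact hadj (by dsimp only; omega)
  have pne : ∀ t ≤ d, p t ≠ p (t + 2) := by
    intro t ht
    by_cases h0 : t = 0
    · rw [h0, p0, Nat.zero_add, p2]
      exact hyx
    by_cases h1 : t = d
    · rw [h1, pd', pe]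
      exact hyx'.symm
    · rw [pm t (by omega) (by omega), pm (t + 2) (by omega) (by omega)]
      exact hlr (by dsimp only; omega)
  have hwin : ∀ t < d, Win (t = 0 ∨ t = d) (t + 1 = 0 ∨ t + 1 = d) (g (p t) (p (t + 1)))
      (g (p (t + 1)) (p (t + 2))) (g (p (t + 2)) (p (t + 3))) := by
    intro t ht
    refine hg.win (padj t (by omega)) (padj (t + 1) (by omega)) (padj (t + 2) (by omega))
      (pne t (by omega)) (pne (t + 1) (by omega)) (fun h => ?_) fun h => ?_
    · obtain rfl : t = 0 := by omega
      change ∃ y, (genPath n S).Adj (p 1) y ∧ y ≠ p 0 ∧ y ≠ p 2 ∧ g (p 1) y = 2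
      rw [p0, p1, p2]
      exact ⟨z, hz, hzy, hzx, h2⟩
    · have htd : t + 1 = d := by omega
      change ∃ y, (genPath n S).Adj (p (t + 2)) y ∧ y ≠ p (t + 1) ∧ y ≠ p (t + 3) ∧ g (p (t + 2)) y = 2
      rw [show t + 2 = d + 1 by omega, show t + 3 = d + 2 by omega, htd, pd', pd, pe]
      exact ⟨z', hz', hzx', hzy', h2'⟩
  obtain ⟨s, hs⟩ := exists_st (hwin 0 hd0) (.inl rfl)
  have hlast := hwin (d - 1) (by omega)
  rw [show d - 1 + 1 = d by omega, show d - 1 + 2 = d + 1 by omega,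
    show d - 1 + 3 = d + 2 by omega] at hlast
  obtain ⟨s', hs'⟩ := exists_st' hlast (.inr rfl)
  have harc : Arc d s s' := ⟨fun t => g (p t) (p (t + 1)), hs, hs', fun t _ ht => hwin t ht⟩
  exact (harc.distance hd0).1

/-- The inner vertices of a generalized path that carry a pendant edge, in a long cycle which
contains the path, including the pendant edges at its ends. -/
def innerPendants (S : Set (Fin n)) : Set (Fin (n + 20)) :=
  {k | ∃ i ∈ S, 0 < i.val ∧ i.val + 1 < n ∧ k.val = i.val + 1}

theorem exists_hom_genCycle : ∃ φ : genPath n S →g genCycle (n + 20) (innerPendants S),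
    Function.Injective φ := by
  classical
  have hmem : ∀ s : S, 0 < s.1.val ∧ s.1.val + 1 < n →
      (⟨s.1.val + 1, by omega⟩ : Fin (n + 20)) ∈ innerPendants S :=
    fun s h => ⟨s.1, s.2, h.1, h.2, rfl⟩
  let f : Fin n ⊕ S → Fin (n + 20) ⊕ innerPendants S := fun x => match x with
    | .inl i => .inl ⟨i.val + 1, by omega⟩
    | .inr s => if h : 0 < s.1.val ∧ s.1.val + 1 < n then .inr ⟨_, hmem s h⟩
      else if s.1.val = 0 then .inl ⟨0, by omega⟩ else .inl ⟨n + 1, by omega⟩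
  have f1 : ∀ (s : S) (h : 0 < s.1.val ∧ s.1.val + 1 < n), f (.inr s) = .inr ⟨_, hmem s h⟩ :=
    fun s h => dif_pos h
  have f2 : ∀ s : S, s.1.val = 0 → f (.inr s) = .inl ⟨0, by omega⟩ := fun s h => by
    simp only [f]
    rw [dif_neg (by omega), if_pos h]
  have f3 : ∀ s : S, s.1.val ≠ 0 → s.1.val + 1 = n → f (.inr s) = .inl ⟨n + 1, by omega⟩ :=
    fun s h h' => by
      simp only [f]
      rw [dif_neg (by omega), if_neg h]
  have hcases : ∀ s : S, (0 < s.1.val ∧ s.1.val + 1 < n) ∨ s.1.val = 0 ∨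
      (s.1.val ≠ 0 ∧ s.1.val + 1 = n) := fun s => by have := s.1.2; omega
  have hcyc : ∀ {a b : Fin (n + 20)}, a.val + 1 = b.val →
      (genCycle (n + 20) (innerPendants S)).Adj (.inl a) (.inl b) := by
    intro a b h
    change (SimpleGraph.cycleGraph (n + 20)).Adj a b
    rw [cycleGraph_adj_iff (by omega), h, Nat.mod_eq_of_lt b.2]
    exact .inl rfl
  have hpend : ∀ s : S, (genCycle (n + 20) (innerPendants S)).Adj
      (.inl ⟨s.1.val + 1, by omega⟩) (f (.inr s)) := by
    intro s
    rcases hcases s with h | h | h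
    · rw [f1 s h]
      rfl
    · rw [f2 s h]
      refine (hcyc ?_).symm
      dsimp only
      omega
    · rw [f3 s h.1 h.2]
      refine hcyc ?_
      dsimp only
      omega
  refine ⟨⟨f, ?_⟩, ?_⟩
  · rintro (i | s) (j | t) h
    · have h : (SimpleGraph.pathGraph n).Adj i j := h
      rw [SimpleGraph.pathGraph_adj] at h
      rcases h with h | h
      · exact hcyc (by dsimp only; omega)
      · exact (hcyc (by dsimp only; omega)).symm
    · have h : i = t.1 := h
      subst h
      exact hpend t
    · have h : j = s.1 := h
      subst h
      exact (hpend s).symm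
    · exact h.elim
  · have hinl : ∀ i : Fin n, f (.inl i) = .inl ⟨i.val + 1, by omega⟩ := fun _ => rfl
    have hmix : ∀ (i : Fin n) (s : S), f (.inl i) ≠ f (.inr s) := by
      intro i s h
      rw [hinl] at h
      rcases hcases s with h' | h' | h'
      · rw [f1 s h'] at h
        exact absurd h (by simp)
      · rw [f2 s h'] at h
        have := congrArg Fin.val (Sum.inl_injective h)
        dsimp only at this
        omega
      · rw [f3 s h'.1 h'.2] at h
        have := congrArg Fin.val (Sum.inl_injective h)
        dsimp only at this
        omega
    rintro (i | s) (j | t) h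
    · have := congrArg Fin.val (Sum.inl_injective h)
      dsimp only at this
      exact congrArg _ (Fin.ext (by omega))
    · exact absurd h (hmix i t)
    · exact absurd h.symm (hmix j s)
    · change f (.inr s) = f (.inr t) at h
      refine congrArg _ (Subtype.ext (Fin.ext ?_))
      rcases hcases s with hs | hs | hs <;> rcases hcases t with ht | ht | ht
      · rw [f1 s hs, f1 t ht] at h
        have := congrArg (fun x => x.1.val) (Sum.inr_injective h)
        dsimp only at this
        omega
      · rw [f1 s hs, f2 t ht] at h
        exact absurd h (by simp)
      · rw [f1 s hs, f3 t ht.1 ht.2] at h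
        exact absurd h (by simp)
      · rw [f2 s hs, f1 t ht] at h
        exact absurd h (by simp)
      · omega
      · rw [f2 s hs, f3 t ht.1 ht.2] at h
        have := congrArg Fin.val (Sum.inl_injective h)
        dsimp only at this
        omega
      · rw [f3 s hs.1 hs.2, f1 t ht] at h
        exact absurd h (by simp)
      · rw [f3 s hs.1 hs.2, f2 t ht] at h
        have := congrArg Fin.val (Sum.inl_injective h)
        dsimp only at this
        omega
      · omega

theorem around_innerPendants {t : ℕ} : around (innerPendants S) t ↔
    ∃ i ∈ S, 0 < i.val ∧ i.val + 1 < n ∧ t % (n + 20) = i.val + 1 := by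
  constructor
  · rintro ⟨k, ⟨i, hi, h0, h1, h2⟩, hk⟩
    exact ⟨i, hi, h0, h1, hk.symm.trans h2⟩
  · rintro ⟨i, hi, h0, h1, h2⟩
    exact ⟨⟨i.val + 1, by omega⟩, ⟨i, hi, h0, h1, rfl⟩, h2.symm⟩

/-- A short distance is one between vertices of the path, not across the rest of the long cycle. -/
theorem mod_add_of_around {t d : ℕ} (ht : around (innerPendants S) t) (hd : d ≤ 20) :
    (t + d) % (n + 20) = t % (n + 20) + d := by
  obtain ⟨i, -, h0, h1, h2⟩ := around_innerPendants.mp ht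
  rw [Nat.add_mod, h2, Nat.mod_eq_of_lt (show d < n + 20 by omega), Nat.mod_eq_of_lt (by omega)]

theorem gap_innerPendants (hS : PathCondition S) {t d : ℕ} (hg : Gap (around (innerPendants S)) t d) :
    d = 4 ∨ 8 ≤ d := by
  by_contra hcon
  have hd : d ≤ 20 := by omega
  obtain ⟨i, hi, hi0, hi1, hit⟩ := around_innerPendants.mp hg.2.1
  obtain ⟨j, hj, hj0, hj1, hjt⟩ := around_innerPendants.mp hg.2.2.1
  have hd0 := hg.1
  rw [mod_add_of_around hg.2.1 hd] at hjt
  have hij : i < j := by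
    rw [Fin.lt_def]
    omega
  have := hS i j ⟨hij, isHairy_genPath.mpr ⟨hi, hi0, hi1⟩, isHairy_genPath.mpr ⟨hj, hj0, hj1⟩,
    fun k hik hkj hk => ?_⟩
  · rw [dist_genPath hij.le] at this
    omega
  · obtain ⟨hk, hk0, hk1⟩ := isHairy_genPath.mp hk
    rw [Fin.lt_def] at hik hkj
    refine hg.2.2.2 (k.val - i.val) (by omega) (by omega) (around_innerPendants.mpr
      ⟨k, hk, hk0, hk1, ?_⟩)
    rw [mod_add_of_around hg.2.1 (by omega)]
    omega

/-- The distance across the rest of the long cycle is large. -/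
theorem exists_long_gap {t : ℕ} (ht : around (innerPendants S) t) :
    ∃ t d, Gap (around (innerPendants S)) t d ∧ 13 ≤ d := by
  by_contra! hcon
  have : ∀ k, ∃ t, around (innerPendants S) t ∧ k ≤ t % (n + 20) := by
    intro k
    induction k with
    | zero => exact ⟨t, ht, Nat.zero_le _⟩
    | succ k ih =>
      obtain ⟨t, ht, hk⟩ := ih
      obtain ⟨d, hd, -⟩ := exists_gap ht ((around_add t).mpr ht) (by omega)
      have h13 := hcon t d hd
      refine ⟨t + d, hd.2.2.1, ?_⟩
      rw [mod_add_of_around ht (by omega)]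
      have := hd.1
      omega
  obtain ⟨t, -, h⟩ := this (n + 20)
  have := Nat.mod_lt t (show 0 < n + 20 by omega)
  omega

theorem lambdaEdge_genPath_le_iff : lambdaEdge (genPath n S) ≤ 4 ↔ PathCondition S := by
  constructor
  · intro h
    obtain ⟨g, hg⟩ := (lambdaEdge_le_iff 4).mp h
    rintro i j ⟨hij, hi, hj, -⟩
    rw [isHairy_genPath] at hi hj
    rw [dist_genPath hij.le]
    exact distance_of_isLab_genPath hg hij hi.1 hi.2.1 hj.1 hj.2.2
  · intro hS
    obtain ⟨φ, hφ⟩ := exists_hom_genCycle (S := S)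
    refine (lambdaEdge_le_of_hom φ hφ).trans ((lambdaEdge_genCycle_le_iff (by omega)).mpr
      ((cycleCondition_iff (by omega)).mpr ⟨fun t d => gap_innerPendants hS, ?_⟩))
    by_cases hno : ∀ t, ¬ around (innerPendants S) t
    · left
      have : flips (around (innerPendants S)) 0 (n + 20) = 0 := by
        classical
        rw [flips, Finset.card_eq_zero, Finset.filter_eq_empty_iff]
        exact fun t _ hg => hno t hg.2.1
      rw [this]
      exact Even.zero
    · push Not at hno
      obtain ⟨t, ht⟩ := hno
      exact .inr (exists_long_gap ht)

end

end DistanceEdgeLabeling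

theorem mainTheorem3 :
    (∀ lam : ℕ, lam ≤ 4 →
      PolyTimeDecidable (fun G => lambdaEdge G.2 = lam) ∧
      PolyTimeDecidable (fun G => lambdaEdge G.2 ≤ lam) ∧
      PolyTimeSearch lam) ∧
    (∀ (N : ℕ) (G : SimpleGraph (Fin N)), G.Connected →
      (lambdaEdge G = 0 ↔
        Nonempty (G ≃g SimpleGraph.pathGraph 1) ∨ Nonempty (G ≃g SimpleGraph.pathGraph 2)) ∧
      lambdaEdge G ≠ 1 ∧
      (lambdaEdge G = 2 ↔ Nonempty (G ≃g SimpleGraph.pathGraph 3)) ∧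
      (lambdaEdge G = 3 ↔
        Nonempty (G ≃g SimpleGraph.pathGraph 4) ∨ Nonempty (G ≃g SimpleGraph.pathGraph 5)) ∧
      (lambdaEdge G ≤ 4 → IsGeneralizedPath G ∨ IsGeneralizedCycle G)) ∧
    (∀ (n : ℕ) (S : Set (Fin n)), 1 ≤ n → (lambdaEdge (genPath n S) ≤ 4 ↔ PathCondition S)) ∧
    (∀ (n : ℕ) (S : Set (Fin n)), 3 ≤ n → (lambdaEdge (genCycle n S) ≤ 4 ↔ CycleCondition S)) :=
  ⟨fun _ hlam => ⟨polyTimeDecidable_eq hlam, polyTimeDecidable_le hlam, polyTimeSearch hlam⟩,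
    fun _ _ hG => ⟨(lambdaEdge_small hG).1, (lambdaEdge_small hG).2.1, (lambdaEdge_small hG).2.2.1,
      (lambdaEdge_small hG).2.2.2, isGeneralized_of_lambdaEdge_le hG⟩,
    fun _ _ _ => lambdaEdge_genPath_le_iff, fun _ _ hn => lambdaEdge_genCycle_le_iff hn⟩
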